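/- **Setting.** Let $(E,\mathcal F,\mu)$ be a probability space with $L^2(\mu)$ separable, with a full Markov triple structure. That is, there are an algebra $\mathcal A$ of measurable functions $E\to\mathbb R$, stable under composition with $C^\infty$ functions $\Psi:\mathbb R^k\to\mathbb R$, and an ideal $\mathcal A_0\subseteq\mathcal A$ of bounded functions, dense in $L^p(\mu)$ for all $1\le p<\infty$ and stable under composition with $C^\infty$ functions $\Psi$ such that $\Psi(0)=0$. There are a linear operator $L$ on $\mathcal A$ and a symmetric bilinear map $\Gamma$ on $\mathcal A$, both preserving $\mathcal A_0$, with $L1=0$ and, $\mu$-almost everywhere, $\Gamma(F,G)=\frac12(L(FG)-FLG-GLF)$ and $\Gamma(F,F)\ge0$, where $\Gamma(F,F)=0$ if and only if $F$ is constant. The diffusion property holds: $$\Gamma(\Psi(F_1,\dots,F_k),G)=\sum_j\partial_j\Psi(F_1,\dots,F_k)\,\Gamma(F_j,G),$$ $$L\Psi(F_1,\dots,F_k)=\sum_i\partial_i\Psi(F_1,\dots,F_k)\,LF_i+\sum_{i,j}\partial_{ij}\Psi(F_1,\dots,F_k)\,\Gamma(F_i,F_j),$$ and $\int_E G\,LF\,d\mu=-\int_E\Gamma(F,G)\,d\mu$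 if $F,G\in\mathcal A$ and one of them is in $\mathcal A_0$; for each $F\in\mathcal A_0$ there is $c_F<\infty$ with $|\int_E\Gamma(F,G)\,d\mu|\le c_F\|G\|_2$ for all $G\in\mathcal A_0$. The form $\mathcal E(F,G)=\int_E\Gamma(F,G)\,d\mu$ is extended from $\mathcal A_0$ to the completion $\mathcal D(\mathcal E)\subseteq L^2(\mu)$ of $\mathcal A_0$ for the norm $(\|F\|_2^2+\mathcal E(F,F))^{1/2}$. The domain $\mathcal D(L)$ is the set of $f\in\mathcal D(\mathcal E)$ for which there is $Lf\in L^2(\mu)$ with $\mathcal E(f,g)=-\int_E g\,Lf\,d\mu$ for all $g\in\mathcal D(\mathcal E)$. Finally $1\in\mathcal D(L)$, $L1=0$, and $Lf=0$ with $f\in\mathcal D(L)$ implies that $f$ is constant. An eigenfunction $F$ of $L:\mathcal D(L)\to L^2(\mu)$ with eigenvalue $-\lambda$ is *chaotic* if there is $\eta>1$ such that $-\eta\lambda$ is an eigenvalue of $L$ and $F^2\in\bigoplus_{\kappa\le\eta\lambda}\ker(L+\kappa\,\mathrm{Id})$ (orthogonal Hilbert sum over the eigenvalues $-\kappa$ of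 $L$). The smallest such $\eta$ is the *chaos grade* of $F$. Let $b(x)=b_2x^2+b_1x+b_0$ with $b_0,b_1,b_2\in\mathbb R$, and let $\nu$ be the Pearson distribution with mean $m$ associated with $b$, i.e. the invariant law of the diffusion $dX_t=-\theta(X_t-m)\,dt+\sqrt{2\theta b(X_t)}\,dB_t$, $\theta>0$: the probability measure $\nu$ has mean $m$ and a density $p$ that is positive on an open interval $(l,u)$ and zero outside of it, with $b(x)p(x)=-\int_{-\infty}^x(y-m)p(y)\,dy$ on $(l,u)$. Assume that $\nu$ has a finite fourth moment. Put $$Q(x)=x^2+\frac{2(b_1+m)}{2b_2-1}x+\frac1{b_2-1}\Big(b_0+\frac{m(b_1+m)}{2b_2-1}\Big),\qquad U(x)=(1-b_2)Q^2(x)-\tfrac1{12}(Q'(x))^3(x-m).$$ Let $\mathscr H$ be a class of absolutely continuous functions $\mathbb R\to\mathbb R$ with $\sup_{h\in\mathscr H}\|h'\|_\infty<\infty$ that is separating: two laws on $\mathbb R$ which integrate all $h\in\mathscr H$, with the same integrals, are equal. Put $d_{\mathscr H}(X,Z)=\sup_{h\in\mathscr H}|\mathbb E\,h(X)-\mathbb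 E\,h(Z)|$; this distance is called admissible for $X$ and $Z$ if $h(X)$ and $h(Z)$ are integrable for all $h\in\mathscr H$. **Proposition 3.5.** There is a constant $c_{\mathscr H}>0$, depending only on $\mathscr H$ and on the target law $\nu$, such that the following holds for every full Markov triple as above, every chaotic eigenfunction $F\in L^4(\mu)$ of $L$, with chaos grade $\eta$, and every random variable $Z$ with law $\nu$. Let $G=F+m$, and let $d_{\mathscr H}$ be admissible for $G$ and $Z$. If $\eta\le2(1-b_2)$, then $$d_{\mathscr H}(G,Z)\le c_{\mathscr H}\sqrt{\Big(1-b_2-\frac\eta4\Big)\int_EU(G)\,d\mu}.$$ If $\eta>2(1-b_2)$, then with $\xi=\eta-2(1-b_2)$ $$d_{\mathscr H}(G,Z)\le c_{\mathscr H}\sqrt{\Big(1-b_2-\frac\eta4\Big)\int_EU(G)\,d\mu+\frac{\xi(1-b_2)}2\int_EQ^2(G)\,d\mu}.$$ -/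

import Mathlib

open MeasureTheory Filter Topology
open scoped ContDiff ENNReal

/-! ### The Markov setting

Elements of the algebras are honest functions, all identities between them hold `μ`-a.e. -/

/-- The partial derivative `∂ⱼ Ψ` of a function of `k` real variables. -/
noncomputable def partialDeriv {k : ℕ} (Ψ : (Fin k → ℝ) → ℝ) (j : Fin k) (x : Fin k → ℝ) : ℝ :=
  fderiv ℝ Ψ x (Pi.single j 1)

/-- The algebraic part of a full Markov triple `(E, μ, Γ)`: the algebras `𝒜₀ ⊆ 𝒜`, the carré du
champ `Γ` (`cdc`) and the generator `L` (`gen`) acting on them. The values of `cdc` and `gen`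
outside of `𝒜` are irrelevant. -/
structure MarkovStructure {E : Type*} [MeasurableSpace E] (μ : Measure E) where
  /-- the algebra `𝒜` -/
  A : Subalgebra ℝ (E → ℝ)
  /-- the algebra `𝒜₀` of bounded functions -/
  A₀ : NonUnitalSubalgebra ℝ (E → ℝ)
  /-- the carré du champ `Γ` -/
  cdc : (E → ℝ) → (E → ℝ) → (E → ℝ)
  /-- the generator `L` -/
  gen : (E → ℝ) → (E → ℝ)
  separable : TopologicalSpace.SeparableSpace (Lp ℝ 2 μ)
  measurable_of_mem : ∀ F ∈ A, Measurable F
  smooth_mem : ∀ (k : ℕ) (Ψ : (Fin k → ℝ) → ℝ), ContDiff ℝ ∞ Ψ →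
    ∀ F : Fin k → E → ℝ, (∀ i, F i ∈ A) → (fun x => Ψ (fun i => F i x)) ∈ A
  A₀_subset : ∀ F ∈ A₀, F ∈ A
  bounded_of_mem : ∀ F ∈ A₀, ∃ C : ℝ, ∀ᵐ x ∂μ, |F x| ≤ C
  dense_A₀ : ∀ p : ℝ≥0∞, 1 ≤ p → p ≠ ⊤ → ∀ f : E → ℝ, MemLp f p μ →
    ∀ ε : ℝ≥0∞, ε ≠ 0 → ∃ F ∈ A₀, eLpNorm (f - F) p μ ≤ ε
  smooth_mem₀ : ∀ (k : ℕ) (Ψ : (Fin k → ℝ) → ℝ), ContDiff ℝ ∞ Ψ → Ψ 0 = 0 →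
    ∀ F : Fin k → E → ℝ, (∀ i, F i ∈ A₀) → (fun x => Ψ (fun i => F i x)) ∈ A₀
  ideal : ∀ F ∈ A₀, ∀ G ∈ A, F * G ∈ A₀
  cdc_mem₀ : ∀ F ∈ A₀, ∀ G ∈ A₀, cdc F G ∈ A₀
  cdc_symm : ∀ F ∈ A, ∀ G ∈ A, cdc F G =ᵐ[μ] cdc G F
  cdc_linear : ∀ F ∈ A, ∀ F' ∈ A, ∀ G ∈ A, ∀ a : ℝ,
    cdc (a • F + F') G =ᵐ[μ] a • cdc F G + cdc F' G
  cdc_nonneg : ∀ F ∈ A, 0 ≤ᵐ[μ] cdc F F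
  /-- connexity -/
  cdc_eq_zero_iff : ∀ F ∈ A, cdc F F =ᵐ[μ] 0 ↔ ∃ a : ℝ, F =ᵐ[μ] fun _ => a
  cdc_bound : ∀ F ∈ A₀, ∃ c : ℝ, ∀ G ∈ A₀,
    |∫ x, cdc F G x ∂μ| ≤ c * (eLpNorm G 2 μ).toReal
  gen_mem : ∀ F ∈ A, gen F ∈ A
  gen_mem₀ : ∀ F ∈ A₀, gen F ∈ A₀
  gen_linear : ∀ F ∈ A, ∀ G ∈ A, ∀ a : ℝ, gen (a • F + G) =ᵐ[μ] a • gen F + gen G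
  gen_one : gen 1 =ᵐ[μ] 0
  cdc_eq : ∀ F ∈ A, ∀ G ∈ A,
    cdc F G =ᵐ[μ] (1 / 2 : ℝ) • (gen (F * G) - F * gen G - G * gen F)
  /-- integration by parts, as soon as one of the two functions is in `𝒜₀` -/
  integration_by_parts : ∀ F ∈ A, ∀ G ∈ A, (F ∈ A₀ ∨ G ∈ A₀) →
    ∫ x, G x * gen F x ∂μ = -∫ x, cdc F G x ∂μ
  diffusion_cdc : ∀ (k : ℕ) (Ψ : (Fin k → ℝ) → ℝ), ContDiff ℝ ∞ Ψ →
    ∀ F : Fin k → E → ℝ, (∀ i, F i ∈ A) → ∀ G ∈ A,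
    cdc (fun x => Ψ (fun i => F i x)) G =ᵐ[μ]
      fun x => ∑ j, partialDeriv Ψ j (fun i => F i x) * cdc (F j) G x
  diffusion_gen : ∀ (k : ℕ) (Ψ : (Fin k → ℝ) → ℝ), ContDiff ℝ ∞ Ψ →
    ∀ F : Fin k → E → ℝ, (∀ i, F i ∈ A) →
    gen (fun x => Ψ (fun i => F i x)) =ᵐ[μ]
      fun x => ∑ i, partialDeriv Ψ i (fun l => F l x) * gen (F i) x
        + ∑ i, ∑ j, partialDeriv (partialDeriv Ψ j) i (fun l => F l x) * cdc (F i) (F j) x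

namespace MarkovStructure

variable {E : Type*} [MeasurableSpace E] {μ : Measure E} (M : MarkovStructure μ)

/-- The Dirichlet form `𝓔(F, G) = ∫ Γ(F, G) dμ` on `𝒜₀`. -/
noncomputable def form₀ (F G : E → ℝ) : ℝ := ∫ x, M.cdc F G x ∂μ

/-- The sequence `F n` in `𝒜₀` is Cauchy for the energy norm `(‖F‖₂² + 𝓔(F, F))^(1/2)` and
converges to `f` in `L²(μ)`. -/
def Approximates (F : ℕ → E → ℝ) (f : E → ℝ) : Prop :=
  (∀ n, F n ∈ M.A₀) ∧
  Tendsto (fun n => eLpNorm (F n - f) 2 μ) atTop (𝓝 0) ∧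
  ∀ ε : ℝ, 0 < ε → ∃ N, ∀ n, N ≤ n → ∀ k, N ≤ k → M.form₀ (F n - F k) (F n - F k) < ε

/-- The domain `𝒟(𝓔)`, the completion of `𝒜₀` for the energy norm, seen inside `L²(μ)`. -/
def MemFormDomain (f : E → ℝ) : Prop :=
  MemLp f 2 μ ∧ ∃ F : ℕ → E → ℝ, M.Approximates F f

/-- `e` is the value `𝓔(f, g)` of the Dirichlet form extended to `𝒟(𝓔)` by continuity. -/
def IsForm (f g : E → ℝ) (e : ℝ) : Prop :=
  ∃ F G : ℕ → E → ℝ, M.Approximates F f ∧ M.Approximates G g ∧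
    Tendsto (fun n => M.form₀ (F n) (G n)) atTop (𝓝 e)

/-- `f ∈ 𝒟(L)` and `L f = h`: the function `f` is in `𝒟(𝓔)`, `h` is in `L²(μ)`, and
`𝓔(f, g) = -∫ g h dμ` for all `g ∈ 𝒟(𝓔)`. By the Riesz representation theorem such an `h` exists
if and only if `|𝓔(f, g)| ≤ c ‖g‖₂` for all `g ∈ 𝒟(𝓔)`. -/
def HasGenerator (f h : E → ℝ) : Prop :=
  M.MemFormDomain f ∧ MemLp h 2 μ ∧
    ∀ g, M.MemFormDomain g → M.IsForm f g (-∫ x, g x * h x ∂μ)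

/-- `f` is an eigenfunction of `L : 𝒟(L) → L²(μ)` with eigenvalue `a`. -/
def IsEigenfunction (a : ℝ) (f : E → ℝ) : Prop :=
  M.HasGenerator f (fun x => a * f x) ∧ ¬ f =ᵐ[μ] 0

/-- `a` is an eigenvalue of `L : 𝒟(L) → L²(μ)`. -/
def IsEigenvalue (a : ℝ) : Prop := ∃ f, M.IsEigenfunction a f

/-- The orthogonal (Hilbert) sum of the eigenspaces `ker (L + κ Id)`, over the eigenvalues `-κ`
with `κ ≤ t`. -/
noncomputable def eigenSum (t : ℝ) : Submodule ℝ (Lp ℝ 2 μ) :=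
  (Submodule.span ℝ {u : Lp ℝ 2 μ | ∃ κ ≤ t, M.IsEigenfunction (-κ) u}).topologicalClosure

/-- `F` is a chaotic eigenfunction of `L` with eigenvalue `-lam` and chaos grade `η`. -/
def IsChaotic (lam : ℝ) (F : E → ℝ) (η : ℝ) : Prop :=
  M.IsEigenfunction (-lam) F ∧
    IsLeast {t : ℝ | 1 < t ∧ M.IsEigenvalue (-(t * lam)) ∧
      ∃ u ∈ M.eigenSum (t * lam), u =ᵐ[μ] fun x => F x ^ 2} η

end MarkovStructure

/-- A full Markov triple: moreover `1 ∈ 𝒟(L)` with `L 1 = 0`, and `L` is ergodic on `𝒟(L)`. -/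
structure FullMarkovTriple {E : Type*} [MeasurableSpace E] (μ : Measure E)
    extends MarkovStructure μ where
  hasGenerator_one : toMarkovStructure.HasGenerator (fun _ => 1) (fun _ => 0)
  ergodic : ∀ f : E → ℝ, toMarkovStructure.HasGenerator f (fun _ => 0) →
    ∃ a : ℝ, f =ᵐ[μ] fun _ => a

/-! ### Pearson distributions -/

/-- The quadratic polynomial `b(x) = b₂ x² + b₁ x + b₀`. -/
def pearsonB (b₀ b₁ b₂ : ℝ) (x : ℝ) : ℝ := b₂ * x ^ 2 + b₁ * x + b₀

/-- `ν` is the Pearson distribution with mean `m` and quadratic polynomial `b`, i.e. the invariant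
law of `dX = -θ (X - m) dt + √(2 θ b(X)) dB` (for any `θ > 0`): it has a density `p`, supported by
an open interval `I`, finite mean `m`, and its squared diffusion coefficient
`σ²(x) = -2 θ (∫_{-∞}^x (y - m) p(y) dy) / p(x)` equals `2 θ b(x)` on `I`. -/
def IsPearson (m b₀ b₁ b₂ : ℝ) (ν : Measure ℝ) : Prop :=
  IsProbabilityMeasure ν ∧
  ∃ (I : Set ℝ) (p : ℝ → ℝ), IsOpen I ∧ I.OrdConnected ∧ Measurable p ∧
    (∀ x ∈ I, 0 < p x) ∧ (∀ x, x ∉ I → p x = 0) ∧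
    ν = volume.withDensity (fun x => ENNReal.ofReal (p x)) ∧
    Integrable (fun x => x) ν ∧ ∫ x, x ∂ν = m ∧
    ∀ x ∈ I, pearsonB b₀ b₁ b₂ x = -(∫ y in Set.Iic x, (y - m) * p y) / p x

/-- The polynomial `Q`. -/
noncomputable def pearsonQ (m b₀ b₁ b₂ : ℝ) (x : ℝ) : ℝ :=
  x ^ 2 + 2 * (b₁ + m) / (2 * b₂ - 1) * x
    + 1 / (b₂ - 1) * (b₀ + m * (b₁ + m) / (2 * b₂ - 1))

/-- The polynomial `U = (1 - b₂) Q² - (Q')³ (x - m) / 12`. -/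
noncomputable def pearsonU (m b₀ b₁ b₂ : ℝ) (x : ℝ) : ℝ :=
  (1 - b₂) * pearsonQ m b₀ b₁ b₂ x ^ 2
    - 1 / 12 * deriv (pearsonQ m b₀ b₁ b₂) x ^ 3 * (x - m)

/-! ### Distances between probability laws on the real line -/

/-- `H` is separating: two laws on `ℝ` that integrate all functions in `H`, with the same
integrals, coincide. -/
def IsSeparating (H : Set (ℝ → ℝ)) : Prop :=
  (∀ h ∈ H, Measurable h) ∧
  ∀ P P' : Measure ℝ, IsProbabilityMeasure P → IsProbabilityMeasure P' →
    (∀ h ∈ H, Integrable h P ∧ Integrable h P' ∧ ∫ x, h x ∂P = ∫ x, h x ∂P') → P = P'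

/-- The functions in `H` are absolutely continuous (on every bounded interval), and
`sup_{h ∈ H} ‖h'‖_∞ < ∞`. -/
def HasBoundedDerivatives (H : Set (ℝ → ℝ)) : Prop :=
  (∀ h ∈ H, ∀ a b : ℝ, AbsolutelyContinuousOnInterval h a b) ∧
  ∃ C : ℝ, ∀ h ∈ H, ∀ᵐ x : ℝ, |deriv h x| ≤ C

/-- The distance `d_H` is admissible for (random variables with) the laws `P` and `P'`. -/
def IsAdmissible (H : Set (ℝ → ℝ)) (P P' : Measure ℝ) : Prop :=
  ∀ h ∈ H, Integrable h P ∧ Integrable h P'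

/-- The distance `d_H(P, P') = sup_{h ∈ H} |∫ h dP - ∫ h dP'|` of two laws, with values in
`[0, ∞]`. -/
noncomputable def lawDist (H : Set (ℝ → ℝ)) (P P' : Measure ℝ) : ℝ≥0∞ :=
  ⨆ h ∈ H, ENNReal.ofReal |∫ x, h x ∂P - ∫ x, h x ∂P'|

section Generic

variable {E : Type*} [MeasurableSpace E] {μ : Measure E}

theorem integral_mul_eq_inner {f g : E → ℝ} (hf : MemLp f 2 μ) (hg : MemLp g 2 μ) :
    ∫ x, f x * g x ∂μ = inner ℝ (hf.toLp f) (hg.toLp g) := by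
  rw [L2.inner_def]
  refine integral_congr_ae ?_
  filter_upwards [hf.coeFn_toLp, hg.coeFn_toLp] with x h1 h2
  simp [h1, h2, mul_comm]

theorem tendsto_integral_mul_of_eLpNorm {F G : ℕ → E → ℝ} {f g : E → ℝ}
    (hF : ∀ n, MemLp (F n) 2 μ) (hf : MemLp f 2 μ) (hG : ∀ n, MemLp (G n) 2 μ) (hg : MemLp g 2 μ)
    (h : Tendsto (fun n => eLpNorm (F n - f) 2 μ) atTop (𝓝 0))
    (h' : Tendsto (fun n => eLpNorm (G n - g) 2 μ) atTop (𝓝 0)) :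
    Tendsto (fun n => ∫ x, F n x * G n x ∂μ) atTop (𝓝 (∫ x, f x * g x ∂μ)) := by
  rw [integral_mul_eq_inner hf hg]
  simp_rw [fun n => integral_mul_eq_inner (hF n) (hG n)]
  exact ((Lp.tendsto_Lp_iff_tendsto_eLpNorm'' F hF f hf).2 h).inner
    ((Lp.tendsto_Lp_iff_tendsto_eLpNorm'' G hG g hg).2 h')

theorem tendsto_integral_mul_const_of_eLpNorm {F : ℕ → E → ℝ} {f g : E → ℝ}
    (hF : ∀ n, MemLp (F n) 2 μ) (hf : MemLp f 2 μ) (hg : MemLp g 2 μ)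
    (h : Tendsto (fun n => eLpNorm (F n - f) 2 μ) atTop (𝓝 0)) :
    Tendsto (fun n => ∫ x, F n x * g x ∂μ) atTop (𝓝 (∫ x, f x * g x ∂μ)) :=
  tendsto_integral_mul_of_eLpNorm (G := fun _ => g) hF hf (fun _ => hg) hg h (by simp)

/-- The Cauchy-Schwarz inequality for a function dominated by a geometric mean. -/
theorem integral_abs_le_sqrt_mul_sqrt {a b c : E → ℝ} (ha : Integrable a μ) (hb : Integrable b μ)
    (hc : AEStronglyMeasurable c μ) (ha0 : 0 ≤ᵐ[μ] a) (hb0 : 0 ≤ᵐ[μ] b)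
    (h : ∀ᵐ x ∂μ, c x ^ 2 ≤ a x * b x) :
    Integrable c μ ∧ ∫ x, |c x| ∂μ ≤ √(∫ x, a x ∂μ) * √(∫ x, b x ∂μ) := by
  have key : ∀ {a : E → ℝ}, Integrable a μ → 0 ≤ᵐ[μ] a → MemLp (fun x => √(a x)) 2 μ := by
    intro a ha ha0
    rw [memLp_two_iff_integrable_sq (Real.continuous_sqrt.comp_aestronglyMeasurable ha.1)]
    refine ha.congr ?_
    filter_upwards [ha0] with x hx
    exact (Real.sq_sqrt hx).symm
  have hsa := key ha ha0
  have hsb := key hb hb0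
  have hle : ∀ᵐ x ∂μ, |c x| ≤ √(a x) * √(b x) := by
    filter_upwards [ha0, hb0, h] with x h1 h2 h3
    rw [← Real.sqrt_mul h1]
    exact Real.abs_le_sqrt h3
  have hint : Integrable (fun x => √(a x) * √(b x)) μ := hsa.integrable_mul hsb
  refine ⟨hint.mono' hc hle, ?_⟩
  have hci : Integrable c μ := hint.mono' hc hle
  refine (integral_mono_ae hci.abs hint hle).trans ?_
  have := integral_mul_le_Lp_mul_Lq_of_nonneg (μ := μ) Real.HolderConjugate.two_two
    (f := fun x => √(a x)) (g := fun x => √(b x)) (Eventually.of_forall fun x => Real.sqrt_nonneg _)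
    (Eventually.of_forall fun x => Real.sqrt_nonneg _) (by simpa using hsa) (by simpa using hsb)
  refine this.trans (le_of_eq ?_)
  rw [Real.sqrt_eq_rpow, Real.sqrt_eq_rpow]
  congr 2 <;> refine integral_congr_ae ?_
  · filter_upwards [ha0] with x hx
    norm_cast
    exact Real.sq_sqrt hx
  · filter_upwards [hb0] with x hx
    norm_cast
    exact Real.sq_sqrt hx

end Generic

namespace MarkovStructure

variable {E : Type*} [MeasurableSpace E] {μ : Measure E} (M : MarkovStructure μ)
variable {F G X Y g f h : E → ℝ}

section Algebra

theorem cdc_sub_left (hF : F ∈ M.A) (hG : G ∈ M.A) (hX : X ∈ M.A) :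
    M.cdc (F - G) X =ᵐ[μ] M.cdc F X - M.cdc G X := by
  have := M.cdc_linear G hG F hF X hX (-1)
  rw [show (-1 : ℝ) • G + F = F - G by simp [sub_eq_add_neg, add_comm]] at this
  filter_upwards [this] with x hx
  rw [hx]; simp; ring

theorem cdc_add_left (hF : F ∈ M.A) (hG : G ∈ M.A) (hX : X ∈ M.A) :
    M.cdc (F + G) X =ᵐ[μ] M.cdc F X + M.cdc G X := by
  have := M.cdc_linear F hF G hG X hX 1
  simpa using this

theorem cdc_add_right (hF : F ∈ M.A) (hG : G ∈ M.A) (hX : X ∈ M.A) :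
    M.cdc X (F + G) =ᵐ[μ] M.cdc X F + M.cdc X G := by
  filter_upwards [M.cdc_symm X hX _ (add_mem hF hG), M.cdc_add_left hF hG hX,
    M.cdc_symm X hX F hF, M.cdc_symm X hX G hG] with x h1 h2 h3 h4
  rw [h1, h2]; simp [h3, h4]

theorem cdc_lincomb (hX : X ∈ M.A) (hY : Y ∈ M.A) (r : ℝ) :
    M.cdc (r • X + Y) (r • X + Y) =ᵐ[μ]
      fun x => r * r * M.cdc X X x + 2 * r * M.cdc X Y x + M.cdc Y Y x := by
  have hZ : r • X + Y ∈ M.A := add_mem (M.A.smul_mem hX r) hY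
  filter_upwards [M.cdc_linear X hX Y hY _ hZ r, M.cdc_symm X hX _ hZ, M.cdc_symm Y hY _ hZ,
    M.cdc_linear X hX Y hY X hX r, M.cdc_linear X hX Y hY Y hY r, M.cdc_symm Y hY X hX]
    with x h1 h2 h3 h4 h5 h6
  rw [h1]; simp only [Pi.add_apply, Pi.smul_apply, smul_eq_mul, h2, h3, h4, h5, h6]; ring

theorem cdc_sq_le (hX : X ∈ M.A) (hY : Y ∈ M.A) :
    ∀ᵐ x ∂μ, M.cdc X Y x ^ 2 ≤ M.cdc X X x * M.cdc Y Y x := by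
  have h : ∀ᵐ x ∂μ, ∀ r : ℚ,
      0 ≤ (r : ℝ) * r * M.cdc X X x + 2 * r * M.cdc X Y x + M.cdc Y Y x := by
    rw [ae_all_iff]
    intro r
    filter_upwards [M.cdc_lincomb hX hY r,
      M.cdc_nonneg _ (add_mem (M.A.smul_mem hX (r : ℝ)) hY)] with x h1 h2
    rw [← h1]; exact h2
  filter_upwards [h] with x hx
  have hr : ∀ r : ℝ, 0 ≤ M.cdc X X x * (r * r) + 2 * M.cdc X Y x * r + M.cdc Y Y x := by
    intro r
    refine Rat.denseRange_cast.induction_on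
      (p := fun r : ℝ => 0 ≤ M.cdc X X x * (r * r) + 2 * M.cdc X Y x * r + M.cdc Y Y x) r
      (isClosed_le continuous_const (by fun_prop)) fun q => ?_
    convert hx q using 1; ring
  have := discrim_le_zero hr
  rw [discrim] at this
  nlinarith

theorem cdc_comp (hF : F ∈ M.A) (hG : G ∈ M.A) {f : ℝ → ℝ} (hf : ContDiff ℝ ∞ f) :
    M.cdc (fun x => f (F x)) G =ᵐ[μ] fun x => deriv f (F x) * M.cdc F G x := by
  have hΨ : ContDiff ℝ ∞ (fun y : Fin 1 → ℝ => f (y 0)) := hf.comp (by fun_prop)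
  have := M.diffusion_cdc 1 _ hΨ (fun _ => F) (fun _ => hF) G hG
  filter_upwards [this] with x hx
  rw [hx]
  simp only [Finset.univ_unique, Fin.default_eq_zero, Finset.sum_singleton]
  congr 1
  have hd : HasFDerivAt (fun y : Fin 1 → ℝ => f (y 0))
      ((deriv f (F x)) • (ContinuousLinearMap.proj 0 : (Fin 1 → ℝ) →L[ℝ] ℝ)) (fun _ => F x) := by
    have h1 : HasDerivAt f (deriv f (F x)) (F x) :=
      ((hf.differentiable (by simp)) (F x)).hasDerivAt
    have h2 : HasFDerivAt (fun y : Fin 1 → ℝ => y 0)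
      (ContinuousLinearMap.proj 0 : (Fin 1 → ℝ) →L[ℝ] ℝ) (fun _ => F x) :=
      hasFDerivAt_apply 0 _
    exact HasDerivAt.comp_hasFDerivAt (x := fun _ : Fin 1 => F x) (f := fun y => y 0) h1 h2
  rw [partialDeriv, hd.fderiv]
  simp

theorem cdc_mul_left (hF : F ∈ M.A) (hG : G ∈ M.A) (hX : X ∈ M.A) :
    M.cdc (F * G) X =ᵐ[μ] fun x => F x * M.cdc G X x + G x * M.cdc F X x := by
  have hΨ : ContDiff ℝ ∞ (fun y : Fin 2 → ℝ => y 0 * y 1) := by fun_prop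
  have := M.diffusion_cdc 2 _ hΨ ![F, G] (by intro i; fin_cases i <;> simpa) X hX
  filter_upwards [this] with x hx
  have e : (F * G) = fun x => ![F, G] 0 x * ![F, G] 1 x := by ext; simp
  rw [e, hx]
  have hd : HasFDerivAt (fun y : Fin 2 → ℝ => y 0 * y 1)
      (F x • (ContinuousLinearMap.proj 1 : (Fin 2 → ℝ) →L[ℝ] ℝ) +
        G x • (ContinuousLinearMap.proj 0 : (Fin 2 → ℝ) →L[ℝ] ℝ)) (fun i => ![F, G] i x) := by
    have h2 : ∀ i, HasFDerivAt (fun y : Fin 2 → ℝ => y i)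
      (ContinuousLinearMap.proj i : (Fin 2 → ℝ) →L[ℝ] ℝ) (fun i => ![F, G] i x) := fun i =>
      hasFDerivAt_apply i _
    simpa using (h2 0).fun_mul (h2 1)
  simp only [partialDeriv, hd.fderiv]
  simp [Fin.sum_univ_two]; ring

end Algebra

section Form

theorem memLp_of_mem₀ [IsFiniteMeasure μ] (hF : F ∈ M.A₀) (p : ℝ≥0∞) : MemLp F p μ := by
  obtain ⟨C, hC⟩ := M.bounded_of_mem F hF
  exact MemLp.of_bound (M.measurable_of_mem F (M.A₀_subset F hF)).aestronglyMeasurable C hC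

theorem integrable_of_mem₀ [IsFiniteMeasure μ] (hF : F ∈ M.A₀) : Integrable F μ :=
  memLp_one_iff_integrable.1 (M.memLp_of_mem₀ hF 1)

theorem comp_mem₀ (hF : F ∈ M.A₀) {f : ℝ → ℝ} (hf : ContDiff ℝ ∞ f) (h0 : f 0 = 0) :
    (fun x => f (F x)) ∈ M.A₀ :=
  M.smooth_mem₀ 1 (fun y => f (y 0)) (hf.comp (by fun_prop)) h0 (fun _ => F) fun _ => hF

theorem form₀_symm (hF : F ∈ M.A₀) (hG : G ∈ M.A₀) : M.form₀ F G = M.form₀ G F :=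
  integral_congr_ae (M.cdc_symm F (M.A₀_subset _ hF) G (M.A₀_subset _ hG))

theorem form₀_nonneg (hF : F ∈ M.A₀) : 0 ≤ M.form₀ F F :=
  integral_nonneg_of_ae (M.cdc_nonneg F (M.A₀_subset _ hF))

variable [IsProbabilityMeasure μ]

theorem form₀_sub_left (hF : F ∈ M.A₀) (hG : G ∈ M.A₀) (hX : X ∈ M.A₀) :
    M.form₀ (F - G) X = M.form₀ F X - M.form₀ G X := by
  rw [form₀, integral_congr_ae
    (M.cdc_sub_left (M.A₀_subset _ hF) (M.A₀_subset _ hG) (M.A₀_subset _ hX))]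
  exact integral_sub (M.integrable_of_mem₀ (M.cdc_mem₀ _ hF _ hX))
    (M.integrable_of_mem₀ (M.cdc_mem₀ _ hG _ hX))

theorem form₀_add_left (hF : F ∈ M.A₀) (hG : G ∈ M.A₀) (hX : X ∈ M.A₀) :
    M.form₀ (F + G) X = M.form₀ F X + M.form₀ G X := by
  rw [form₀, integral_congr_ae
    (M.cdc_add_left (M.A₀_subset _ hF) (M.A₀_subset _ hG) (M.A₀_subset _ hX))]
  exact integral_add (M.integrable_of_mem₀ (M.cdc_mem₀ _ hF _ hX))
    (M.integrable_of_mem₀ (M.cdc_mem₀ _ hG _ hX))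

theorem form₀_sub_right (hF : F ∈ M.A₀) (hG : G ∈ M.A₀) (hX : X ∈ M.A₀) :
    M.form₀ X (F - G) = M.form₀ X F - M.form₀ X G := by
  rw [M.form₀_symm hX (sub_mem hF hG), M.form₀_sub_left hF hG hX, M.form₀_symm hF hX,
    M.form₀_symm hG hX]

theorem form₀_add_right (hF : F ∈ M.A₀) (hG : G ∈ M.A₀) (hX : X ∈ M.A₀) :
    M.form₀ X (F + G) = M.form₀ X F + M.form₀ X G := by
  rw [M.form₀_symm hX (add_mem hF hG), M.form₀_add_left hF hG hX, M.form₀_symm hF hX,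
    M.form₀_symm hG hX]

/-- A weighted Cauchy-Schwarz inequality for the carré du champ. -/
theorem integral_abs_mul_cdc_le {w : E → ℝ} (hw : AEStronglyMeasurable w μ) (hX : X ∈ M.A₀)
    (hY : Y ∈ M.A₀) (hi : Integrable (fun x => w x ^ 2 * M.cdc Y Y x) μ) :
    Integrable (fun x => w x * M.cdc X Y x) μ ∧
    ∫ x, |w x * M.cdc X Y x| ∂μ ≤
      √(∫ x, w x ^ 2 * M.cdc Y Y x ∂μ) * √(M.form₀ X X) := by
  refine integral_abs_le_sqrt_mul_sqrt hi (M.integrable_of_mem₀ (M.cdc_mem₀ _ hX _ hX))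
    (hw.mul (M.integrable_of_mem₀ (M.cdc_mem₀ _ hX _ hY)).1) ?_
    (M.cdc_nonneg X (M.A₀_subset _ hX)) ?_
  · filter_upwards [M.cdc_nonneg Y (M.A₀_subset _ hY)] with x hx
    exact mul_nonneg (sq_nonneg _) hx
  · filter_upwards [M.cdc_sq_le (M.A₀_subset _ hX) (M.A₀_subset _ hY)] with x hx
    rw [mul_pow]
    nlinarith [sq_nonneg (w x), mul_le_mul_of_nonneg_left hx (sq_nonneg (w x))]

theorem integral_abs_cdc_le (hX : X ∈ M.A₀) (hY : Y ∈ M.A₀) :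
    ∫ x, |M.cdc X Y x| ∂μ ≤ √(M.form₀ X X) * √(M.form₀ Y Y) := by
  have := (M.integral_abs_mul_cdc_le (w := fun _ => 1) aestronglyMeasurable_const hX hY
    (by simpa using M.integrable_of_mem₀ (M.cdc_mem₀ _ hY _ hY))).2
  rw [mul_comm]
  simpa [form₀] using this

theorem abs_form₀_le (hX : X ∈ M.A₀) (hY : Y ∈ M.A₀) :
    |M.form₀ X Y| ≤ √(M.form₀ X X) * √(M.form₀ Y Y) :=
  (abs_integral_le_integral_abs).trans (M.integral_abs_cdc_le hX hY)

theorem form₀_add_self_le (hX : X ∈ M.A₀) (hY : Y ∈ M.A₀) :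
    M.form₀ (X + Y) (X + Y) ≤ 2 * M.form₀ X X + 2 * M.form₀ Y Y := by
  have h := M.form₀_nonneg (sub_mem hX hY)
  rw [M.form₀_sub_left hX hY (sub_mem hX hY), M.form₀_sub_right hX hY hX,
    M.form₀_sub_right hX hY hY] at h
  rw [M.form₀_add_left hX hY (add_mem hX hY), M.form₀_add_right hX hY hX,
    M.form₀_add_right hX hY hY]
  linarith

omit [IsProbabilityMeasure μ] in
theorem form₀_eq_neg_integral (hX : X ∈ M.A₀) (hY : Y ∈ M.A₀) :
    M.form₀ X Y = -∫ x, X x * M.gen Y x ∂μ := by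
  rw [M.integration_by_parts Y (M.A₀_subset _ hY) X (M.A₀_subset _ hX) (Or.inl hY), neg_neg]
  exact M.form₀_symm hX hY

end Form

section Approximation

variable {Fs Gs : ℕ → E → ℝ}

variable {M} in
theorem Approximates.congr (hF : M.Approximates Fs f) (h : f =ᵐ[μ] g) : M.Approximates Fs g :=
  ⟨hF.1, hF.2.1.congr fun n => eLpNorm_congr_ae ((EventuallyEq.refl _ (Fs n)).sub h), hF.2.2⟩

variable {M} in
theorem Approximates.comp (hF : M.Approximates Fs f) {s : ℕ → ℕ} (hs : StrictMono s) :
    M.Approximates (fun n => Fs (s n)) f := by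
  refine ⟨fun n => hF.1 _, hF.2.1.comp hs.tendsto_atTop, fun ε hε => ?_⟩
  obtain ⟨N, hN⟩ := hF.2.2 ε hε
  exact ⟨N, fun n hn k hk => hN _ (hn.trans (hs.id_le n)) _ (hk.trans (hs.id_le k))⟩

variable [IsProbabilityMeasure μ]

theorem form₀_zero : M.form₀ 0 0 = 0 := by
  have h := M.form₀_sub_left (zero_mem M.A₀) (zero_mem M.A₀) (zero_mem M.A₀)
  simpa using h

theorem approximates_const (hg : g ∈ M.A₀) : M.Approximates (fun _ => g) g :=
  ⟨fun _ => hg, by simp, fun ε hε => ⟨0, fun n _ k _ => by simpa [M.form₀_zero] using hε⟩⟩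

theorem memFormDomain_of_mem₀ (hg : g ∈ M.A₀) : M.MemFormDomain g :=
  ⟨M.memLp_of_mem₀ hg 2, _, M.approximates_const hg⟩

variable {M}

theorem Approximates.memLp (hF : M.Approximates Fs f) (n : ℕ) : MemLp (Fs n) 2 μ :=
  M.memLp_of_mem₀ (hF.1 n) 2

theorem Approximates.form₀_bdd (hF : M.Approximates Fs f) :
    ∃ C N, 0 < C ∧ ∀ n, N ≤ n → √(M.form₀ (Fs n) (Fs n)) ≤ C := by
  obtain ⟨N, hN⟩ := hF.2.2 1 one_pos
  refine ⟨√(2 * 1 + 2 * M.form₀ (Fs N) (Fs N)), N, ?_, fun n hn => Real.sqrt_le_sqrt ?_⟩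
  · have := M.form₀_nonneg (hF.1 N)
    positivity
  · have := M.form₀_add_self_le (sub_mem (hF.1 n) (hF.1 N)) (hF.1 N)
    rw [sub_add_cancel] at this
    linarith [hN n hn N le_rfl]

omit [IsProbabilityMeasure μ] in
theorem Approximates.sqrt_cauchy (hF : M.Approximates Fs f) {ε : ℝ} (hε : 0 < ε) :
    ∃ N, ∀ n, N ≤ n → ∀ k, N ≤ k → √(M.form₀ (Fs n - Fs k) (Fs n - Fs k)) < ε := by
  obtain ⟨N, hN⟩ := hF.2.2 (ε ^ 2) (by positivity)
  exact ⟨N, fun n hn k hk => (Real.sqrt_lt' hε).2 (hN n hn k hk)⟩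

theorem Approximates.sub (hF : M.Approximates Fs f) (hG : M.Approximates Gs g)
    (hf : MemLp f 2 μ) (hg : MemLp g 2 μ) :
    M.Approximates (fun n => Fs n - Gs n) (f - g) := by
  refine ⟨fun n => sub_mem (hF.1 n) (hG.1 n), ?_, fun ε hε => ?_⟩
  · have h := hF.2.1.add hG.2.1
    rw [add_zero] at h
    refine tendsto_of_tendsto_of_tendsto_of_le_of_le tendsto_const_nhds h (fun _ => zero_le)
      fun n => ?_
    have e : Fs n - Gs n - (f - g) = (Fs n - f) - (Gs n - g) := by ring
    simp only [e]
    exact eLpNorm_sub_le ((hF.memLp n).sub hf).1 ((hG.memLp n).sub hg).1 (by norm_num)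
  · obtain ⟨N, hN⟩ := hF.2.2 (ε / 4) (by positivity)
    obtain ⟨N', hN'⟩ := hG.2.2 (ε / 4) (by positivity)
    refine ⟨max N N', fun n hn k hk => ?_⟩
    have h1 := hN n (le_of_max_le_left hn) k (le_of_max_le_left hk)
    have h2 := hN' k (le_of_max_le_right hk) n (le_of_max_le_right hn)
    have := M.form₀_add_self_le (sub_mem (hF.1 n) (hF.1 k)) (sub_mem (hG.1 k) (hG.1 n))
    rw [show Fs n - Fs k + (Gs k - Gs n) = Fs n - Gs n - (Fs k - Gs k) by ring] at this
    linarith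

theorem Approximates.tendsto_form₀_left (hF : M.Approximates Fs f) (hf : MemLp f 2 μ)
    (hg : g ∈ M.A₀) :
    Tendsto (fun n => M.form₀ (Fs n) g) atTop (𝓝 (-∫ x, f x * M.gen g x ∂μ)) := by
  simp_rw [fun n => M.form₀_eq_neg_integral (hF.1 n) hg]
  exact (tendsto_integral_mul_const_of_eLpNorm hF.memLp hf (M.memLp_of_mem₀ (M.gen_mem₀ g hg) 2)
    hF.2.1).neg

/-- The form `𝓔` is closable on `𝒜₀`. -/
theorem Approximates.tendsto_form₀_zero (hF : M.Approximates Fs 0) :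
    Tendsto (fun n => M.form₀ (Fs n) (Fs n)) atTop (𝓝 0) := by
  obtain ⟨C, N₀, hC, hb⟩ := hF.form₀_bdd
  rw [Metric.tendsto_atTop]
  intro ε hε
  obtain ⟨N, hN⟩ := hF.sqrt_cauchy (ε := ε / (2 * C)) (by positivity)
  refine ⟨max N N₀, fun n hn => ?_⟩
  rw [Real.dist_eq, sub_zero]
  have hlim : Tendsto (fun k => M.form₀ (Fs k) (Fs n)) atTop (𝓝 0) := by
    simpa using hF.tendsto_form₀_left MemLp.zero (hF.1 n)
  have h1 : ∀ᶠ k in atTop, |M.form₀ (Fs n) (Fs n) - M.form₀ (Fs k) (Fs n)| ≤ ε / 2 := by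
    filter_upwards [eventually_ge_atTop N] with k hk
    rw [← M.form₀_sub_left (hF.1 n) (hF.1 k) (hF.1 n)]
    refine (M.abs_form₀_le (sub_mem (hF.1 n) (hF.1 k)) (hF.1 n)).trans ?_
    have h1 := (hN n (le_of_max_le_left hn) k hk).le
    have h2 := hb n (le_of_max_le_right hn)
    calc _ ≤ ε / (2 * C) * C := by gcongr
      _ = ε / 2 := by field_simp
  have h2 := le_of_tendsto (tendsto_const_nhds.sub hlim).abs h1
  rw [sub_zero] at h2
  linarith

theorem Approximates.tendsto_form₀_sub (hF : M.Approximates Fs f) (hG : M.Approximates Gs f)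
    (hf : MemLp f 2 μ) :
    Tendsto (fun n => √(M.form₀ (Fs n - Gs n) (Fs n - Gs n))) atTop (𝓝 0) := by
  have h := hF.sub hG hf hf
  rw [sub_self] at h
  simpa using h.tendsto_form₀_zero.sqrt

theorem HasGenerator.integral_mul_gen (h' : M.HasGenerator f h) (hg : g ∈ M.A₀) :
    ∫ x, f x * M.gen g x ∂μ = ∫ x, h x * g x ∂μ := by
  obtain ⟨Fs, Gs, hF, hG, hlim⟩ := h'.2.2 g (M.memFormDomain_of_mem₀ hg)
  have hgL := M.memLp_of_mem₀ hg 2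
  have h1 := hF.tendsto_form₀_left h'.1.1 hg
  have h2 : Tendsto (fun n => M.form₀ (Fs n) (Gs n) - M.form₀ (Fs n) g) atTop (𝓝 0) := by
    obtain ⟨C, N, hC, hb⟩ := hF.form₀_bdd
    have h3 := (hG.tendsto_form₀_sub (M.approximates_const hg) hgL).const_mul C
    rw [mul_zero] at h3
    refine squeeze_zero_norm' ?_ h3
    filter_upwards [eventually_ge_atTop N] with n hn
    rw [← M.form₀_sub_right (hG.1 n) hg (hF.1 n)]
    refine (M.abs_form₀_le (hF.1 n) (sub_mem (hG.1 n) hg)).trans ?_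
    gcongr
    exact hb n hn
  have h3 := tendsto_nhds_unique h2 (hlim.sub h1)
  simp_rw [mul_comm (h _)]
  linarith

theorem HasGenerator.tendsto_form₀_const (h' : M.HasGenerator f h) (hF : M.Approximates Fs f)
    (hg : g ∈ M.A₀) :
    Tendsto (fun n => M.form₀ (Fs n) g) atTop (𝓝 (-∫ x, h x * g x ∂μ)) := by
  rw [← h'.integral_mul_gen hg]
  exact hF.tendsto_form₀_left h'.1.1 hg

theorem HasGenerator.tendsto_form₀_add_integral (h' : M.HasGenerator f h)
    (hF : M.Approximates Fs f) (hG : ∀ n, Gs n ∈ M.A₀) {C : ℝ} (hC : 0 < C)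
    (hb : ∀ᶠ n in atTop, √(M.form₀ (Gs n) (Gs n)) ≤ C) :
    Tendsto (fun n => M.form₀ (Fs n) (Gs n) + ∫ x, h x * Gs n x ∂μ) atTop (𝓝 0) := by
  obtain ⟨N₀, hb⟩ := eventually_atTop.1 hb
  rw [Metric.tendsto_atTop]
  intro ε hε
  obtain ⟨N, hN⟩ := hF.sqrt_cauchy (ε := ε / (2 * C)) (by positivity)
  refine ⟨max N N₀, fun n hn => ?_⟩
  rw [Real.dist_eq, sub_zero, ← sub_neg_eq_add]
  have h3 : ∀ᶠ k in atTop, |M.form₀ (Fs n) (Gs n) - M.form₀ (Fs k) (Gs n)| ≤ ε / 2 := by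
    filter_upwards [eventually_ge_atTop N] with k hk
    rw [← M.form₀_sub_left (hF.1 n) (hF.1 k) (hG n)]
    refine (M.abs_form₀_le (sub_mem (hF.1 n) (hF.1 k)) (hG n)).trans ?_
    have h1 := (hN n (le_of_max_le_left hn) k hk).le
    have h2 := hb n (le_of_max_le_right hn)
    calc _ ≤ ε / (2 * C) * C := by gcongr
      _ = ε / 2 := by field_simp
  have h4 := le_of_tendsto
    (tendsto_const_nhds.sub (h'.tendsto_form₀_const hF (hG n))).abs h3
  linarith

theorem HasGenerator.tendsto_form₀ (h' : M.HasGenerator f h) (hF : M.Approximates Fs f)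
    (hG : M.Approximates Gs g) (hg : MemLp g 2 μ) :
    Tendsto (fun n => M.form₀ (Fs n) (Gs n)) atTop (𝓝 (-∫ x, h x * g x ∂μ)) := by
  obtain ⟨C, N₀, hC, hb⟩ := hG.form₀_bdd
  have h1 : Tendsto (fun n => -∫ x, h x * Gs n x ∂μ) atTop (𝓝 (-∫ x, h x * g x ∂μ)) := by
    simp_rw [mul_comm (h _)]
    exact (tendsto_integral_mul_const_of_eLpNorm hG.memLp hg h'.2.1 hG.2.1).neg
  simpa using (h'.tendsto_form₀_add_integral hF hG.1 hC (eventually_atTop.2 ⟨N₀, hb⟩)).add h1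

omit [IsProbabilityMeasure μ] in
theorem HasGenerator.congr {f' h' : E → ℝ} (H : M.HasGenerator f h) (hf : f =ᵐ[μ] f')
    (hh : h =ᵐ[μ] h') : M.HasGenerator f' h' := by
  obtain ⟨Fs, hFs⟩ := H.1.2
  refine ⟨⟨(memLp_congr_ae hf).1 H.1.1, Fs, hFs.congr hf⟩, (memLp_congr_ae hh).1 H.2.1,
    fun g hg => ?_⟩
  obtain ⟨A, B, hA, hB, hlim⟩ := H.2.2 g hg
  refine ⟨A, B, hA.congr hf, hB, ?_⟩
  rwa [integral_congr_ae (g := fun x => g x * h x)]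
  filter_upwards [hh] with x hx
  rw [hx]

omit [IsProbabilityMeasure μ] in
theorem IsEigenfunction.congr {a : ℝ} (H : M.IsEigenfunction a f) (hf : f =ᵐ[μ] g) :
    M.IsEigenfunction a g := by
  refine ⟨H.1.congr hf ?_, fun h => H.2 (hf.trans h)⟩
  filter_upwards [hf] with x hx
  rw [hx]

omit [IsProbabilityMeasure μ] in
theorem IsEigenfunction.memLp {a : ℝ} (H : M.IsEigenfunction a f) : MemLp f 2 μ := H.1.1.1

/-- Eigenfunctions of different eigenvalues are orthogonal. -/
theorem IsEigenfunction.integral_mul_eq_zero {a b : ℝ} (hf : M.IsEigenfunction a f)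
    (hg : M.IsEigenfunction b g) (hab : a ≠ b) : ∫ x, f x * g x ∂μ = 0 := by
  obtain ⟨Fs, hF⟩ := hf.1.1.2
  obtain ⟨Gs, hG⟩ := hg.1.1.2
  have h1 := hf.1.tendsto_form₀ hF hG hg.memLp
  have h2 := hg.1.tendsto_form₀ hG hF hf.memLp
  simp_rw [fun n => M.form₀_symm (hG.1 n) (hF.1 n)] at h2
  have h3 := tendsto_nhds_unique h1 h2
  simp_rw [mul_assoc, integral_const_mul, mul_comm (g _)] at h3
  have : (a - b) * ∫ x, f x * g x ∂μ = 0 := by linarith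
  exact (mul_eq_zero.1 this).resolve_left (sub_ne_zero.2 hab)

theorem IsEigenfunction.nonpos {a : ℝ} (hf : M.IsEigenfunction a f) : a ≤ 0 := by
  obtain ⟨Fs, hF⟩ := hf.1.1.2
  have h1 := hf.1.tendsto_form₀ hF hF hf.memLp
  have h2 := ge_of_tendsto' h1 fun n => M.form₀_nonneg (hF.1 n)
  simp_rw [mul_assoc, integral_const_mul] at h2
  have h3 : 0 < ∫ x, f x * f x ∂μ := by
    refine lt_of_le_of_ne (integral_nonneg fun x => mul_self_nonneg _) fun h0 => hf.2 ?_
    have := (integral_eq_zero_iff_of_nonneg (fun x => mul_self_nonneg (f x))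
      (hf.memLp.integrable_mul hf.memLp)).1 h0.symm
    filter_upwards [this] with x hx
    simpa using hx
  nlinarith

end Approximation

end MarkovStructure

section HilbertSpace

variable {H : Type*} [NormedAddCommGroup H] [InnerProductSpace ℝ H]

/-- On sums of eigenvectors for eigenvalues `-κ ∈ [-t, 0]` of a symmetric operator `L`, the
operator `L (L + t)` is nonpositive. -/
theorem inner_add_smul_nonpos_of_mem_span {S : Set (ℝ × H)} {t : ℝ}
    (hS : ∀ s ∈ S, 0 ≤ s.1 ∧ s.1 ≤ t)
    (horth : ∀ s ∈ S, ∀ s' ∈ S, s.1 ≠ s'.1 → inner ℝ s.2 s'.2 = 0) {q : H × H}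
    (hq : q ∈ Submodule.span ℝ ((fun s : ℝ × H => (s.2, (-s.1) • s.2)) '' S)) :
    inner ℝ q.2 (q.2 + t • q.1) ≤ 0 := by
  obtain ⟨n, c, g, rfl⟩ := Submodule.mem_span_set'.1 hq
  choose s hsS hs using fun i => (g i).2
  have h1 : (∑ i, c i • (g i : H × H)).1 = ∑ i, c i • (s i).2 := by
    rw [Prod.fst_sum]; exact Finset.sum_congr rfl fun i _ => by rw [← hs i]; rfl
  have h2 : (∑ i, c i • (g i : H × H)).2 = ∑ i, (-(c i * (s i).1)) • (s i).2 := by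
    rw [Prod.snd_sum]
    refine Finset.sum_congr rfl fun i _ => ?_
    rw [← hs i, Prod.smul_snd, smul_smul]; congr 1; ring
  rw [h1, h2, Finset.smul_sum, ← Finset.sum_add_distrib]
  have h3 : inner ℝ (∑ i, (-(c i * (s i).1)) • (s i).2)
      (∑ i, ((-(c i * (s i).1)) • (s i).2 + t • c i • (s i).2)) =
      -inner ℝ (∑ i, (c i * √((s i).1 * (t - (s i).1))) • (s i).2)
        (∑ i, (c i * √((s i).1 * (t - (s i).1))) • (s i).2) := by
    simp_rw [sum_inner, inner_sum, ← Finset.sum_neg_distrib]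
    refine Finset.sum_congr rfl fun i _ => Finset.sum_congr rfl fun j _ => ?_
    simp only [inner_add_right, real_inner_smul_left, real_inner_smul_right]
    by_cases hij : (s i).1 = (s j).1
    · rw [hij]
      have := Real.mul_self_sqrt (mul_nonneg (hS _ (hsS j)).1 (sub_nonneg.2 (hS _ (hsS j)).2))
      linear_combination (c i * c j * inner ℝ (s i).2 (s j).2) * this
    · rw [horth _ (hsS i) _ (hsS j) hij]; ring
  rw [h3, neg_nonpos]
  exact real_inner_self_nonneg

end HilbertSpace

namespace MarkovStructure

variable {E : Type*} [MeasurableSpace E] {μ : Measure E} {M : MarkovStructure μ}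
variable {F G X Y g f h : E → ℝ}

section Spectral

variable (M) in
/-- The closed graph of `L`, restricted to the sum of the eigenspaces of eigenvalues `≥ -t`. -/
noncomputable def genGraph (t : ℝ) : Submodule ℝ (Lp ℝ 2 μ × Lp ℝ 2 μ) :=
  (Submodule.span ℝ ((fun s : ℝ × Lp ℝ 2 μ => (s.2, (-s.1) • s.2)) ''
    {s | s.1 ≤ t ∧ M.IsEigenfunction (-s.1) s.2})).topologicalClosure

variable [IsProbabilityMeasure μ]

omit [IsProbabilityMeasure μ] in
theorem IsEigenfunction.toLp_mem_genGraph {κ t : ℝ} (hf : M.IsEigenfunction (-κ) f) (ht : κ ≤ t) :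
    (hf.memLp.toLp f, (-κ) • hf.memLp.toLp f) ∈ M.genGraph t :=
  Submodule.le_topologicalClosure _ <| Submodule.subset_span
    ⟨(κ, hf.memLp.toLp f), ⟨ht, hf.congr hf.memLp.coeFn_toLp.symm⟩, rfl⟩

theorem inner_nonpos_of_mem_genGraph {t : ℝ} {q : Lp ℝ 2 μ × Lp ℝ 2 μ} (hq : q ∈ M.genGraph t) :
    inner ℝ q.2 (q.2 + t • q.1) ≤ 0 := by
  have hcl : IsClosed {q : Lp ℝ 2 μ × Lp ℝ 2 μ | inner ℝ q.2 (q.2 + t • q.1) ≤ 0} :=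
    isClosed_le (by fun_prop) continuous_const
  refine closure_minimal (fun p hp => ?_) hcl hq
  refine inner_add_smul_nonpos_of_mem_span (fun s hs => ⟨?_, hs.1⟩) (fun s hs s' hs' hne => ?_) hp
  · linarith [hs.2.nonpos]
  · have := hs.2.integral_mul_eq_zero hs'.2 (by simpa using hne)
    rwa [integral_mul_eq_inner hs.2.memLp hs'.2.memLp, Lp.toLp_coeFn, Lp.toLp_coeFn] at this

theorem norm_snd_le_of_mem_genGraph {t : ℝ} (ht : 0 ≤ t) {q : Lp ℝ 2 μ × Lp ℝ 2 μ}
    (hq : q ∈ M.genGraph t) : ‖q.2‖ ≤ t * ‖q.1‖ := by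
  have h := inner_nonpos_of_mem_genGraph hq
  rw [inner_add_right, real_inner_smul_right, real_inner_self_eq_norm_sq] at h
  have h2 := abs_le.1 (abs_real_inner_le_norm q.2 q.1)
  by_contra! hlt
  nlinarith [norm_nonneg q.2, norm_nonneg q.1, mul_nonneg ht (norm_nonneg q.1)]

theorem integral_mul_gen_of_mem_genGraph {t : ℝ} {q : Lp ℝ 2 μ × Lp ℝ 2 μ}
    (hq : q ∈ M.genGraph t) (hg : g ∈ M.A₀) :
    ∫ x, q.1 x * M.gen g x ∂μ = ∫ x, q.2 x * g x ∂μ := by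
  have hg2 := M.memLp_of_mem₀ hg 2
  have hLg := M.memLp_of_mem₀ (M.gen_mem₀ g hg) 2
  let T : Submodule ℝ (Lp ℝ 2 μ × Lp ℝ 2 μ) :=
    { carrier := {q | inner ℝ q.1 (hLg.toLp _) = inner ℝ q.2 (hg2.toLp g)}
      add_mem' := fun {a b} ha hb => by
        simp only [Set.mem_ofPred_eq, Prod.fst_add, Prod.snd_add, inner_add_left] at *
        rw [ha, hb]
      zero_mem' := by simp
      smul_mem' := fun c a ha => by
        simp only [Set.mem_ofPred_eq, Prod.smul_fst, Prod.smul_snd, real_inner_smul_left] at *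
        rw [ha] }
  have hT : IsClosed (T : Set (Lp ℝ 2 μ × Lp ℝ 2 μ)) := isClosed_eq (by fun_prop) (by fun_prop)
  have hle : M.genGraph t ≤ T := by
    refine Submodule.topologicalClosure_minimal _ (Submodule.span_le.2 ?_) hT
    rintro _ ⟨⟨κ, u⟩, ⟨-, hu⟩, rfl⟩
    have h1 := hu.1.integral_mul_gen hg
    simp only at h1
    simp_rw [mul_assoc, integral_const_mul] at h1
    rw [integral_mul_eq_inner hu.memLp hLg, integral_mul_eq_inner hu.memLp hg2,
      Lp.toLp_coeFn] at h1
    change inner ℝ u _ = inner ℝ ((-κ) • u) _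
    rw [h1, real_inner_smul_left]
  have h := hle hq
  rw [integral_mul_eq_inner (Lp.memLp _) hLg, integral_mul_eq_inner (Lp.memLp _) hg2,
    Lp.toLp_coeFn, Lp.toLp_coeFn]
  exact h

theorem exists_mem_genGraph {t : ℝ} (ht : 0 ≤ t) {v : Lp ℝ 2 μ} (hv : v ∈ M.eigenSum t) :
    ∃ w, (v, w) ∈ M.genGraph t := by
  let T : M.genGraph t →ₗ[ℝ] Lp ℝ 2 μ := (LinearMap.fst ℝ _ _).comp (M.genGraph t).subtype
  have hTc : Continuous T := continuous_fst.comp continuous_subtype_val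
  have hcl : IsClosed (Submodule.span ℝ ((fun s : ℝ × Lp ℝ 2 μ => (s.2, (-s.1) • s.2)) ''
    {s | s.1 ≤ t ∧ M.IsEigenfunction (-s.1) s.2})).topologicalClosure.carrier :=
    Submodule.isClosed_topologicalClosure _
  have : CompleteSpace (M.genGraph t) := hcl.isComplete.completeSpace_coe
  have hanti : AntilipschitzWith (⟨max 1 t, le_max_of_le_left zero_le_one⟩ : NNReal) T := by
    refine AddMonoidHomClass.antilipschitz_of_bound T fun q => ?_
    change ‖(q : Lp ℝ 2 μ × Lp ℝ 2 μ)‖ ≤ max 1 t * ‖q.1.1‖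
    rw [Prod.norm_def]
    refine max_le ?_ ((norm_snd_le_of_mem_genGraph ht q.2).trans ?_)
    · nlinarith [norm_nonneg q.1.1, le_max_left 1 t]
    · gcongr; exact le_max_right _ _
  have hTu : UniformContinuous T :=
    uniformContinuous_addMonoidHom_of_continuous (f := T.toAddMonoidHom) hTc
  have hrange : IsClosed (LinearMap.range T : Set (Lp ℝ 2 μ)) := by
    rw [LinearMap.coe_range]; exact hanti.isClosed_range hTu
  have hle : M.eigenSum t ≤ LinearMap.range T := by
    refine Submodule.topologicalClosure_minimal _ (Submodule.span_le.2 ?_) hrange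
    rintro u ⟨κ, hκ, hu⟩
    exact ⟨⟨(u, (-κ) • u), Submodule.le_topologicalClosure _ <| Submodule.subset_span
      ⟨(κ, u), ⟨hκ, hu⟩, rfl⟩⟩, rfl⟩
  obtain ⟨q, hq⟩ := hle hv
  refine ⟨q.1.2, ?_⟩
  have : (v, q.1.2) = q.1 := by rw [← hq]; rfl
  rw [this]; exact q.2

end Spectral

section Density

variable [IsProbabilityMeasure μ]

/-- An integrable function that is orthogonal to the algebra `𝒜₀` vanishes. -/
theorem ae_eq_zero_of_forall_integral_mul (M : MarkovStructure μ) {k : E → ℝ} (hk : Integrable k μ)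
    (h : ∀ g ∈ M.A₀, ∫ x, k x * g x ∂μ = 0) : k =ᵐ[μ] 0 := by
  refine hk.ae_eq_zero_of_forall_setIntegral_eq_zero fun S hS _ => ?_
  have hSL : MemLp (S.indicator fun _ => (1 : ℝ)) 2 μ :=
    memLp_indicator_const 2 hS 1 (Or.inr (measure_ne_top _ _))
  choose F hFA hF using fun n : ℕ => M.dense_A₀ 2 (by norm_num) (by norm_num) _ hSL
    ((n + 1 : ℝ≥0∞)⁻¹) (by simp)
  have hlim : Tendsto (fun n => eLpNorm (F n - S.indicator fun _ => (1 : ℝ)) 2 μ) atTop (𝓝 0) := by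
    refine tendsto_of_tendsto_of_tendsto_of_le_of_le tendsto_const_nhds
      (ENNReal.tendsto_inv_nat_nhds_zero.comp (tendsto_add_atTop_nat 1)) (fun _ => zero_le)
      fun n => ?_
    rw [eLpNorm_sub_comm]
    simpa using hF n
  obtain ⟨ns, -, hns⟩ := (tendstoInMeasure_of_tendsto_eLpNorm (by norm_num)
    (fun n => (M.memLp_of_mem₀ (hFA n) 2).1) hSL.1 hlim).exists_seq_tendsto_ae
  have hsin : ContDiff ℝ ∞ fun x : ℝ => Real.sin (Real.pi / 2 * x) := by fun_prop
  have h1 : Tendsto (fun n => ∫ x, k x * Real.sin (Real.pi / 2 * F (ns n) x) ∂μ) atTop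
      (𝓝 (∫ x, k x * Real.sin (Real.pi / 2 * S.indicator (fun _ => (1 : ℝ)) x) ∂μ)) := by
    refine tendsto_integral_of_dominated_convergence (fun x => |k x|) (fun n => ?_) hk.abs
      (fun n => ?_) ?_
    · exact hk.1.mul (M.integrable_of_mem₀ (M.comp_mem₀ (hFA (ns n)) hsin (by simp))).1
    · refine Eventually.of_forall fun x => ?_
      rw [Real.norm_eq_abs, abs_mul]
      exact mul_le_of_le_one_right (abs_nonneg _) (Real.abs_sin_le_one _)
    · filter_upwards [hns] with x hx
      exact tendsto_const_nhds.mul ((Real.continuous_sin.tendsto _).comp (tendsto_const_nhds.mul hx))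
  simp_rw [fun n => h _ (M.comp_mem₀ (hFA (ns n)) hsin (by simp))] at h1
  rw [← integral_indicator hS, tendsto_nhds_unique tendsto_const_nhds h1]
  refine integral_congr_ae (Eventually.of_forall fun x => ?_)
  by_cases hx : x ∈ S <;> simp [hx]

end Density

end MarkovStructure

namespace MarkovStructure

variable {E : Type*} [MeasurableSpace E] {μ : Measure E} {M : MarkovStructure μ}
variable {F G X Y g f h : E → ℝ} {Fs : ℕ → E → ℝ}

section CarreDuChamp

variable (M) in
theorem cdc_self_sub_self (hX : X ∈ M.A) (hY : Y ∈ M.A) :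
    M.cdc (X - Y) (X + Y) =ᵐ[μ] M.cdc X X - M.cdc Y Y := by
  filter_upwards [M.cdc_sub_left hX hY (add_mem hX hY), M.cdc_add_right hX hY hX,
    M.cdc_add_right hX hY hY, M.cdc_symm X hX Y hY] with x h1 h2 h3 h4
  rw [h1]; simp only [Pi.sub_apply, h2, h3, Pi.add_apply, h4]; ring

variable (M) in
theorem cdc_mul_self_le (hX : X ∈ M.A) (hY : Y ∈ M.A) :
    ∀ᵐ x ∂μ, M.cdc (X * Y) (X * Y) x ≤
      2 * (X x ^ 2 * M.cdc Y Y x) + 2 * (Y x ^ 2 * M.cdc X X x) := by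
  have hXY := mul_mem hX hY
  filter_upwards [M.cdc_mul_left hX hY hXY, M.cdc_symm X hX _ hXY, M.cdc_symm Y hY _ hXY,
    M.cdc_mul_left hX hY hX, M.cdc_mul_left hX hY hY, M.cdc_symm Y hY X hX, M.cdc_sq_le hX hY,
    M.cdc_nonneg X hX, M.cdc_nonneg Y hY] with x h1 h2 h3 h4 h5 h6 h7 h8 h9
  rw [h1, h2, h3, h4, h5, h6]
  simp only [Pi.zero_apply] at h8 h9
  have h10 : |X x * Y x * M.cdc X Y x| ≤ (X x ^ 2 * M.cdc Y Y x + Y x ^ 2 * M.cdc X X x) / 2 := by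
    refine abs_le_of_sq_le_sq ?_ (by positivity)
    have : (X x * Y x * M.cdc X Y x) ^ 2 ≤ (X x * Y x) ^ 2 * (M.cdc X X x * M.cdc Y Y x) := by
      rw [mul_pow]; gcongr
    nlinarith [sq_nonneg (X x ^ 2 * M.cdc Y Y x - Y x ^ 2 * M.cdc X X x)]
  have := le_abs_self (X x * Y x * M.cdc X Y x)
  linarith

variable [IsProbabilityMeasure μ]

variable (M) in
theorem form₀_comp_self_le (hX : X ∈ M.A₀) {f : ℝ → ℝ} (hf : ContDiff ℝ ∞ f) (h0 : f 0 = 0)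
    {C : ℝ} (hC : ∀ x, |deriv f x| ≤ C) :
    M.form₀ (fun x => f (X x)) (fun x => f (X x)) ≤ C ^ 2 * M.form₀ X X := by
  have hXA := M.A₀_subset _ hX
  have hfX := M.comp_mem₀ hX hf h0
  have hfXA := M.A₀_subset _ hfX
  rw [form₀, form₀, ← integral_const_mul]
  refine integral_mono_ae (M.integrable_of_mem₀ (M.cdc_mem₀ _ hfX _ hfX))
    ((M.integrable_of_mem₀ (M.cdc_mem₀ _ hX _ hX)).const_mul _) ?_
  filter_upwards [M.cdc_comp hXA hfXA hf, M.cdc_symm X hXA _ hfXA, M.cdc_comp hXA hXA hf,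
    M.cdc_nonneg X hXA] with x h1 h2 h3 h4
  rw [h1, h2, h3, ← mul_assoc, ← pow_two]
  simp only [Pi.zero_apply] at h4
  have := sq_le_sq' (by linarith [(abs_le.1 (hC (X x))).1]) (abs_le.1 (hC (X x))).2
  gcongr

theorem Approximates.exists_comp_ae (hF : M.Approximates Fs f) (hf : MemLp f 2 μ) :
    ∃ s : ℕ → ℕ, StrictMono s ∧ ∀ᵐ x ∂μ, Tendsto (fun n => Fs (s n) x) atTop (𝓝 (f x)) :=
  (tendstoInMeasure_of_tendsto_eLpNorm (by norm_num) (fun n => (hF.memLp n).1) hf.1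
    hF.2.1).exists_seq_tendsto_ae

/-- The carré du champ extends to the form domain, with values in `L¹`. -/
theorem Approximates.exists_cdc_limit (hF : M.Approximates Fs f) :
    ∃ γ : E → ℝ, Integrable γ μ ∧ 0 ≤ᵐ[μ] γ ∧
      Tendsto (fun n => ∫ x, |M.cdc (Fs n) (Fs n) x - γ x| ∂μ) atTop (𝓝 0) := by
  have hint : ∀ n, Integrable (M.cdc (Fs n) (Fs n)) μ := fun n =>
    M.integrable_of_mem₀ (M.cdc_mem₀ _ (hF.1 n) _ (hF.1 n))
  have hdist : ∀ n k, dist ((hint n).toL1 _) ((hint k).toL1 _) =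
      ∫ x, |M.cdc (Fs n) (Fs n) x - M.cdc (Fs k) (Fs k) x| ∂μ := by
    intro n k
    rw [dist_eq_norm, ← Integrable.toL1_sub _ _ (hint n) (hint k), L1.norm_of_fun_eq_integral_norm]
    rfl
  have hcau : CauchySeq fun n => (hint n).toL1 _ := by
    rw [Metric.cauchySeq_iff]
    intro ε hε
    obtain ⟨C, N₀, hC, hb⟩ := hF.form₀_bdd
    obtain ⟨N, hN⟩ := hF.sqrt_cauchy (ε := ε / (4 * C)) (by positivity)
    refine ⟨max N N₀, fun n hn k hk => ?_⟩
    rw [hdist]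
    have h1 : ∫ x, |M.cdc (Fs n) (Fs n) x - M.cdc (Fs k) (Fs k) x| ∂μ =
        ∫ x, |M.cdc (Fs n - Fs k) (Fs n + Fs k) x| ∂μ := by
      refine integral_congr_ae ?_
      filter_upwards [M.cdc_self_sub_self (M.A₀_subset _ (hF.1 n)) (M.A₀_subset _ (hF.1 k))]
        with x hx
      rw [hx]; rfl
    rw [h1]
    refine (M.integral_abs_cdc_le (sub_mem (hF.1 n) (hF.1 k)) (add_mem (hF.1 n) (hF.1 k))).trans_lt
      ?_
    have h2 : √(M.form₀ (Fs n + Fs k) (Fs n + Fs k)) ≤ 2 * C := by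
      refine Real.sqrt_le_iff.2 ⟨by positivity, ?_⟩
      have h3 := (Real.sqrt_le_left hC.le).1 (hb n (le_of_max_le_right hn))
      have h4 := (Real.sqrt_le_left hC.le).1 (hb k (le_of_max_le_right hk))
      have := M.form₀_add_self_le (hF.1 n) (hF.1 k)
      nlinarith
    have h3 := (hN n (le_of_max_le_left hn) k (le_of_max_le_left hk)).le
    calc _ ≤ ε / (4 * C) * (2 * C) := by gcongr
      _ = ε / 2 := by field_simp; norm_num
      _ < ε := by linarith
  obtain ⟨γ, hγ⟩ := cauchySeq_tendsto_of_complete hcau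
  have hγi := L1.integrable_coeFn γ
  refine ⟨γ, hγi, ?_, ?_⟩
  · obtain ⟨ns, -, hns⟩ := (tendstoInMeasure_of_tendsto_Lp hγ).exists_seq_tendsto_ae
    have h1 : ∀ᵐ x ∂μ, ∀ n, 0 ≤ ((hint n).toL1 _ : E → ℝ) x := by
      rw [ae_all_iff]
      intro n
      filter_upwards [(hint n).coeFn_toL1, M.cdc_nonneg _ (M.A₀_subset _ (hF.1 n))] with x h1 h2
      rw [h1]; exact h2
    filter_upwards [hns, h1] with x h2 h3
    exact ge_of_tendsto' h2 fun n => h3 _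
  · have h1 := tendsto_iff_dist_tendsto_zero.1 hγ
    refine h1.congr fun n => ?_
    rw [dist_eq_norm, ← Integrable.toL1_coeFn γ hγi, ← Integrable.toL1_sub _ _ (hint n) hγi,
      L1.norm_of_fun_eq_integral_norm, Integrable.toL1_coeFn]
    rfl

omit [IsProbabilityMeasure μ] in
/-- Convergence of integrals of products, for a bounded and a convergent factor. -/
theorem tendsto_integral_mul_of_bounded {k : ℕ → E → ℝ} {γ : E → ℝ} {w : ℕ → E → ℝ} {w' : E → ℝ}
    {C : ℝ} (hk : ∀ n, Integrable (k n) μ) (hγ : Integrable γ μ)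
    (hlim : Tendsto (fun n => ∫ x, |k n x - γ x| ∂μ) atTop (𝓝 0))
    (hw : ∀ n, AEStronglyMeasurable (w n) μ) (hC : ∀ n, ∀ᵐ x ∂μ, |w n x| ≤ C)
    (hw' : ∀ᵐ x ∂μ, Tendsto (fun n => w n x) atTop (𝓝 (w' x))) :
    Tendsto (fun n => ∫ x, w n x * k n x ∂μ) atTop (𝓝 (∫ x, w' x * γ x ∂μ)) := by
  have h1 : Tendsto (fun n => ∫ x, w n x * γ x ∂μ) atTop (𝓝 (∫ x, w' x * γ x ∂μ)) := by
    refine tendsto_integral_of_dominated_convergence (fun x => C * |γ x|)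
      (fun n => (hw n).mul hγ.1) (hγ.abs.const_mul C) (fun n => ?_) ?_
    · filter_upwards [hC n] with x hx
      rw [Real.norm_eq_abs, abs_mul]; gcongr
    · filter_upwards [hw'] with x hx using hx.mul_const _
  have hC' : ∀ n, ∀ᵐ x ∂μ, ‖w n x‖ ≤ C := hC
  have h2 : Tendsto (fun n => ∫ x, w n x * (k n x - γ x) ∂μ) atTop (𝓝 0) := by
    have h3 := hlim.const_mul C
    rw [mul_zero] at h3
    refine squeeze_zero_norm (fun n => ?_) h3
    refine (norm_integral_le_integral_norm _).trans ?_
    rw [← integral_const_mul]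
    refine integral_mono_ae (((hk n).sub hγ).bdd_mul (hw n) (hC' n)).norm
      (((hk n).sub hγ).abs.const_mul C) ?_
    filter_upwards [hC n] with x hx
    rw [Real.norm_eq_abs, abs_mul]; gcongr
  have h3 := h2.add h1
  rw [zero_add] at h3
  refine h3.congr fun n => ?_
  have i1 : Integrable (fun x => w n x * (k n x - γ x)) μ :=
    ((hk n).sub hγ).bdd_mul (hw n) (hC' n)
  rw [← integral_add i1 (hγ.bdd_mul (hw n) (hC' n))]
  refine integral_congr_ae (Eventually.of_forall fun x => ?_)
  simp only; ring

/-- The integration by parts formulas for an eigenfunction `F` and its carré du champ `γ`. -/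
theorem IsEigenfunction.exists_cdc {lam : ℝ} (hF : M.IsEigenfunction (-lam) F) :
    ∃ γ : E → ℝ, Integrable γ μ ∧ 0 ≤ᵐ[μ] γ ∧
      (∀ (f : ℝ → ℝ), ContDiff ℝ ∞ f → f 0 = 0 → ∀ C : ℝ, (∀ x, |deriv f x| ≤ C) →
        lam * ∫ x, F x * f (F x) ∂μ = ∫ x, deriv f (F x) * γ x ∂μ) ∧
      (∀ g ∈ M.A₀, Integrable (fun x => F x ^ 2 * M.gen g x) μ ∧
        ∫ x, g x * γ x ∂μ =
          lam * ∫ x, F x * (g x * F x) ∂μ + 1 / 2 * ∫ x, F x ^ 2 * M.gen g x ∂μ) := by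
  have hFL := hF.memLp
  obtain ⟨Fs', hFs'⟩ := hF.1.1.2
  obtain ⟨s, hs, hae⟩ := hFs'.exists_comp_ae hFL
  have hFs := hFs'.comp hs
  set Fs := fun n => Fs' (s n) with hFsdef
  obtain ⟨γ, hγi, hγ0, hγ⟩ := hFs.exists_cdc_limit
  obtain ⟨B, hB, hBb⟩ : ∃ B, 0 < B ∧ ∀ᶠ n in atTop, √(M.form₀ (Fs n) (Fs n)) ≤ B := by
    obtain ⟨C, N, hC, hb⟩ := hFs.form₀_bdd
    exact ⟨C, hC, eventually_atTop.2 ⟨N, hb⟩⟩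
  have hint : ∀ n, Integrable (M.cdc (Fs n) (Fs n)) μ := fun n =>
    M.integrable_of_mem₀ (M.cdc_mem₀ _ (hFs.1 n) _ (hFs.1 n))
  have hA : ∀ n, Fs n ∈ M.A := fun n => M.A₀_subset _ (hFs.1 n)
  refine ⟨γ, hγi, hγ0, fun f hf hf0 C hC => ?_, fun g hg => ?_⟩
  · have hC0 : 0 ≤ C := (abs_nonneg _).trans (hC 0)
    have hlip : ∀ x y, |f x - f y| ≤ C * |x - y| := fun x y =>
      Convex.norm_image_sub_le_of_norm_deriv_le (s := Set.univ)
        (fun z _ => (hf.differentiable (by simp)) z) (fun z _ => hC z) convex_univ trivial trivial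
    have hfc : Continuous f := hf.continuous
    have hmem : ∀ n, (fun x => f (Fs n x)) ∈ M.A₀ := fun n => M.comp_mem₀ (hFs.1 n) hf hf0
    have hfF : MemLp (fun x => f (F x)) 2 μ := by
      refine hFL.of_le_mul (c := C) (hfc.comp_aestronglyMeasurable hFL.1)
        (Eventually.of_forall fun x => ?_)
      simpa [hf0] using hlip (F x) 0
    have h1 := hF.1.tendsto_form₀_add_integral hFs hmem (C := (C + 1) * B) (by positivity) (by
      filter_upwards [hBb] with n hn
      calc _ ≤ √(C ^ 2 * M.form₀ (Fs n) (Fs n)) :=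
            Real.sqrt_le_sqrt (M.form₀_comp_self_le (hFs.1 n) hf hf0 hC)
        _ = C * √(M.form₀ (Fs n) (Fs n)) := by
            rw [Real.sqrt_mul (sq_nonneg _), Real.sqrt_sq hC0]
        _ ≤ (C + 1) * B := by gcongr; linarith)
    have h2 : Tendsto (fun n => ∫ x, (-lam * F x) * f (Fs n x) ∂μ) atTop
        (𝓝 (∫ x, (-lam * F x) * f (F x) ∂μ)) := by
      simp_rw [mul_comm (-lam * _)]
      refine tendsto_integral_mul_const_of_eLpNorm (F := fun n x => f (Fs n x))
        (fun n => M.memLp_of_mem₀ (hmem n) 2) hfF hF.1.2.1 ?_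
      have h3 := ENNReal.Tendsto.const_mul (a := ENNReal.ofReal C) hFs.2.1
        (Or.inr ENNReal.ofReal_ne_top)
      rw [mul_zero] at h3
      refine tendsto_of_tendsto_of_tendsto_of_le_of_le tendsto_const_nhds h3 (fun _ => zero_le)
        fun n => ?_
      exact eLpNorm_le_mul_eLpNorm_of_ae_le_mul (Eventually.of_forall fun x => hlip _ _) 2
    have h3 : Tendsto (fun n => M.form₀ (Fs n) (fun x => f (Fs n x))) atTop
        (𝓝 (∫ x, deriv f (F x) * γ x ∂μ)) := by
      have h4 := tendsto_integral_mul_of_bounded hint hγi hγ (w := fun n x => deriv f (Fs n x))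
        (w' := fun x => deriv f (F x)) (C := C)
        (fun n => (hf.continuous_deriv (by simp)).comp_aestronglyMeasurable (hFs.memLp n).1)
        (fun n => Eventually.of_forall fun x => hC _) (by
          filter_upwards [hae] with x hx
          exact ((hf.continuous_deriv (by simp)).tendsto _).comp hx)
      refine h4.congr fun n => ?_
      rw [M.form₀_symm (hFs.1 n) (hmem n)]
      exact (integral_congr_ae (M.cdc_comp (hA n) (hA n) hf)).symm
    have h4 := tendsto_nhds_unique h1 (h3.add h2)
    simp_rw [mul_assoc, integral_const_mul] at h4
    linarith
  · obtain ⟨Cg, hCg⟩ := M.bounded_of_mem g hg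
    obtain ⟨CΓ, hCΓ⟩ := M.bounded_of_mem _ (M.cdc_mem₀ _ hg _ hg)
    have hgA := M.A₀_subset _ hg
    have hLg := M.gen_mem₀ g hg
    obtain ⟨CL, hCL⟩ := M.bounded_of_mem _ hLg
    have hmem : ∀ n, g * Fs n ∈ M.A₀ := fun n => mul_mem hg (hFs.1 n)
    have hmulL : ∀ {k u : E → ℝ} {c : ℝ}, MemLp u 2 μ → AEStronglyMeasurable k μ →
        (∀ᵐ x ∂μ, |k x| ≤ c) → MemLp (fun x => k x * u x) 2 μ := by
      intro k u c hu hk hc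
      refine hu.of_le_mul (c := c) (hk.mul hu.1) ?_
      filter_upwards [hc] with x hx
      rw [norm_mul]; gcongr; exact hx
    have hmulT : ∀ {k : E → ℝ} {c : ℝ}, AEStronglyMeasurable k μ → (∀ᵐ x ∂μ, |k x| ≤ c) →
        Tendsto (fun n => eLpNorm ((fun x => k x * Fs n x) - fun x => k x * F x) 2 μ) atTop
          (𝓝 0) := by
      intro k c hk hc
      have h3 := ENNReal.Tendsto.const_mul (a := ENNReal.ofReal c) hFs.2.1
        (Or.inr ENNReal.ofReal_ne_top)
      rw [mul_zero] at h3
      refine tendsto_of_tendsto_of_tendsto_of_le_of_le tendsto_const_nhds h3 (fun _ => zero_le)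
        fun n => ?_
      refine eLpNorm_le_mul_eLpNorm_of_ae_le_mul ?_ 2
      filter_upwards [hc] with x hx
      simp only [Pi.sub_apply]
      rw [← mul_sub, norm_mul]; gcongr; exact hx
    have hg1 := (M.integrable_of_mem₀ hg).1
    have hL1 := (M.integrable_of_mem₀ hLg).1
    have hsq : Tendsto (fun n => ∫ x, Fs n x * Fs n x ∂μ) atTop (𝓝 (∫ x, F x * F x ∂μ)) :=
      tendsto_integral_mul_of_eLpNorm hFs.memLp hFL hFs.memLp hFL hFs.2.1 hFs.2.1
    set K := 2 * (Cg ^ 2 * B ^ 2) + 2 * (|CΓ| * (∫ x, F x * F x ∂μ + 1)) + 1 with hK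
    have hK0 : 0 < K := by
      have : 0 ≤ ∫ x, F x * F x ∂μ := integral_nonneg fun x => mul_self_nonneg _
      positivity
    have h1 := hF.1.tendsto_form₀_add_integral hFs hmem (C := √K) (by positivity) (by
      filter_upwards [hBb, hsq.eventually_lt_const (lt_add_one _)] with n hn hn'
      refine Real.sqrt_le_sqrt ?_
      have hB2 := (Real.sqrt_le_left hB.le).1 hn
      have hi1 := (hint n).const_mul (Cg ^ 2)
      have hi2 : Integrable (fun x => |CΓ| * (Fs n x * Fs n x)) μ :=
        ((hFs.memLp n).integrable_mul (hFs.memLp n)).const_mul |CΓ|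
      have hle : M.form₀ (g * Fs n) (g * Fs n) ≤
          ∫ x, (2 * (Cg ^ 2 * M.cdc (Fs n) (Fs n) x) + 2 * (|CΓ| * (Fs n x * Fs n x))) ∂μ := by
        refine integral_mono_ae (M.integrable_of_mem₀ (M.cdc_mem₀ _ (hmem n) _ (hmem n)))
          ((hi1.const_mul 2).add (hi2.const_mul 2)) ?_
        filter_upwards [M.cdc_mul_self_le hgA (hA n), hCg, hCΓ, M.cdc_nonneg _ (hA n)]
          with x e1 e2 e3 e4
        refine e1.trans ?_
        simp only [Pi.zero_apply] at e4
        have e5 : g x ^ 2 ≤ Cg ^ 2 := by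
          rw [← sq_abs]; gcongr
        have e6 : M.cdc g g x ≤ |CΓ| := (le_abs_self _).trans (e3.trans (le_abs_self _))
        have e7 := mul_le_mul_of_nonneg_right e5 e4
        have e8 := mul_le_mul_of_nonneg_left e6 (mul_self_nonneg (Fs n x))
        nlinarith
      refine hle.trans ?_
      rw [integral_add (hi1.const_mul 2) (hi2.const_mul 2)]
      simp_rw [integral_const_mul]
      rw [hK]
      have e1 := mul_le_mul_of_nonneg_left hB2 (sq_nonneg Cg)
      have e2 := mul_le_mul_of_nonneg_left hn'.le (abs_nonneg CΓ)
      simp only [form₀] at e1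
      linarith)
    have h2 : Tendsto (fun n => ∫ x, (-lam * F x) * (g * Fs n) x ∂μ) atTop
        (𝓝 (∫ x, (-lam * F x) * (g x * F x) ∂μ)) := by
      simp_rw [mul_comm (-lam * _), Pi.mul_apply]
      exact tendsto_integral_mul_const_of_eLpNorm (F := fun n x => g x * Fs n x)
        (fun n => hmulL (hFs.memLp n) hg1 hCg) (hmulL hFL hg1 hCg) hF.1.2.1 (hmulT hg1 hCg)
    have h3 : Tendsto (fun n => ∫ x, g x * M.cdc (Fs n) (Fs n) x ∂μ) atTop
        (𝓝 (∫ x, g x * γ x ∂μ)) :=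
      tendsto_integral_mul_of_bounded hint hγi hγ (w := fun _ => g) (w' := g) (fun _ => hg1)
        (fun _ => hCg) (Eventually.of_forall fun x => tendsto_const_nhds)
    have h4 : Tendsto (fun n => ∫ x, (M.gen g x * Fs n x) * Fs n x ∂μ) atTop
        (𝓝 (∫ x, (M.gen g x * F x) * F x ∂μ)) :=
      tendsto_integral_mul_of_eLpNorm (F := fun n x => M.gen g x * Fs n x)
        (fun n => hmulL (hFs.memLp n) hL1 hCL) (hmulL hFL hL1 hCL) hFs.memLp hFL
        (hmulT hL1 hCL) hFs.2.1
    have h5 : ∀ n, M.form₀ (Fs n) (g * Fs n) =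
        ∫ x, g x * M.cdc (Fs n) (Fs n) x ∂μ - 1 / 2 * ∫ x, (M.gen g x * Fs n x) * Fs n x ∂μ := by
      intro n
      have hFF : Fs n * Fs n ∈ M.A₀ := mul_mem (hFs.1 n) (hFs.1 n)
      have e1 := M.form₀_eq_neg_integral hFF hg
      have i1 : Integrable (fun x => g x * M.cdc (Fs n) (Fs n) x) μ :=
        M.integrable_of_mem₀ (mul_mem hg (M.cdc_mem₀ _ (hFs.1 n) _ (hFs.1 n)))
      have i2 : Integrable (fun x => Fs n x * M.cdc (Fs n) g x) μ :=
        M.integrable_of_mem₀ (mul_mem (hFs.1 n) (M.cdc_mem₀ _ (hFs.1 n) _ hg))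
      have e2 : M.form₀ (Fs n * Fs n) g = 2 * ∫ x, Fs n x * M.cdc (Fs n) g x ∂μ := by
        rw [form₀, ← integral_const_mul]
        refine integral_congr_ae ?_
        filter_upwards [M.cdc_mul_left (hA n) (hA n) hgA] with x hx
        rw [hx]; ring
      have e3 : M.form₀ (Fs n) (g * Fs n) =
          ∫ x, g x * M.cdc (Fs n) (Fs n) x ∂μ + ∫ x, Fs n x * M.cdc (Fs n) g x ∂μ := by
        rw [M.form₀_symm (hFs.1 n) (hmem n), form₀, ← integral_add i1 i2]
        refine integral_congr_ae ?_
        filter_upwards [M.cdc_mul_left hgA (hA n) (hA n), M.cdc_symm _ hgA _ (hA n)] with x hx hx'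
        rw [hx, hx']
      have e4 : ∫ x, (Fs n * Fs n) x * M.gen g x ∂μ = ∫ x, (M.gen g x * Fs n x) * Fs n x ∂μ :=
        integral_congr_ae (Eventually.of_forall fun x => by simp only [Pi.mul_apply]; ring)
      rw [e3, ← e4]; linarith
    simp_rw [h5] at h1
    have h6 := tendsto_nhds_unique h1 ((h3.sub (h4.const_mul (1 / 2))).add h2)
    have h7 : ∫ x, F x ^ 2 * M.gen g x ∂μ = ∫ x, (M.gen g x * F x) * F x ∂μ :=
      integral_congr_ae (Eventually.of_forall fun x => by simp only; ring)
    refine ⟨?_, ?_⟩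
    · refine ((hmulL hFL hL1 hCL).integrable_mul hFL).congr (Eventually.of_forall fun x => ?_)
      simp only [Pi.mul_apply]; ring
    · rw [h7]
      simp_rw [mul_assoc (-lam), integral_const_mul] at h6
      linarith

end CarreDuChamp

end MarkovStructure

/-- `τ` is a nonnegative Stein kernel (up to conditioning on `G`) of the random variable `G` with
mean `m`. -/
structure IsSteinKernel {E : Type*} [MeasurableSpace E] (μ : Measure E) (m : ℝ) (G τ : E → ℝ) :
    Prop where
  memLp : MemLp G 4 μ
  memLp_kernel : MemLp τ 2 μ
  nonneg : 0 ≤ᵐ[μ] τ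
  integral_eq : ∀ φ : ℝ → ℝ, Continuous φ → (∃ C, ∀ x, |φ x| ≤ C) →
    ∫ x, (G x - m) * (∫ t in m..G x, φ t) ∂μ = ∫ x, τ x * φ (G x) ∂μ

section

variable {E : Type*} [MeasurableSpace E] {μ : Measure E} {m : ℝ} {G τ : E → ℝ}

theorem intervalIntegrable_of_quadratic_growth {φ : ℝ → ℝ} {C : ℝ} (hφ : Measurable φ)
    (hC : ∀ x, |φ x| ≤ C * (1 + x ^ 2)) (a b : ℝ) : IntervalIntegrable φ volume a b := by
  refine (Continuous.intervalIntegrable (u := fun x => C * (1 + x ^ 2)) (by fun_prop) a b).mono_fun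
    hφ.aestronglyMeasurable (Eventually.of_forall fun x => ?_)
  exact (hC x).trans (le_abs_self _)

theorem abs_integral_le_of_quadratic_growth {φ : ℝ → ℝ} {C : ℝ}
    (hC : ∀ x, |φ x| ≤ C * (1 + x ^ 2)) (m x : ℝ) :
    |∫ t in m..x, φ t| ≤ C * (1 + x ^ 2 + m ^ 2) * |x - m| := by
  have hC0 : 0 ≤ C := by simpa using (abs_nonneg _).trans (hC 0)
  refine intervalIntegral.norm_integral_le_of_norm_le_const (f := φ) fun t ht => ?_
  rw [Real.norm_eq_abs]
  refine (hC t).trans ?_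
  have : t ^ 2 ≤ x ^ 2 + m ^ 2 := by
    rcases Set.mem_uIoc.1 ht with h | h <;>
    rcases le_total 0 t with h0 | h0 <;> nlinarith [sq_nonneg x, sq_nonneg m]
  nlinarith

theorem MemLp.sq_of_four (hG : MemLp G 4 μ) : MemLp (fun x => G x ^ 2) 2 μ := by
  have : MemLp (fun x => G x * G x) 2 μ :=
    MemLp.mul (p := 4) (q := 4) (r := 2) hG hG (hpqr := ⟨by
      rw [← two_mul, show (4 : ℝ≥0∞) = 2 * 2 by norm_num, ENNReal.mul_inv (by simp) (by simp),
        ← mul_assoc, ENNReal.mul_inv_cancel (by simp) (by simp), one_mul]⟩)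
  simpa [pow_two] using this

theorem MemLp.quadratic_of_four [IsFiniteMeasure μ] (hG : MemLp G 4 μ) (a b c : ℝ) :
    MemLp (fun x => a * G x ^ 2 + b * G x + c) 2 μ :=
  (((MemLp.sq_of_four hG).const_mul a).add ((hG.mono_exponent (by norm_num)).const_mul b)).add
    (memLp_const c)

variable [IsProbabilityMeasure μ]

theorem IsSteinKernel.integrable_test (h : IsSteinKernel μ m G τ) {φ : ℝ → ℝ} {C : ℝ}
    (hφ : Measurable φ) (hC : ∀ x, |φ x| ≤ C * (1 + x ^ 2)) :
    Integrable (fun x => (G x - m) * (∫ t in m..G x, φ t)) μ ∧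
    Integrable (fun x => τ x * φ (G x)) μ := by
  have hG := h.memLp.1
  have hc : Continuous fun x => ∫ t in m..x, φ t :=
    intervalIntegral.continuous_primitive (intervalIntegrable_of_quadratic_growth hφ hC) m
  constructor
  · have h1 := (MemLp.quadratic_of_four h.memLp 1 (-(2 * m)) (m ^ 2)).integrable_mul
      (MemLp.quadratic_of_four h.memLp C 0 (C * (1 + m ^ 2)))
    refine h1.mono' ((hG.sub aestronglyMeasurable_const).mul (hc.comp_aestronglyMeasurable hG))
      (Eventually.of_forall fun x => ?_)
    rw [Real.norm_eq_abs, abs_mul]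
    have := mul_le_mul_of_nonneg_left (abs_integral_le_of_quadratic_growth hC m (G x))
      (abs_nonneg (G x - m))
    refine this.trans (le_of_eq ?_)
    have e := abs_mul_abs_self (G x - m)
    simp only [Pi.mul_apply]
    linear_combination (C * (1 + G x ^ 2 + m ^ 2)) * e
  · refine (h.memLp_kernel.norm.integrable_mul (MemLp.quadratic_of_four h.memLp C 0 C)).mono'
      (h.memLp_kernel.1.mul (hφ.comp_aemeasurable hG.aemeasurable).aestronglyMeasurable)
      (Eventually.of_forall fun x => ?_)
    rw [norm_mul]
    simp only [Pi.mul_apply]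
    gcongr
    refine (hC _).trans (le_of_eq ?_)
    ring

theorem IsSteinKernel.integral_eq_of_tendsto (h : IsSteinKernel μ m G τ) {φ : ℕ → ℝ → ℝ}
    {ψ : ℝ → ℝ} {C : ℝ} (hφ : ∀ n, Measurable (φ n)) (hC : ∀ n x, |φ n x| ≤ C * (1 + x ^ 2))
    (hlim : ∀ x, Tendsto (fun n => φ n x) atTop (𝓝 (ψ x)))
    (heq : ∀ n, ∫ x, (G x - m) * (∫ t in m..G x, φ n t) ∂μ = ∫ x, τ x * φ n (G x) ∂μ) :
    ∫ x, (G x - m) * (∫ t in m..G x, ψ t) ∂μ = ∫ x, τ x * ψ (G x) ∂μ := by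
  have h1 : Tendsto (fun n => ∫ x, (G x - m) * (∫ t in m..G x, φ n t) ∂μ) atTop
      (𝓝 (∫ x, (G x - m) * (∫ t in m..G x, ψ t) ∂μ)) := by
    refine tendsto_integral_of_dominated_convergence
      (fun x => (1 * G x ^ 2 + -(2 * m) * G x + m ^ 2) * (C * G x ^ 2 + 0 * G x + C * (1 + m ^ 2)))
      (fun n => (h.integrable_test (hφ n) (hC n)).1.1)
      ((MemLp.quadratic_of_four h.memLp _ _ _).integrable_mul
        (MemLp.quadratic_of_four h.memLp _ _ _)) (fun n => Eventually.of_forall fun x => ?_)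
      (Eventually.of_forall fun x => ?_)
    · rw [Real.norm_eq_abs, abs_mul]
      have := mul_le_mul_of_nonneg_left (abs_integral_le_of_quadratic_growth (hC n) m (G x))
        (abs_nonneg (G x - m))
      refine this.trans (le_of_eq ?_)
      have e := abs_mul_abs_self (G x - m)
      linear_combination (C * (1 + G x ^ 2 + m ^ 2)) * e
    · refine tendsto_const_nhds.mul
        (intervalIntegral.tendsto_integral_filter_of_dominated_convergence
          (fun t => C * (1 + t ^ 2)) (Eventually.of_forall fun n => (hφ n).aestronglyMeasurable)
          (Eventually.of_forall fun n => Eventually.of_forall fun t _ => hC n t)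
          (Continuous.intervalIntegrable (by fun_prop) _ _)
          (Eventually.of_forall fun t _ => hlim t))
  have h2 : Tendsto (fun n => ∫ x, τ x * φ n (G x) ∂μ) atTop (𝓝 (∫ x, τ x * ψ (G x) ∂μ)) := by
    refine tendsto_integral_of_dominated_convergence (fun x => ‖τ x‖ * (C * G x ^ 2 + 0 * G x + C))
      (fun n => (h.integrable_test (hφ n) (hC n)).2.1)
      (h.memLp_kernel.norm.integrable_mul (MemLp.quadratic_of_four h.memLp _ _ _))
      (fun n => Eventually.of_forall fun x => ?_) (Eventually.of_forall fun x => ?_)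
    · rw [norm_mul]
      gcongr
      refine (hC _ _).trans (le_of_eq ?_)
      ring
    · exact tendsto_const_nhds.mul (hlim _)
  simp_rw [heq] at h1
  exact tendsto_nhds_unique h1 h2

theorem IsSteinKernel.integral_eq_of_quadratic_growth (h : IsSteinKernel μ m G τ) {φ : ℝ → ℝ}
    {C : ℝ} (hφ : Continuous φ) (hC : ∀ x, |φ x| ≤ C * (1 + x ^ 2)) :
    ∫ x, (G x - m) * (∫ t in m..G x, φ t) ∂μ = ∫ x, τ x * φ (G x) ∂μ := by
  have hc : ∀ n : ℕ, Continuous fun x => max (-(n : ℝ)) (min n (φ x)) := fun n => by fun_prop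
  refine h.integral_eq_of_tendsto (φ := fun n x => max (-(n : ℝ)) (min n (φ x)))
    (fun n => (hc n).measurable) (fun n x => le_trans ?_ (hC x)) (fun x => ?_)
    fun n => h.integral_eq _ (hc n) ⟨n, fun x => ?_⟩
  · have hn : (0 : ℝ) ≤ n := n.cast_nonneg
    rcases abs_cases (φ x) with ⟨e, _⟩ | ⟨e, _⟩ <;> rw [e, abs_le] <;> constructor <;>
      simp only [le_max_iff, max_le_iff, min_le_iff, le_min_iff] <;> grind
  · refine tendsto_const_nhds.congr' ?_
    filter_upwards [eventually_ge_atTop ⌈|φ x|⌉₊] with n hn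
    have h1 := abs_le.1 (Nat.ceil_le.1 hn)
    rw [min_eq_right h1.2, max_eq_right h1.1]
  · have hn : (0 : ℝ) ≤ n := n.cast_nonneg
    rw [abs_le]
    exact ⟨le_max_left _ _, max_le (by linarith) (min_le_left _ _)⟩

theorem IsSteinKernel.integral_pow (h : IsSteinKernel μ m G τ) {k : ℕ} (hk : k ≤ 2) :
    ∫ x, (G x - m) ^ (k + 2) ∂μ = (k + 1) * ∫ x, τ x * (G x - m) ^ k ∂μ := by
  have h1 := h.integral_eq_of_quadratic_growth (φ := fun t => (t - m) ^ k) (C := 2 + 2 * m ^ 2)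
    (by fun_prop) (fun x => by
      have e1 : |x - m| ≤ 1 + (x - m) ^ 2 := by
        rw [← sq_abs]; nlinarith [sq_nonneg (|x - m| - 1), abs_nonneg (x - m)]
      have e2 : 1 + (x - m) ^ 2 ≤ (2 + 2 * m ^ 2) * (1 + x ^ 2) := by
        nlinarith [sq_nonneg (x + m), sq_nonneg (x * m)]
      interval_cases k
      · rw [pow_zero, abs_one]; nlinarith
      · rw [pow_one]; linarith
      · rw [abs_of_nonneg (sq_nonneg _)]; linarith)
  rw [← h1, ← integral_const_mul]
  refine integral_congr_ae (Eventually.of_forall fun x => ?_)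
  have : ∫ t in m..G x, (t - m) ^ k = (G x - m) ^ (k + 1) / (k + 1) := by
    rw [intervalIntegral.integral_comp_sub_right (fun t => t ^ k), _root_.integral_pow]; simp
  simp only [this]
  field_simp
  ring

end

theorem isSteinKernel_of_smooth {E : Type*} [MeasurableSpace E] {μ : Measure E}
    [IsProbabilityMeasure μ] {F τ : E → ℝ} (m : ℝ) (hF : MemLp F 4 μ) (hτ : MemLp τ 2 μ)
    (h0 : 0 ≤ᵐ[μ] τ)
    (h : ∀ (f : ℝ → ℝ), ContDiff ℝ ∞ f → f 0 = 0 → ∀ C : ℝ, (∀ x, |deriv f x| ≤ C) →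
        ∫ x, F x * f (F x) ∂μ = ∫ x, deriv f (F x) * τ x ∂μ) :
    IsSteinKernel μ m (fun x => F x + m) τ := by
  have hint : ∀ {φ : ℝ → ℝ} {C : ℝ}, Continuous φ → (∀ x, |φ x| ≤ C) →
      Integrable (fun x => F x * (∫ t in (0 : ℝ)..F x, φ t)) μ ∧
      Integrable (fun x => φ (F x) * τ x) μ := by
    intro φ C hφ hC
    have hF2 : MemLp F 2 μ := hF.mono_exponent (by norm_num)
    refine ⟨?_, (hτ.integrable (by norm_num)).bdd_mul (hφ.comp_aestronglyMeasurable hF.1)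
      (Eventually.of_forall fun x => hC _)⟩
    refine ((hF2.integrable_mul hF2).const_mul C).mono' (hF.1.mul
      ((intervalIntegral.continuous_primitive (fun a b => hφ.intervalIntegrable a b)
        0).comp_aestronglyMeasurable hF.1)) (Eventually.of_forall fun x => ?_)
    rw [norm_mul]
    have h1 := intervalIntegral.norm_integral_le_of_norm_le_const (a := 0) (b := F x) (f := φ)
      fun t _ => hC t
    rw [sub_zero] at h1
    refine (mul_le_mul_of_nonneg_left h1 (norm_nonneg _)).trans (le_of_eq ?_)
    simp only [Pi.mul_apply, Real.norm_eq_abs]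
    linear_combination C * abs_mul_abs_self (F x)
  have hcont : ∀ φ : ℝ → ℝ, Continuous φ → ∀ C, (∀ x, |φ x| ≤ C) →
      ∫ x, F x * (∫ t in (0 : ℝ)..F x, φ t) ∂μ = ∫ x, φ (F x) * τ x ∂μ := by
    intro φ hφ C hC
    have happ : ∀ n : ℕ, ∃ ψ : ℝ → ℝ, ContDiff ℝ ∞ ψ ∧ ∀ x, |ψ x - φ x| < 1 / ((n : ℝ) + 1) := by
      intro n
      obtain ⟨ψ, h1, h2, -⟩ := hφ.exists_contDiff_approx ⊤ (ε := fun _ => 1 / ((n : ℝ) + 1))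
        continuous_const (fun _ => by positivity)
      exact ⟨ψ, h1, fun x => h2 x⟩
    choose ψ hψ happ using happ
    have hbd : ∀ n x, |ψ n x| ≤ C + 1 := by
      intro n x
      have h1 : 1 / ((n : ℝ) + 1) ≤ 1 := by
        rw [div_le_one (by positivity)]; linarith [n.cast_nonneg (α := ℝ)]
      have h2 := abs_sub_abs_le_abs_sub (ψ n x) (φ x)
      linarith [happ n x, hC x]
    have hlim : ∀ x, Tendsto (fun n => ψ n x) atTop (𝓝 (φ x)) := by
      intro x
      rw [tendsto_iff_dist_tendsto_zero]
      exact squeeze_zero (fun _ => dist_nonneg) (fun n => (happ n x).le)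
        tendsto_one_div_add_atTop_nhds_zero_nat
    have hder : ∀ n, deriv (fun x => ∫ t in (0 : ℝ)..x, ψ n t) = ψ n := fun n =>
      funext fun x => (hψ n).continuous.deriv_integral _ _ _
    have heq : ∀ n, ∫ x, F x * (∫ t in (0 : ℝ)..F x, ψ n t) ∂μ = ∫ x, ψ n (F x) * τ x ∂μ := by
      intro n
      have := h (fun x => ∫ t in (0 : ℝ)..x, ψ n t) (by
        rw [contDiff_infty_iff_deriv, hder]
        exact ⟨fun x => ((hψ n).continuous.integral_hasStrictDerivAt 0
          x).hasDerivAt.differentiableAt, hψ n⟩) (by simp) (C + 1) (by rw [hder]; exact hbd n)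
      rwa [hder] at this
    have t1 : Tendsto (fun n => ∫ x, F x * (∫ t in (0 : ℝ)..F x, ψ n t) ∂μ) atTop
        (𝓝 (∫ x, F x * (∫ t in (0 : ℝ)..F x, φ t) ∂μ)) := by
      have hF2 : MemLp F 2 μ := hF.mono_exponent (by norm_num)
      refine tendsto_integral_of_dominated_convergence (fun x => (C + 1) * (F x * F x))
        (fun n => (hint (hψ n).continuous (hbd n)).1.1)
        ((hF2.integrable_mul hF2).const_mul _) (fun n => Eventually.of_forall fun x => ?_)
        (Eventually.of_forall fun x => ?_)
      · rw [norm_mul]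
        have h1 := intervalIntegral.norm_integral_le_of_norm_le_const (a := 0) (b := F x)
          (f := ψ n) fun t _ => hbd n t
        rw [sub_zero] at h1
        refine (mul_le_mul_of_nonneg_left h1 (norm_nonneg _)).trans (le_of_eq ?_)
        simp only [Real.norm_eq_abs]
        linear_combination (C + 1) * abs_mul_abs_self (F x)
      · exact tendsto_const_nhds.mul
          (intervalIntegral.tendsto_integral_filter_of_dominated_convergence (fun _ => C + 1)
            (Eventually.of_forall fun n => (hψ n).continuous.aestronglyMeasurable)
            (Eventually.of_forall fun n => Eventually.of_forall fun t _ => hbd n t)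
            intervalIntegrable_const (Eventually.of_forall fun t _ => hlim t))
    have t2 : Tendsto (fun n => ∫ x, ψ n (F x) * τ x ∂μ) atTop (𝓝 (∫ x, φ (F x) * τ x ∂μ)) := by
      refine tendsto_integral_of_dominated_convergence (fun x => (C + 1) * ‖τ x‖)
        (fun n => (hint (hψ n).continuous (hbd n)).2.1)
        ((hτ.integrable (by norm_num)).norm.const_mul _) (fun n => Eventually.of_forall fun x => ?_)
        (Eventually.of_forall fun x => (hlim _).mul_const _)
      rw [norm_mul]; gcongr; exact hbd n _
    simp_rw [heq] at t1
    exact tendsto_nhds_unique t1 t2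
  refine ⟨hF.add (memLp_const m), hτ, h0, fun φ hφ ⟨C, hC⟩ => ?_⟩
  have h1 := hcont (fun t => φ (t + m)) (by fun_prop) C (fun x => hC _)
  simp_rw [intervalIntegral.integral_comp_add_right φ, zero_add] at h1
  simp_rw [add_sub_cancel_right, h1, mul_comm (τ _)]

namespace MarkovStructure

variable {E : Type*} [MeasurableSpace E] {μ : Measure E} {M : MarkovStructure μ}
variable [IsProbabilityMeasure μ]

theorem IsChaotic.pos {lam η : ℝ} {F : E → ℝ} (h : M.IsChaotic lam F η) : 0 < lam := by
  have h0 : 0 ≤ lam := by linarith [h.1.nonpos]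
  refine lt_of_le_of_ne h0 fun h1 => ?_
  subst h1
  obtain ⟨⟨h2, h3, h4⟩, h5⟩ := h.2
  have h6 := h5 (a := (1 + η) / 2) ⟨by linarith, by simpa using h3, by simpa using h4⟩
  linarith

/-- The carré du champ `γ` of a chaotic eigenfunction `F` is square integrable, is a Stein kernel,
and satisfies an inequality `∫ L V (L + η λ) V ≤ 0` for `V = F² + q₁ F + q₀`. -/
theorem IsChaotic.exists_isSteinKernel {lam η : ℝ} {F : E → ℝ} (h : M.IsChaotic lam F η)
    (hF4 : MemLp F 4 μ) (h1 : M.HasGenerator (fun _ => 1) (fun _ => 0)) (m : ℝ) :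
    ∫ x, F x ∂μ = 0 ∧ ∃ τ, IsSteinKernel μ m (fun x => F x + m) τ ∧
      ∀ q₁ q₀ : ℝ, ∫ x, (2 * τ x - 2 * F x ^ 2 - q₁ * F x) *
        ((2 * τ x - 2 * F x ^ 2 - q₁ * F x) + η * (F x ^ 2 + q₁ * F x + q₀)) ∂μ ≤ 0 := by
  have hlam := h.pos
  obtain ⟨hF, ⟨hη, -, u, hu, huF⟩, -⟩ := h
  have hηl : 0 ≤ η * lam := by positivity
  have hone : M.IsEigenfunction (-0) (fun _ : E => (1 : ℝ)) := by
    refine ⟨h1.congr (EventuallyEq.refl _ _) (Eventually.of_forall fun x => by simp), fun h => ?_⟩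
    have := h.exists
    simp at this
  have hmean : ∫ x, F x ∂μ = 0 := by
    simpa using hF.integral_mul_eq_zero hone (by simpa using hlam.ne')
  refine ⟨hmean, ?_⟩
  obtain ⟨γ, hγi, hγ0, hγA, hγB⟩ := hF.exists_cdc
  obtain ⟨W, hW⟩ := exists_mem_genGraph hηl hu
  have hF2 : MemLp (fun x => F x ^ 2) 2 μ := MemLp.sq_of_four hF4
  have hγW : γ =ᵐ[μ] fun x => lam * F x ^ 2 + 1 / 2 * W x := by
    have hWL : MemLp (fun x => lam * F x ^ 2 + 1 / 2 * W x) 2 μ :=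
      (hF2.const_mul lam).add ((Lp.memLp W).const_mul _)
    have h0 := M.ae_eq_zero_of_forall_integral_mul
      (k := fun x => γ x - (lam * F x ^ 2 + 1 / 2 * W x)) (hγi.sub (hWL.integrable (by norm_num)))
      (fun g hg => by
        have hg2 := M.memLp_of_mem₀ hg 2
        have e1 : Integrable (fun x => g x * γ x) μ := by
          obtain ⟨C, hC⟩ := M.bounded_of_mem g hg
          exact hγi.bdd_mul hg2.1 hC
        have e2 : Integrable (fun x => F x * (g x * F x)) μ :=
          (hF2.integrable_mul hg2).congr (Eventually.of_forall fun x => by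
            simp only [Pi.mul_apply]; ring)
        have e3 : Integrable (fun x => W x * g x) μ := (Lp.memLp W).integrable_mul hg2
        have e4 : ∫ x, F x ^ 2 * M.gen g x ∂μ = ∫ x, W x * g x ∂μ := by
          rw [← integral_mul_gen_of_mem_genGraph hW hg]
          refine integral_congr_ae ?_
          filter_upwards [huF] with x hx
          simp only [hx]
        have e5 : ∫ x, (γ x - (lam * F x ^ 2 + 1 / 2 * W x)) * g x ∂μ =
            ∫ x, (g x * γ x - (lam * (F x * (g x * F x)) + 1 / 2 * (W x * g x))) ∂μ :=
          integral_congr_ae (Eventually.of_forall fun x => by simp only; ring)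
        rw [e5, integral_sub e1 ((e2.const_mul _).fun_add (e3.const_mul _)),
          integral_add (e2.const_mul _) (e3.const_mul _), integral_const_mul, integral_const_mul,
          (hγB g hg).2, e4, sub_self])
    filter_upwards [h0] with x hx
    simp only [Pi.zero_apply] at hx
    linarith
  have hγL : MemLp γ 2 μ :=
    (memLp_congr_ae hγW).2 ((hF2.const_mul lam).add ((Lp.memLp W).const_mul _))
  refine ⟨fun x => lam⁻¹ * γ x, isSteinKernel_of_smooth m hF4 (hγL.const_mul _) ?_ ?_, ?_⟩
  · filter_upwards [hγ0] with x hx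
    exact mul_nonneg (inv_nonneg.2 hlam.le) hx
  · intro f hf hf0 C hC
    have := hγA f hf hf0 C hC
    simp_rw [mul_left_comm _ lam⁻¹, integral_const_mul, ← this]
    field_simp
  · intro q₁ q₀
    have hFm := hF.toLp_mem_genGraph (t := η * lam) (by nlinarith)
    have hom := hone.toLp_mem_genGraph (t := η * lam) hηl
    have hq := add_mem (add_mem hW (Submodule.smul_mem _ q₁ hFm)) (Submodule.smul_mem _ q₀ hom)
    have hin := inner_nonpos_of_mem_genGraph hq
    rw [L2.inner_def] at hin
    set A := hF.memLp.toLp F with hA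
    set B := hone.memLp.toLp _ with hB
    simp only [Prod.smul_mk, Prod.mk_add_mk, neg_zero, zero_smul, smul_zero, add_zero] at hin
    have hpos : 0 < lam ^ 2 := by positivity
    refine nonpos_of_mul_nonpos_right ?_ hpos
    rw [← integral_const_mul]
    refine le_trans (le_of_eq (integral_congr_ae ?_)) hin
    filter_upwards [Lp.coeFn_add W (q₁ • (-lam) • A), Lp.coeFn_smul q₁ ((-lam) • A),
      Lp.coeFn_smul (-lam) A, hF.memLp.coeFn_toLp, hone.memLp.coeFn_toLp,
      Lp.coeFn_add (W + q₁ • (-lam) • A) ((η * lam) • (u + q₁ • A + q₀ • B)),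
      Lp.coeFn_smul (η * lam) (u + q₁ • A + q₀ • B), Lp.coeFn_add (u + q₁ • A) (q₀ • B),
      Lp.coeFn_add u (q₁ • A), Lp.coeFn_smul q₁ A, Lp.coeFn_smul q₀ B, huF, hγW]
      with x e1 e2 e3 e4 e5 e6 e7 e8 e9 e10 e11 e12 e13
    simp only [e6, e1, e7, e8, e9, e10, e11, e2, e3, e12, e13, Pi.add_apply, Pi.smul_apply,
      smul_eq_mul, RCLike.inner_apply, conj_trivial]
    rw [hA, hB, e4, e5]
    field_simp
    ring

end MarkovStructure

section PearsonBound

variable {E : Type*} [MeasurableSpace E] {μ : Measure E}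

theorem MemLp.integrable_mul_quadratic_cube [IsFiniteMeasure μ] {F : E → ℝ} (hF : MemLp F 4 μ)
    (q : ℝ) : Integrable (fun x => (2 * F x + q) ^ 3 * F x) μ :=
  ((MemLp.quadratic_of_four hF 4 (4 * q) (q ^ 2)).integrable_mul
    (MemLp.quadratic_of_four hF 2 q 0)).congr
    (Eventually.of_forall fun x => by simp only [Pi.mul_apply]; ring)

variable [IsProbabilityMeasure μ]

theorem IsSteinKernel.integral_mul_quadratic {m : ℝ} {F τ : E → ℝ}
    (h : IsSteinKernel μ m (fun x => F x + m) τ) (hF4 : MemLp F 4 μ) (hF0 : ∫ x, F x ∂μ = 0)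
    (q₁ q₀ : ℝ) :
    ∫ x, ((2 * τ x - 2 * F x ^ 2 - q₁ * F x) * (F x ^ 2 + q₁ * F x + q₀)
      + 1 / 6 * ((2 * F x + q₁) ^ 3 * F x)) ∂μ = 0 := by
  have hτ := h.memLp_kernel
  have m0 := h.integral_pow (k := 0) (by norm_num)
  have m1 := h.integral_pow (k := 1) (by norm_num)
  have m2 := h.integral_pow (k := 2) (by norm_num)
  simp only [add_sub_cancel_right] at m0 m1 m2
  have i1 : Integrable F μ := hF4.integrable (by norm_num)
  have hp : ∀ a b c, Integrable (fun x => τ x * (a * F x ^ 2 + b * F x + c)) μ := fun a b c =>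
    hτ.integrable_mul (MemLp.quadratic_of_four hF4 a b c)
  have hq : ∀ a b c a' b' c', Integrable (fun x => (a * F x ^ 2 + b * F x + c) *
      (a' * F x ^ 2 + b' * F x + c')) μ := fun a b c a' b' c' =>
    (MemLp.quadratic_of_four hF4 a b c).integrable_mul (MemLp.quadratic_of_four hF4 a' b' c')
  have t0 : Integrable (fun x => τ x * F x ^ 0) μ := by simpa using hp 0 0 1
  have t1 : Integrable (fun x => τ x * F x ^ 1) μ := by simpa using hp 0 1 0
  have t2 : Integrable (fun x => τ x * F x ^ 2) μ := by simpa using hp 1 0 0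
  have f2 : Integrable (fun x => F x ^ (0 + 2)) μ := by simpa using hq 1 0 0 0 0 1
  have f3 : Integrable (fun x => F x ^ (1 + 2)) μ := by
    refine (hq 1 0 0 0 1 0).congr (Eventually.of_forall fun x => ?_); simp only; ring
  have f4 : Integrable (fun x => F x ^ (2 + 2)) μ := by
    refine (hq 1 0 0 1 0 0).congr (Eventually.of_forall fun x => ?_); simp only; ring
  have e : (fun x => (2 * τ x - 2 * F x ^ 2 - q₁ * F x) * (F x ^ 2 + q₁ * F x + q₀)
      + 1 / 6 * ((2 * F x + q₁) ^ 3 * F x)) = fun x =>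
      ((2 * (τ x * F x ^ 2) - 2 / 3 * F x ^ (2 + 2)) +
        (2 * q₁ * (τ x * F x ^ 1) - q₁ * F x ^ (1 + 2))) +
      ((2 * q₀ * (τ x * F x ^ 0) - 2 * q₀ * F x ^ (0 + 2)) + (q₁ ^ 3 / 6 - q₁ * q₀) * F x) := by
    ext x; ring
  have j2 : Integrable (fun x => 2 * (τ x * F x ^ 2) - 2 / 3 * F x ^ (2 + 2)) μ :=
    (t2.const_mul 2).sub (f4.const_mul (2 / 3))
  have j1 : Integrable (fun x => 2 * q₁ * (τ x * F x ^ 1) - q₁ * F x ^ (1 + 2)) μ :=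
    (t1.const_mul (2 * q₁)).sub (f3.const_mul q₁)
  have j0 : Integrable (fun x => 2 * q₀ * (τ x * F x ^ 0) - 2 * q₀ * F x ^ (0 + 2)) μ :=
    (t0.const_mul (2 * q₀)).sub (f2.const_mul (2 * q₀))
  have j := i1.const_mul (q₁ ^ 3 / 6 - q₁ * q₀)
  rw [e, integral_add (j2.fun_add j1) (j0.fun_add j),
    integral_add j2 j1, integral_add j0 j,
    integral_sub (t2.const_mul 2) (f4.const_mul (2 / 3)),
    integral_sub (t1.const_mul (2 * q₁)) (f3.const_mul q₁),
    integral_sub (t0.const_mul (2 * q₀)) (f2.const_mul (2 * q₀))]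
  simp_rw [integral_const_mul]
  rw [hF0, m0, m1, m2]
  push_cast
  ring

theorem deriv_pearsonQ (m b₀ b₁ b₂ x : ℝ) :
    deriv (pearsonQ m b₀ b₁ b₂) x = 2 * x + 2 * (b₁ + m) / (2 * b₂ - 1) := by
  have : HasDerivAt (pearsonQ m b₀ b₁ b₂)
      ((2 : ℕ) * x ^ (2 - 1) + 2 * (b₁ + m) / (2 * b₂ - 1) * 1) x :=
    (((hasDerivAt_pow 2 x).add ((hasDerivAt_id x).const_mul _))).add_const _
  rw [this.deriv]; norm_num

/-- The bound of the Stein discrepancy by fourth moments. -/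
theorem IsSteinKernel.integral_sq_sub_pearsonB_le {m b₀ b₁ b₂ η : ℝ} (hb : b₂ < 1 / 2)
    {F τ : E → ℝ} (h : IsSteinKernel μ m (fun x => F x + m) τ) (hF4 : MemLp F 4 μ)
    (hF0 : ∫ x, F x ∂μ = 0)
    (hL : ∀ q₁ q₀ : ℝ, ∫ x, (2 * τ x - 2 * F x ^ 2 - q₁ * F x) *
        ((2 * τ x - 2 * F x ^ 2 - q₁ * F x) + η * (F x ^ 2 + q₁ * F x + q₀)) ∂μ ≤ 0) :
    ∫ x, (τ x - pearsonB b₀ b₁ b₂ (F x + m)) ^ 2 ∂μ ≤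
      2 * ((1 - b₂ - η / 4) * ∫ x, pearsonU m b₀ b₁ b₂ (F x + m) ∂μ) +
      (η - 2 * (1 - b₂)) * (1 - b₂) / 2 * ∫ x, pearsonQ m b₀ b₁ b₂ (F x + m) ^ 2 ∂μ := by
  set α := 2 * (b₁ + m) / (2 * b₂ - 1) with hα
  have hα' : α * (2 * b₂ - 1) = 2 * (b₁ + m) := by
    rw [hα]; exact div_mul_cancel₀ _ (by linarith)
  set q₁ := 2 * m + α with hq₁
  set q₀ := pearsonQ m b₀ b₁ b₂ m with hq₀
  have hq₀' : (b₂ - 1) * (q₀ - m ^ 2 - α * m) = b₀ + m * α / 2 := by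
    rw [hq₀, pearsonQ, ← hα]
    have e1 : m * (b₁ + m) / (2 * b₂ - 1) = m * α / 2 := by rw [hα]; ring
    have e2 : b₂ - 1 ≠ 0 := by linarith
    rw [e1]; field_simp; ring
  have hQ : ∀ x, pearsonQ m b₀ b₁ b₂ (F x + m) = F x ^ 2 + q₁ * F x + q₀ := by
    intro x; simp only [hq₀, hq₁, pearsonQ]; ring
  have hU : ∀ x, pearsonU m b₀ b₁ b₂ (F x + m) = (1 - b₂) * (F x ^ 2 + q₁ * F x + q₀) ^ 2 -
      1 / 12 * ((2 * F x + q₁) ^ 3 * F x) := by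
    intro x; rw [pearsonU, deriv_pearsonQ, hQ, ← hα, hq₁]; ring
  have hB : ∀ x, τ x - pearsonB b₀ b₁ b₂ (F x + m) =
      1 / 2 * ((2 * τ x - 2 * F x ^ 2 - q₁ * F x) +
        2 * (1 - b₂) * (F x ^ 2 + q₁ * F x + q₀)) := by
    intro x
    rw [pearsonB, hq₁]
    linear_combination (F x / 2 + m / 2) * hα' + hq₀'
  simp_rw [hQ, hU, hB]
  have hτ := h.memLp_kernel
  have sL : ∀ a b c : ℝ, MemLp (fun x => 2 * τ x - 2 * F x ^ 2 - q₁ * F x +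
      (a * F x ^ 2 + b * F x + c)) 2 μ := fun a b c => by
    have := ((hτ.const_mul 2).add (MemLp.quadratic_of_four hF4 (-2) (-q₁) 0)).add
      (MemLp.quadratic_of_four hF4 a b c)
    refine (memLp_congr_ae (Eventually.of_forall fun x => ?_)).1 this
    simp only [Pi.add_apply]; ring
  have sL0 : MemLp (fun x => 2 * τ x - 2 * F x ^ 2 - q₁ * F x) 2 μ := by simpa using sL 0 0 0
  have vL : MemLp (fun x => F x ^ 2 + q₁ * F x + q₀) 2 μ := by
    simpa using MemLp.quadratic_of_four hF4 1 q₁ q₀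
  have i1 : Integrable (fun x => (2 * τ x - 2 * F x ^ 2 - q₁ * F x) *
        ((2 * τ x - 2 * F x ^ 2 - q₁ * F x) + η * (F x ^ 2 + q₁ * F x + q₀))) μ :=
    sL0.integrable_mul (sL0.add (vL.const_mul η))
  have iv : Integrable (fun x => (F x ^ 2 + q₁ * F x + q₀) ^ 2) μ := vL.integrable_sq
  have ic := MemLp.integrable_mul_quadratic_cube hF4 q₁
  have iU : Integrable (fun x => (1 - b₂) * (F x ^ 2 + q₁ * F x + q₀) ^ 2 -
      1 / 12 * ((2 * F x + q₁) ^ 3 * F x)) μ := (iv.const_mul _).sub (ic.const_mul _)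
  have isv : Integrable (fun x => (2 * τ x - 2 * F x ^ 2 - q₁ * F x) * (F x ^ 2 + q₁ * F x + q₀)
      + 1 / 6 * ((2 * F x + q₁) ^ 3 * F x)) μ := (sL0.integrable_mul vL).add (ic.const_mul _)
  have e : ∀ x, (1 / 2 * ((2 * τ x - 2 * F x ^ 2 - q₁ * F x) +
        2 * (1 - b₂) * (F x ^ 2 + q₁ * F x + q₀))) ^ 2 =
      (1 / 4 * ((2 * τ x - 2 * F x ^ 2 - q₁ * F x) *
        ((2 * τ x - 2 * F x ^ 2 - q₁ * F x) + η * (F x ^ 2 + q₁ * F x + q₀))) +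
      (4 * (1 - b₂) - η) / 4 * ((2 * τ x - 2 * F x ^ 2 - q₁ * F x) * (F x ^ 2 + q₁ * F x + q₀)
      + 1 / 6 * ((2 * F x + q₁) ^ 3 * F x))) +
      ((2 * (1 - b₂ - η / 4)) * ((1 - b₂) * (F x ^ 2 + q₁ * F x + q₀) ^ 2 -
      1 / 12 * ((2 * F x + q₁) ^ 3 * F x)) +
      ((η - 2 * (1 - b₂)) * (1 - b₂) / 2) * (F x ^ 2 + q₁ * F x + q₀) ^ 2) := by
    intro x; ring
  simp_rw [e]
  rw [integral_add ((i1.const_mul _).fun_add (isv.const_mul _))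
      ((iU.const_mul _).fun_add (iv.const_mul _)),
    integral_add (i1.const_mul _) (isv.const_mul _), integral_add (iU.const_mul _) (iv.const_mul _)]
  simp_rw [integral_const_mul]
  rw [h.integral_mul_quadratic hF4 hF0]
  have := hL q₁ q₀
  linarith

end PearsonBound

section Primitive

variable {g : ℝ → ℝ}

theorem integral_Iic_eq_add (hg : Integrable g) (x : ℝ) :
    ∫ y in Set.Iic x, g y = (∫ y in Set.Iic 0, g y) + ∫ y in (0 : ℝ)..x, g y := by
  rw [← intervalIntegral.integral_Iic_sub_Iic hg.integrableOn hg.integrableOn]; ring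

theorem continuous_integral_Iic (hg : Integrable g) : Continuous fun x => ∫ y in Set.Iic x, g y := by
  rw [funext (integral_Iic_eq_add hg)]
  exact continuous_const.add
    (intervalIntegral.continuous_primitive (fun a b => hg.intervalIntegrable) 0)

theorem hasDerivAt_integral_Iic (hg : Integrable g) {x : ℝ} (hx : ContinuousAt g x) :
    HasDerivAt (fun x => ∫ y in Set.Iic x, g y) (g x) x := by
  rw [funext (integral_Iic_eq_add hg)]
  exact (intervalIntegral.integral_hasDerivAt_right hg.intervalIntegrable
    (hg.1.stronglyMeasurableAtFilter) hx).const_add _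

theorem integral_Ioi_eq_sub (hg : Integrable g) (x : ℝ) :
    ∫ y in Set.Ioi x, g y = (∫ y, g y) - ∫ y in Set.Iic x, g y := by
  rw [← intervalIntegral.integral_Iic_add_Ioi hg.integrableOn hg.integrableOn (b := x)]; ring

theorem tendsto_integral_Ioi_atTop (hg : Integrable g) :
    Tendsto (fun x => ∫ y in Set.Ioi x, g y) atTop (𝓝 0) := by
  simp_rw [integral_Ioi_eq_sub hg]
  have := (aecover_Iic (μ := volume) (l := atTop) (b := fun x : ℝ => x)
    tendsto_id).integral_tendsto_of_countably_generated hg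
  simpa using this.const_sub (∫ y, g y)

theorem integral_pos_of_pos_on_open (hg : Integrable g) (h0 : ∀ x, 0 ≤ g x) {U : Set ℝ}
    (hU : IsOpen U) (hne : U.Nonempty) (hpos : ∀ x ∈ U, 0 < g x) : 0 < ∫ x, g x := by
  rw [integral_pos_iff_support_of_nonneg h0 hg]
  exact (hU.measure_pos volume hne).trans_le (measure_mono fun x hx => (hpos x hx).ne')

end Primitive

/-- The density `p` of a Pearson distribution with a finite fourth moment, supported by `I`. -/
structure IsPearsonDensity (m b₀ b₁ b₂ : ℝ) (I : Set ℝ) (p : ℝ → ℝ) : Prop where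
  isOpen : IsOpen I
  ordConnected : I.OrdConnected
  measurable : Measurable p
  pos : ∀ x ∈ I, 0 < p x
  eq_zero : ∀ x, x ∉ I → p x = 0
  integrable : Integrable p
  integrable_four : Integrable fun x => x ^ 4 * p x
  integral_one : ∫ x, p x = 1
  integral_id : ∫ x, x * p x = m
  mul_eq : ∀ x ∈ I, pearsonB b₀ b₁ b₂ x * p x = -∫ y in Set.Iic x, (y - m) * p y

/-- The function `x ↦ E (X - m) 1_{X > x}`, for `X` with density `p`. -/
noncomputable def tailMean (m : ℝ) (p : ℝ → ℝ) (x : ℝ) : ℝ := ∫ y in Set.Ioi x, (y - m) * p y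

/-- The function `x ↦ E (X - x)⁺`. -/
noncomputable def upperMean (p : ℝ → ℝ) (x : ℝ) : ℝ := ∫ y in Set.Ioi x, (y - x) * p y

/-- The function `x ↦ E (x - X)⁺`. -/
noncomputable def lowerMean (p : ℝ → ℝ) (x : ℝ) : ℝ := ∫ y in Set.Iic x, (x - y) * p y

/-- The distribution function of the density `p`. -/
noncomputable def distrib (p : ℝ → ℝ) (x : ℝ) : ℝ := ∫ y in Set.Iic x, p y

namespace IsPearsonDensity

variable {m b₀ b₁ b₂ : ℝ} {I : Set ℝ} {p : ℝ → ℝ}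

theorem continuous_pearsonB : Continuous (pearsonB b₀ b₁ b₂) := by
  unfold pearsonB; fun_prop

theorem hasDerivAt_pearsonB (x : ℝ) : HasDerivAt (pearsonB b₀ b₁ b₂) (2 * b₂ * x + b₁) x := by
  have : HasDerivAt (pearsonB b₀ b₁ b₂) (b₂ * ((2 : ℕ) * x ^ (2 - 1)) + b₁ * 1) x :=
    ((((hasDerivAt_pow 2 x).const_mul b₂).add ((hasDerivAt_id x).const_mul b₁))).add_const _
  convert this using 1; norm_num; ring

theorem upperMean_neg (p : ℝ → ℝ) (x : ℝ) : upperMean (fun x => p (-x)) x = lowerMean p (-x) := by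
  rw [upperMean, lowerMean, ← integral_comp_neg_Ioi x (fun y => (-x - y) * p y)]
  refine integral_congr_ae (Eventually.of_forall fun y => ?_)
  simp only; ring

theorem lowerMean_neg (p : ℝ → ℝ) (x : ℝ) : lowerMean (fun x => p (-x)) x = upperMean p (-x) := by
  rw [upperMean, lowerMean, ← integral_comp_neg_Iic x (fun y => (y - -x) * p y)]
  refine integral_congr_ae (Eventually.of_forall fun y => ?_)
  simp only; ring

variable (h : IsPearsonDensity m b₀ b₁ b₂ I p)
include h

theorem nonneg (x : ℝ) : 0 ≤ p x := by
  by_cases hx : x ∈ I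
  · exact (h.pos x hx).le
  · exact (h.eq_zero x hx).ge

theorem integrable_poly (a b c d e : ℝ) :
    Integrable fun x => (a * x ^ 4 + b * x ^ 3 + c * x ^ 2 + d * x + e) * p x := by
  have hi : Integrable fun x => (1 + x ^ 4) * p x :=
    (h.integrable.add h.integrable_four).congr (Eventually.of_forall fun x => by
      simp only [Pi.add_apply]; ring)
  refine (hi.const_mul (|a| + |b| + |c| + |d| + |e|)).mono'
    (Measurable.aestronglyMeasurable (by have := h.measurable; fun_prop))
    (Eventually.of_forall fun x => ?_)
  have hp := h.nonneg x
  rw [Real.norm_eq_abs, abs_mul, abs_of_nonneg hp, ← mul_assoc]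
  refine mul_le_mul_of_nonneg_right ?_ hp
  have k : ∀ (c : ℝ) {t : ℝ}, |t| ≤ 1 + x ^ 4 → |c * t| ≤ |c| * (1 + x ^ 4) := fun c t ht => by
    rw [abs_mul]; gcongr
  have k4 := k a (t := x ^ 4) (by rw [abs_of_nonneg (by positivity)]; linarith)
  have k3 := k b (t := x ^ 3) (by
    rw [abs_le]; constructor <;> nlinarith [sq_nonneg (x ^ 2 - x), sq_nonneg (x ^ 2 + x),
      sq_nonneg (x - 1), sq_nonneg (x + 1), sq_nonneg (x ^ 2 - 1)])
  have k2 := k c (t := x ^ 2) (by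
    rw [abs_of_nonneg (by positivity)]; nlinarith [sq_nonneg (x ^ 2 - 1)])
  have k1 := k d (t := x) (by
    rw [abs_le]; constructor <;> nlinarith [sq_nonneg (x ^ 2 - 1), sq_nonneg (x - 1),
      sq_nonneg (x + 1)])
  have k0 := k e (t := 1) (by rw [abs_one]; nlinarith [sq_nonneg (x ^ 2)])
  rw [mul_one] at k0
  refine (abs_add_le _ _).trans ((add_le_add ((abs_add_le _ _).trans (add_le_add
    ((abs_add_le _ _).trans (add_le_add ((abs_add_le _ _).trans (add_le_add k4 k3)) k2)) k1))
    k0).trans (le_of_eq ?_))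
  ring

theorem integrable_linear (a b : ℝ) : Integrable fun x => (a * x + b) * p x := by
  simpa using h.integrable_poly 0 0 0 a b

theorem integrable_sub (c : ℝ) : Integrable fun x => (x - c) * p x := by
  simpa [sub_eq_add_neg] using h.integrable_linear 1 (-c)

theorem integrable_rsub (c : ℝ) : Integrable fun x => (c - x) * p x := by
  refine (h.integrable_linear (-1) c).congr (Eventually.of_forall fun x => ?_)
  simp only; ring

theorem integral_sub_mean : ∫ x, (x - m) * p x = 0 := by
  have h1 : Integrable fun x => x * p x := by simpa using h.integrable_linear 1 0
  simp_rw [sub_mul]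
  rw [integral_sub h1 (h.integrable.const_mul m), integral_const_mul, h.integral_id,
    h.integral_one]
  ring

theorem tailMean_eq (x : ℝ) : tailMean m p x = -∫ y in Set.Iic x, (y - m) * p y := by
  rw [tailMean, integral_Ioi_eq_sub (h.integrable_sub m), h.integral_sub_mean, zero_sub]

theorem mul_eq_tailMean {x : ℝ} (hx : x ∈ I) : pearsonB b₀ b₁ b₂ x * p x = tailMean m p x := by
  rw [h.mul_eq x hx, h.tailMean_eq]

theorem neg : IsPearsonDensity (-m) b₀ (-b₁) b₂ (-I) fun x => p (-x) where
  isOpen := h.isOpen.neg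
  ordConnected := by
    refine ⟨fun x hx y hy z hz => ?_⟩
    exact h.ordConnected.out hy hx ⟨neg_le_neg hz.2, neg_le_neg hz.1⟩
  measurable := h.measurable.comp measurable_neg
  pos x hx := h.pos _ hx
  eq_zero x hx := h.eq_zero _ hx
  integrable := h.integrable.comp_neg
  integrable_four := by
    have := h.integrable_four.comp_neg
    refine this.congr (Eventually.of_forall fun x => ?_)
    simp only; ring
  integral_one := by rw [integral_neg_eq_self p, h.integral_one]
  integral_id := by
    rw [← h.integral_id, ← integral_neg_eq_self, ← integral_neg]
    simp
  mul_eq x hx := by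
    have h1 := h.mul_eq_tailMean hx
    have h2 : ∫ y in Set.Iic x, (y - -m) * p (-y) = -tailMean m p (-x) := by
      rw [tailMean, ← integral_neg, ← integral_comp_neg_Iic x fun y => -((y - m) * p y)]
      refine integral_congr_ae (Eventually.of_forall fun y => ?_)
      simp only; ring
    rw [h2, neg_neg, ← h1, pearsonB, pearsonB]
    ring

theorem continuous_tailMean : Continuous (tailMean m p) := by
  have := (continuous_integral_Iic (h.integrable_sub m)).neg
  exact this.congr fun x => (h.tailMean_eq x).symm

theorem continuous_distrib : Continuous (distrib p) := continuous_integral_Iic h.integrable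

theorem lowerMean_eq (x : ℝ) : lowerMean p x = tailMean m p x + (x - m) * distrib p x := by
  rw [h.tailMean_eq, lowerMean, distrib, ← integral_const_mul, ← integral_neg,
    ← integral_add (h.integrable_sub m).integrableOn.fun_neg (h.integrable.const_mul _).integrableOn]
  refine integral_congr_ae (Eventually.of_forall fun y => ?_)
  simp only; ring

theorem upperMean_eq (x : ℝ) :
    upperMean p x = tailMean m p x - (x - m) * (1 - distrib p x) := by
  rw [tailMean, upperMean, distrib, ← h.integral_one, ← integral_Ioi_eq_sub h.integrable,
    ← integral_const_mul,
    ← integral_sub (h.integrable_sub m).integrableOn (h.integrable.const_mul _).integrableOn]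
  refine integral_congr_ae (Eventually.of_forall fun y => ?_)
  simp only; ring

theorem distrib_nonneg (x : ℝ) : 0 ≤ distrib p x :=
  integral_nonneg fun y => h.nonneg y

theorem distrib_le_one (x : ℝ) : distrib p x ≤ 1 := by
  have := integral_Ioi_eq_sub h.integrable x
  rw [h.integral_one] at this
  have h2 : 0 ≤ ∫ y in Set.Ioi x, p y := integral_nonneg fun y => h.nonneg y
  rw [distrib]; linarith

theorem upperMean_nonneg (x : ℝ) : 0 ≤ upperMean p x :=
  setIntegral_nonneg measurableSet_Ioi fun y hy =>
    mul_nonneg (sub_nonneg.2 (le_of_lt hy)) (h.nonneg y)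

theorem lowerMean_nonneg (x : ℝ) : 0 ≤ lowerMean p x :=
  setIntegral_nonneg measurableSet_Iic fun y hy =>
    mul_nonneg (sub_nonneg.2 hy) (h.nonneg y)

theorem nonempty : I.Nonempty := by
  by_contra hI
  rw [Set.not_nonempty_iff_eq_empty] at hI
  have h0 : p = 0 := funext fun x => h.eq_zero x (by simp [hI])
  simpa [h0] using h.integral_one

theorem not_forall_mean_lt : ¬ ∀ x ∈ I, m < x := by
  intro hlt
  have := integral_pos_of_pos_on_open (h.integrable_sub m) (fun x => ?_) h.isOpen h.nonempty
    fun x hx => mul_pos (sub_pos.2 (hlt x hx)) (h.pos x hx)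
  · rw [h.integral_sub_mean] at this; exact lt_irrefl _ this
  · by_cases hx : x ∈ I
    · exact mul_nonneg (sub_nonneg.2 (hlt x hx).le) (h.nonneg x)
    · rw [h.eq_zero x hx, mul_zero]

theorem mean_mem : m ∈ I := by
  by_contra hm
  have h1 := h.not_forall_mean_lt
  have h2 := h.neg.not_forall_mean_lt
  push Not at h1 h2
  obtain ⟨x, hx, hxm⟩ := h1
  obtain ⟨y, hy, hym⟩ := h2
  exact hm (h.ordConnected.out hx hy ⟨hxm, by linarith⟩)

theorem exists_gt_mem {x : ℝ} (hx : x ∈ I) : (I ∩ Set.Ioi x).Nonempty := by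
  have h1 : ∀ᶠ y in 𝓝[>] x, y ∈ I := mem_nhdsWithin_of_mem_nhds (h.isOpen.mem_nhds hx)
  obtain ⟨y, hy, hy'⟩ := (h1.and self_mem_nhdsWithin).exists
  exact ⟨y, hy, hy'⟩

theorem tailMean_pos_of_ge {x : ℝ} (hx : x ∈ I) (hxm : m ≤ x) : 0 < tailMean m p x := by
  rw [tailMean, ← integral_indicator measurableSet_Ioi]
  refine integral_pos_of_pos_on_open ((h.integrable_sub m).indicator measurableSet_Ioi)
    (fun y => Set.indicator_nonneg (fun y hy => ?_) y) (h.isOpen.inter isOpen_Ioi)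
    (h.exists_gt_mem hx) fun y hy => ?_
  · exact mul_nonneg (sub_nonneg.2 (hxm.trans (le_of_lt hy))) (h.nonneg y)
  · rw [Set.indicator_of_mem hy.2]
    exact mul_pos (sub_pos.2 (hxm.trans_lt hy.2)) (h.pos y hy.1)

theorem tailMean_neg (x : ℝ) : tailMean (-m) (fun x => p (-x)) x = tailMean m p (-x) := by
  rw [h.tailMean_eq, tailMean, ← integral_neg]
  rw [← integral_comp_neg_Ioi x (fun y => -((y - m) * p y))]
  refine integral_congr_ae (Eventually.of_forall fun y => ?_)
  simp only; ring

theorem tailMean_pos {x : ℝ} (hx : x ∈ I) : 0 < tailMean m p x := by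
  rcases le_total m x with hxm | hxm
  · exact h.tailMean_pos_of_ge hx hxm
  · have := h.neg.tailMean_pos_of_ge (x := -x) (by simpa using hx) (by linarith)
    rwa [h.tailMean_neg, neg_neg] at this

theorem pearsonB_pos {x : ℝ} (hx : x ∈ I) : 0 < pearsonB b₀ b₁ b₂ x := by
  have h1 := h.tailMean_pos hx
  rw [← h.mul_eq_tailMean hx] at h1
  exact pos_of_mul_pos_left h1 (h.nonneg x)

theorem continuousAt {x : ℝ} (hx : x ∈ I) : ContinuousAt p x := by
  have h1 : ContinuousAt (fun y => tailMean m p y / pearsonB b₀ b₁ b₂ y) x :=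
    (h.continuous_tailMean.continuousAt).div continuous_pearsonB.continuousAt (h.pearsonB_pos hx).ne'
  refine h1.congr ?_
  filter_upwards [h.isOpen.mem_nhds hx] with y hy
  rw [← h.mul_eq_tailMean hy, mul_div_cancel_left₀ _ (h.pearsonB_pos hy).ne']

theorem hasDerivAt_tailMean {x : ℝ} (hx : x ∈ I) :
    HasDerivAt (tailMean m p) (-((x - m) * p x)) x := by
  have := (hasDerivAt_integral_Iic (h.integrable_sub m)
    ((by fun_prop : ContinuousAt (fun y => y - m) x).mul (h.continuousAt hx))).neg
  exact this.congr_of_eventuallyEq (Eventually.of_forall fun y => h.tailMean_eq y)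

theorem hasDerivAt_distrib {x : ℝ} (hx : x ∈ I) : HasDerivAt (distrib p) (p x) x :=
  hasDerivAt_integral_Iic h.integrable (h.continuousAt hx)

theorem hasDerivAt_upperMean {x : ℝ} (hx : x ∈ I) :
    HasDerivAt (upperMean p) (-(1 - distrib p x)) x := by
  have h1 := (h.hasDerivAt_tailMean hx).sub (((hasDerivAt_id x).sub_const m).mul
    ((h.hasDerivAt_distrib hx).const_sub 1))
  refine (h1.congr_of_eventuallyEq (Eventually.of_forall fun y => ?_)).congr_deriv ?_
  · rw [h.upperMean_eq]; simp
  · simp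

theorem continuous_upperMean : Continuous (upperMean p) := by
  have h1 := h.continuous_tailMean
  have h2 := h.continuous_distrib
  have : Continuous fun x => tailMean m p x - (x - m) * (1 - distrib p x) := by fun_prop
  exact this.congr fun x => (h.upperMean_eq x).symm

theorem continuous_lowerMean : Continuous (lowerMean p) := by
  have h1 := h.continuous_tailMean
  have h2 := h.continuous_distrib
  have : Continuous fun x => tailMean m p x + (x - m) * distrib p x := by fun_prop
  exact this.congr fun x => (h.lowerMean_eq x).symm

theorem right_end : (∀ x, m ≤ x → x ∈ I) ∨ ∃ u, m < u ∧ ∀ x, m ≤ x → (x ∈ I ↔ x < u) := by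
  have hm := h.mean_mem
  by_cases hI : BddAbove I
  · right
    have hlt : ∀ x ∈ I, x < sSup I := fun x hx => by
      obtain ⟨y, hy, hxy⟩ := h.exists_gt_mem hx
      exact (show x < y from hxy).trans_le (le_csSup hI hy)
    refine ⟨sSup I, hlt m hm, fun x hx => ⟨hlt x, fun hxu => ?_⟩⟩
    obtain ⟨y, hy, hxy⟩ := exists_lt_of_lt_csSup h.nonempty hxu
    exact h.ordConnected.out hm hy ⟨hx, hxy.le⟩
  · left
    intro x hx
    rw [not_bddAbove_iff] at hI
    obtain ⟨y, hy, hxy⟩ := hI x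
    exact h.ordConnected.out hm hy ⟨hx, hxy.le⟩

theorem tailMean_eq_zero {u : ℝ} (hu : ∀ x, m ≤ x → (x ∈ I ↔ x < u)) (hmu : m < u) :
    tailMean m p u = 0 := by
  refine setIntegral_eq_zero_of_forall_eq_zero fun y hy => ?_
  rw [h.eq_zero y, mul_zero]
  rw [hu y (hmu.le.trans (le_of_lt hy)), not_lt]
  exact le_of_lt hy

theorem upperMean_eq_zero {u : ℝ} (hu : ∀ x, m ≤ x → (x ∈ I ↔ x < u)) (hmu : m < u) :
    upperMean p u = 0 := by
  refine setIntegral_eq_zero_of_forall_eq_zero fun y hy => ?_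
  rw [h.eq_zero y, mul_zero]
  rw [hu y (hmu.le.trans (le_of_lt hy)), not_lt]
  exact le_of_lt hy

theorem pearsonB_end {u : ℝ} (hu : ∀ x, m ≤ x → (x ∈ I ↔ x < u)) (hmu : m < u) :
    pearsonB b₀ b₁ b₂ u = 0 := by
  have hmem : ∀ x, m ≤ x → x < u → x ∈ I := fun x hx hxu => (hu x hx).2 hxu
  have h0 : 0 ≤ pearsonB b₀ b₁ b₂ u := by
    refine ge_of_tendsto (continuous_pearsonB.continuousWithinAt (s := Set.Iio u)) ?_
    filter_upwards [Ioo_mem_nhdsLT hmu] with x hx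
    exact (h.pearsonB_pos (hmem x hx.1.le hx.2)).le
  by_contra hne
  have hbpos : ∀ x ∈ Set.Icc m u, 0 < pearsonB b₀ b₁ b₂ x := by
    intro x hx
    rcases hx.2.lt_or_eq with hxu | rfl
    · exact h.pearsonB_pos (hmem x hx.1 hxu)
    · exact lt_of_le_of_ne h0 (Ne.symm hne)
  obtain ⟨y, hy, hymin⟩ := isCompact_Icc.exists_isMinOn (Set.nonempty_Icc.2 hmu.le)
    (continuous_pearsonB (b₀ := b₀) (b₁ := b₁) (b₂ := b₂)).continuousOn
  set β := pearsonB b₀ b₁ b₂ y with hβ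
  have hβ0 : 0 < β := hbpos y hy
  set K := (u - m) / β with hK
  have hder : ∀ x ∈ Set.Ioo m u, HasDerivAt (fun x => tailMean m p x * Real.exp (K * x))
      (-((x - m) * p x) * Real.exp (K * x) + tailMean m p x * (Real.exp (K * x) * (K * 1))) x :=
    fun x hx => (h.hasDerivAt_tailMean (hmem x hx.1.le hx.2)).mul
      (((hasDerivAt_id x).const_mul K).exp)
  have hmono : MonotoneOn (fun x => tailMean m p x * Real.exp (K * x)) (Set.Icc m u) := by
    refine monotoneOn_of_deriv_nonneg (convex_Icc m u) ?_ ?_ ?_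
    · have := h.continuous_tailMean
      fun_prop
    · rw [interior_Icc]
      exact fun x hx => (hder x hx).differentiableAt.differentiableWithinAt
    · rw [interior_Icc]
      intro x hx
      rw [(hder x hx).deriv, ← h.mul_eq_tailMean (hmem x hx.1.le hx.2)]
      have hb1 : β ≤ pearsonB b₀ b₁ b₂ x := hymin ⟨hx.1.le, hx.2.le⟩
      have hKb : u - m ≤ K * pearsonB b₀ b₁ b₂ x := by
        calc u - m = K * β := by rw [hK]; field_simp
          _ ≤ _ := by
            have : 0 ≤ K := div_nonneg (by linarith) hβ0.le
            gcongr
      have : 0 ≤ (K * pearsonB b₀ b₁ b₂ x - (x - m)) * p x * Real.exp (K * x) :=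
        mul_nonneg (mul_nonneg (by linarith [hx.2]) (h.nonneg x)) (Real.exp_pos _).le
      linarith
  have h1 := hmono (Set.left_mem_Icc.2 hmu.le) (Set.right_mem_Icc.2 hmu.le) hmu.le
  simp only [h.tailMean_eq_zero hu hmu, zero_mul] at h1
  have h2 := mul_pos (h.tailMean_pos h.mean_mem) (Real.exp_pos (K * m))
  linarith

theorem deriv_pearsonB_end {u : ℝ} (hu : ∀ x, m ≤ x → (x ∈ I ↔ x < u)) (hmu : m < u) :
    2 * b₂ * u + b₁ ≤ 0 := by
  have hb := h.pearsonB_end hu hmu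
  have h1 := (hasDerivAt_pearsonB (b₀ := b₀) (b₁ := b₁) (b₂ := b₂) u).hasDerivWithinAt
    (s := Set.Iio u)
  rw [hasDerivWithinAt_iff_tendsto_slope' (by simp)] at h1
  refine le_of_tendsto h1 ?_
  filter_upwards [Ioo_mem_nhdsLT hmu] with x hx
  rw [slope_def_field, hb, sub_zero]
  exact div_nonpos_of_nonneg_of_nonpos (h.pearsonB_pos ((hu x hx.1.le).2 hx.2)).le
    (by linarith [hx.2])

end IsPearsonDensity

namespace IsPearsonDensity

variable {m b₀ b₁ b₂ : ℝ} {I : Set ℝ} {p : ℝ → ℝ} (h : IsPearsonDensity m b₀ b₁ b₂ I p)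
include h

theorem hasDerivAt_mul_tailMean {x : ℝ} (hx : x ∈ I) :
    HasDerivAt (fun x => pearsonB b₀ b₁ b₂ x * tailMean m p x)
      ((2 * b₂ * x + b₁ - (x - m)) * tailMean m p x) x := by
  refine ((hasDerivAt_pearsonB x).mul (h.hasDerivAt_tailMean hx)).congr_deriv ?_
  linear_combination (-(x - m)) * h.mul_eq_tailMean hx

theorem convex : Convex ℝ I := h.ordConnected.convex

theorem lt_half_of_nonneg (hk : 0 ≤ (2 * b₂ - 1) * m + m + b₁) : b₂ < 1 / 2 := by
  by_contra! hb
  have hsub : ∀ x, m < x → 0 ≤ 2 * b₂ * x + b₁ - (x - m) := fun x hx => by nlinarith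
  have hmono : ∀ x, (∀ y ∈ Set.Ico m x, y ∈ I) → m ≤ x →
      pearsonB b₀ b₁ b₂ m * tailMean m p m ≤ pearsonB b₀ b₁ b₂ x * tailMean m p x := by
    intro x hI hx
    have : MonotoneOn (fun x => pearsonB b₀ b₁ b₂ x * tailMean m p x) (Set.Icc m x) := by
      refine monotoneOn_of_deriv_nonneg (convex_Icc m x)
        (continuous_pearsonB.mul h.continuous_tailMean).continuousOn ?_ ?_
      · rw [interior_Icc]
        exact fun y hy => (h.hasDerivAt_mul_tailMean
          (hI y ⟨hy.1.le, hy.2⟩)).differentiableAt.differentiableWithinAt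
      · rw [interior_Icc]
        intro y hy
        have hyI := hI y ⟨hy.1.le, hy.2⟩
        rw [(h.hasDerivAt_mul_tailMean hyI).deriv]
        exact mul_nonneg (hsub y hy.1) (h.tailMean_pos hyI).le
    exact this (Set.left_mem_Icc.2 hx) (Set.right_mem_Icc.2 hx) hx
  have hpos : 0 < pearsonB b₀ b₁ b₂ m * tailMean m p m :=
    mul_pos (h.pearsonB_pos h.mean_mem) (h.tailMean_pos h.mean_mem)
  rcases h.right_end with hI | ⟨u, hmu, hu⟩
  · have hint : IntegrableOn (fun x => pearsonB b₀ b₁ b₂ x ^ 2 * p x) (Set.Ici m) := by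
      refine ((h.integrable_poly (b₂ ^ 2) (2 * b₂ * b₁) (b₁ ^ 2 + 2 * b₂ * b₀) (2 * b₁ * b₀)
        (b₀ ^ 2)).congr (Eventually.of_forall fun x => ?_)).integrableOn
      simp only [pearsonB]; ring
    have hc : IntegrableOn (fun _ : ℝ => pearsonB b₀ b₁ b₂ m * tailMean m p m) (Set.Ici m) := by
      refine Integrable.mono' hint aestronglyMeasurable_const ?_
      filter_upwards [ae_restrict_mem measurableSet_Ici] with x hx
      rw [Real.norm_eq_abs, abs_of_pos hpos]
      refine (hmono x (fun y hy => hI y hy.1) hx).trans (le_of_eq ?_)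
      rw [← h.mul_eq_tailMean (hI x hx)]; ring
    rw [integrableOn_const_iff] at hc
    simp only [hpos.ne', enorm_eq_zero, Real.volume_Ici, lt_self_iff_false, or_self] at hc
  · have := hmono u (fun y hy => (hu y hy.1).2 hy.2) hmu.le
    rw [h.tailMean_eq_zero hu hmu, mul_zero] at this
    linarith

theorem lt_half : b₂ < 1 / 2 := by
  rcases le_total 0 ((2 * b₂ - 1) * m + m + b₁) with hk | hk
  · exact h.lt_half_of_nonneg hk
  · exact h.neg.lt_half_of_nonneg (by linarith)

theorem upperMean_mul_le_tail (x : ℝ) (hx : m ≤ x) :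
    upperMean p x * (x - m) ≤ ∫ y in Set.Ioi x, (y - m) ^ 2 * p y := by
  have hi : Integrable fun y => (y - m) ^ 2 * p y := by
    refine (h.integrable_poly 0 0 1 (-(2 * m)) (m ^ 2)).congr (Eventually.of_forall fun y => ?_)
    simp only; ring
  rw [upperMean, ← integral_mul_const]
  refine setIntegral_mono_on ((h.integrable_sub x).mul_const _).integrableOn hi.integrableOn
    measurableSet_Ioi fun y hy => ?_
  have h1 : (y - x) * (x - m) ≤ (y - m) ^ 2 := by
    have : x < y := hy
    nlinarith
  nlinarith [mul_le_mul_of_nonneg_right h1 (h.nonneg y)]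

theorem exists_coeff_pos : ∃ x₁ ∈ I, m < x₁ ∧ 0 < x₁ - m - (2 * b₂ * x₁ + b₁) := by
  have hb := h.lt_half
  rcases h.right_end with hI | ⟨u, hmu, hu⟩
  · refine ⟨max (m + 1) ((m + b₁ + 1) / (1 - 2 * b₂)), hI _ ?_, ?_, ?_⟩
    · exact le_max_of_le_left (by linarith)
    · exact lt_max_of_lt_left (by linarith)
    · have := le_max_right (m + 1) ((m + b₁ + 1) / (1 - 2 * b₂))
      rw [div_le_iff₀ (by linarith)] at this
      linarith
  · have h1 := h.deriv_pearsonB_end hu hmu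
    have hc : ContinuousAt (fun x => x - m - (2 * b₂ * x + b₁)) u := by fun_prop
    have h2 : ∀ᶠ x in 𝓝[<] u, 0 < x - m - (2 * b₂ * x + b₁) :=
      mem_nhdsWithin_of_mem_nhds (hc.eventually_const_lt (by linarith))
    obtain ⟨x, hx, hx'⟩ := (h2.and (Ioo_mem_nhdsLT hmu)).exists
    exact ⟨x, (hu x hx'.1.le).2 hx'.2, hx'.1, hx⟩

theorem exists_upperMean_mul_le : ∃ x₁ ∈ I, m < x₁ ∧ ∃ δ > 0, ∀ x ∈ I, x₁ ≤ x →
    δ * (upperMean p x * (x - m)) ≤ pearsonB b₀ b₁ b₂ x * tailMean m p x := by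
  obtain ⟨x₁, hx₁, hm₁, hδ⟩ := h.exists_coeff_pos
  have hb := h.lt_half
  refine ⟨x₁, hx₁, hm₁, _, hδ, fun x hx hxx => ?_⟩
  set δ := x₁ - m - (2 * b₂ * x₁ + b₁) with hδdef
  have hder : ∀ y ∈ I, HasDerivAt
      (fun x => pearsonB b₀ b₁ b₂ x * tailMean m p x - δ * (upperMean p x * (x - m)))
      ((2 * b₂ * y + b₁ - (y - m)) * tailMean m p y -
        δ * (-(1 - distrib p y) * (y - m) + upperMean p y * 1)) y := fun y hy =>
    (h.hasDerivAt_mul_tailMean hy).sub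
      (((h.hasDerivAt_upperMean hy).mul ((hasDerivAt_id y).sub_const m)).const_mul δ)
  have hanti : AntitoneOn (fun x => pearsonB b₀ b₁ b₂ x * tailMean m p x -
      δ * (upperMean p x * (x - m))) (I ∩ Set.Ici x₁) := by
    refine antitoneOn_of_deriv_nonpos (h.convex.inter (convex_Ici x₁)) ?_ ?_ ?_
    · exact fun y hy => (hder y hy.1).continuousAt.continuousWithinAt
    · exact fun y hy => (hder y (interior_subset hy).1).differentiableAt.differentiableWithinAt
    · intro y hy
      obtain ⟨hyI, hy1⟩ := interior_subset hy
      have hy1 : x₁ ≤ y := hy1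
      rw [(hder y hyI).deriv]
      have hT := (h.tailMean_pos hyI).le
      have hR := h.upperMean_nonneg y
      have e := h.upperMean_eq y
      have e1 : (2 * b₂ * y + b₁ - (y - m)) + δ ≤ 0 := by
        rw [hδdef]; nlinarith
      have e2 := mul_nonneg hδ.le hR
      have e3 := mul_nonneg (neg_nonneg.2 e1) hT
      have e4 : δ * upperMean p y = δ * tailMean m p y - δ * ((y - m) * (1 - distrib p y)) := by
        rw [e]; ring
      nlinarith
  have hlow : ∀ y ∈ I, x ≤ y → -(δ * (upperMean p y * (y - m))) ≤
      pearsonB b₀ b₁ b₂ x * tailMean m p x - δ * (upperMean p x * (x - m)) := fun y hy hxy => by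
    have h1 := hanti ⟨hx, hxx⟩ ⟨hy, hxx.trans hxy⟩ hxy
    have h2 := mul_nonneg (h.pearsonB_pos hy).le (h.tailMean_pos hy).le
    simp only at h1
    linarith
  have hmx : m ≤ x := hm₁.le.trans hxx
  suffices 0 ≤ pearsonB b₀ b₁ b₂ x * tailMean m p x - δ * (upperMean p x * (x - m)) by linarith
  rcases h.right_end with hI | ⟨u, hmu, hu⟩
  · have hi : Integrable fun y => (y - m) ^ 2 * p y := by
      refine (h.integrable_poly 0 0 1 (-(2 * m)) (m ^ 2)).congr (Eventually.of_forall fun y => ?_)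
      simp only; ring
    have h1 := ((tendsto_integral_Ioi_atTop hi).const_mul δ).neg
    rw [mul_zero, neg_zero] at h1
    refine le_of_tendsto h1 ?_
    filter_upwards [eventually_ge_atTop x] with y hy
    refine le_trans ?_ (hlow y (hI y (hmx.trans hy)) hy)
    have := h.upperMean_mul_le_tail y (hmx.trans hy)
    gcongr
  · have hc : Continuous fun y => -(δ * (upperMean p y * (y - m))) := by
      have := h.continuous_upperMean
      fun_prop
    have h1 : Tendsto (fun y => -(δ * (upperMean p y * (y - m)))) (𝓝[<] u)
        (𝓝 (-(δ * (upperMean p u * (u - m))))) := hc.continuousWithinAt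
    rw [h.upperMean_eq_zero hu hmu, zero_mul, mul_zero, neg_zero] at h1
    refine le_of_tendsto h1 ?_
    filter_upwards [Ioo_mem_nhdsLT ((hu x hmx).1 hx)] with y hy
    exact hlow y ((hu y (hmx.trans hy.1.le)).2 hy.2) hy.1.le

theorem exists_kernel_bound_right : ∃ K, ∀ x ∈ I, m ≤ x →
    upperMean p x * lowerMean p x ≤ K * (pearsonB b₀ b₁ b₂ x * tailMean m p x) := by
  obtain ⟨x₁, hx₁, hm₁, δ, hδ, hbd⟩ := h.exists_upperMean_mul_le
  have hsub : Set.Icc m x₁ ⊆ I := fun x hx => h.ordConnected.out h.mean_mem hx₁ hx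
  have hpos : ∀ x ∈ I, 0 < pearsonB b₀ b₁ b₂ x * tailMean m p x := fun x hx =>
    mul_pos (h.pearsonB_pos hx) (h.tailMean_pos hx)
  have hcont : ContinuousOn (fun x => upperMean p x * lowerMean p x /
      (pearsonB b₀ b₁ b₂ x * tailMean m p x)) (Set.Icc m x₁) :=
    (h.continuous_upperMean.mul h.continuous_lowerMean).continuousOn.div
      (continuous_pearsonB.mul h.continuous_tailMean).continuousOn
      fun x hx => (hpos x (hsub hx)).ne'
  obtain ⟨K₁, hK₁⟩ := isCompact_Icc.exists_bound_of_continuousOn hcont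
  set K₂ := (tailMean m p m / (x₁ - m) + 1) / δ with hK₂
  refine ⟨max K₁ K₂, fun x hx hmx => ?_⟩
  have hp := hpos x hx
  rcases le_total x x₁ with hxx | hxx
  · have h1 := (le_abs_self _).trans (hK₁ x ⟨hmx, hxx⟩)
    rw [div_le_iff₀ hp] at h1
    exact h1.trans (mul_le_mul_of_nonneg_right (le_max_left _ _) hp.le)
  · refine le_trans ?_ (mul_le_mul_of_nonneg_right (le_max_right _ _) hp.le)
    have hR := h.upperMean_nonneg x
    have hanti : AntitoneOn (tailMean m p) (I ∩ Set.Ici m) := by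
      refine antitoneOn_of_deriv_nonpos (h.convex.inter (convex_Ici m))
        h.continuous_tailMean.continuousOn ?_ ?_
      · exact fun y hy => (h.hasDerivAt_tailMean
          (interior_subset hy).1).differentiableAt.differentiableWithinAt
      · intro y hy
        obtain ⟨hyI, hy1⟩ := interior_subset hy
        rw [(h.hasDerivAt_tailMean hyI).deriv]
        exact neg_nonpos.2 (mul_nonneg (sub_nonneg.2 hy1) (h.nonneg y))
    have hT : tailMean m p x ≤ tailMean m p m :=
      hanti ⟨h.mean_mem, Set.self_mem_Ici⟩ ⟨hx, hmx⟩ hmx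
    have e1 := h.upperMean_eq x
    have e2 := h.lowerMean_eq x
    have e3 : upperMean p x ≤ tailMean m p m := by
      have := mul_nonneg (sub_nonneg.2 hmx) (sub_nonneg.2 (h.distrib_le_one x))
      linarith
    have e4 : lowerMean p x = upperMean p x + (x - m) := by rw [e1, e2]; ring
    have hT0 : 0 ≤ tailMean m p m := (h.tailMean_pos h.mean_mem).le
    have hd : 0 < x₁ - m := by linarith
    have e5 : tailMean m p m ≤ tailMean m p m / (x₁ - m) * (x - m) := by
      rw [div_mul_eq_mul_div, le_div_iff₀ hd]
      gcongr
    calc upperMean p x * lowerMean p x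
        ≤ upperMean p x * ((tailMean m p m / (x₁ - m) + 1) * (x - m)) := by
          gcongr; rw [e4]; linarith
      _ = (tailMean m p m / (x₁ - m) + 1) / δ * (δ * (upperMean p x * (x - m))) := by
          field_simp
      _ ≤ _ := by
          rw [hK₂]
          exact mul_le_mul_of_nonneg_left (hbd x hx hxx) (by positivity)

theorem exists_kernel_bound : ∃ K, 0 ≤ K ∧ ∀ x ∈ I,
    upperMean p x * lowerMean p x ≤ K * (pearsonB b₀ b₁ b₂ x * tailMean m p x) := by
  obtain ⟨K₁, hK₁⟩ := h.exists_kernel_bound_right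
  obtain ⟨K₂, hK₂⟩ := h.neg.exists_kernel_bound_right
  refine ⟨max 0 (max K₁ K₂), le_max_left _ _, fun x hx => ?_⟩
  have hp := mul_nonneg (h.pearsonB_pos hx).le (h.tailMean_pos hx).le
  rcases le_total m x with hmx | hmx
  · exact (hK₁ x hx hmx).trans (mul_le_mul_of_nonneg_right
      (le_max_of_le_right (le_max_left _ _)) hp)
  · have h1 := hK₂ (-x) (by simpa using hx) (by linarith)
    rw [upperMean_neg, lowerMean_neg, h.tailMean_neg, neg_neg, mul_comm (lowerMean p x),
      show pearsonB b₀ (-b₁) b₂ (-x) = pearsonB b₀ b₁ b₂ x by simp [pearsonB]] at h1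
    exact h1.trans (mul_le_mul_of_nonneg_right (le_max_of_le_right (le_max_right _ _)) hp)

end IsPearsonDensity

/-- A solution `f` of the Stein equation `b f' - (x - m) f = h - e` on `I`, with derivative `φ`
extended by zero outside of `I`. -/
structure IsSteinSolution (m b₀ b₁ b₂ : ℝ) (I : Set ℝ) (h : ℝ → ℝ) (e C D : ℝ) (φ f : ℝ → ℝ) :
    Prop where
  measurable : Measurable φ
  continuousOn : ContinuousOn φ I
  eq_zero : ∀ x, x ∉ I → φ x = 0
  abs_deriv_le : ∀ x, |φ x| ≤ D
  hasDerivAt : ∀ x ∈ I, HasDerivAt f (φ x) x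
  eq_sub : ∀ x ∈ I, pearsonB b₀ b₁ b₂ x * φ x - (x - m) * f x = h x - e
  abs_le : ∀ x ∈ I, |f x| ≤ C

theorem IsSteinSolution.neg {m b₀ b₁ b₂ e C D : ℝ} {I : Set ℝ} {h φ f : ℝ → ℝ}
    (H : IsSteinSolution m b₀ b₁ b₂ I h e C D φ f) :
    IsSteinSolution (-m) b₀ (-b₁) b₂ (-I) (fun x => h (-x)) e C D (fun x => φ (-x))
      (fun x => -f (-x)) where
  measurable := H.measurable.comp measurable_neg
  continuousOn := H.continuousOn.comp continuous_neg.continuousOn fun x hx => hx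
  eq_zero x hx := H.eq_zero _ hx
  abs_deriv_le x := H.abs_deriv_le _
  hasDerivAt x hx := by
    have := ((H.hasDerivAt (-x) hx).scomp x (hasDerivAt_neg x)).neg
    exact this.congr_deriv (by simp)
  eq_sub x hx := by
    have := H.eq_sub (-x) hx
    simp only [pearsonB] at *
    linarith
  abs_le x hx := by rw [abs_neg]; exact H.abs_le _ hx

namespace IsPearsonDensity

variable {m b₀ b₁ b₂ : ℝ} {I : Set ℝ} {p : ℝ → ℝ} (hd : IsPearsonDensity m b₀ b₁ b₂ I p)
include hd

theorem integrable_lipschitz_mul {h : ℝ → ℝ} {C : ℝ} (hh : ∀ x y, |h x - h y| ≤ C * |x - y|)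
    (hc : Continuous h) : Integrable fun x => h x * p x := by
  refine (((hd.integrable_linear 1 0).abs.const_mul C).add (hd.integrable.const_mul |h 0|)).mono'
    (hc.aestronglyMeasurable.mul hd.integrable.1) (Eventually.of_forall fun x => ?_)
  have hp := hd.nonneg x
  have h1 : |h x| ≤ C * |x| + |h 0| := by
    have e1 := hh x 0
    rw [sub_zero] at e1
    linarith [abs_sub_abs_le_abs_sub (h x) (h 0)]
  rw [Real.norm_eq_abs, abs_mul, abs_of_nonneg hp]
  refine (mul_le_mul_of_nonneg_right h1 hp).trans (le_of_eq ?_)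
  simp only [Pi.add_apply, one_mul, add_zero, abs_mul, abs_of_nonneg hp]
  ring

theorem stein_numerator_bounds {h : ℝ → ℝ} {C : ℝ} (hh : ∀ x y, |h x - h y| ≤ C * |x - y|)
    (hc : Continuous h) (x : ℝ) :
    ∃ A B, |A| ≤ C * lowerMean p x ∧ |B| ≤ C * upperMean p x ∧
      h x - ∫ y, h y * p y = A - B ∧
      ∫ y in Set.Iic x, (h y - ∫ z, h z * p z) * p y =
        -((1 - distrib p x) * A) - distrib p x * B := by
  have hi := hd.integrable_lipschitz_mul hh hc
  have hp := hd.integrable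
  have hA : ∫ y in Set.Iic x, (h x - h y) * p y =
      h x * distrib p x - ∫ y in Set.Iic x, h y * p y := by
    simp_rw [sub_mul]
    rw [integral_sub (hp.const_mul _).integrableOn hi.integrableOn, integral_const_mul, distrib]
  have hB : ∫ y in Set.Ioi x, (h y - h x) * p y =
      ((∫ y, h y * p y) - ∫ y in Set.Iic x, h y * p y) - h x * (1 - distrib p x) := by
    simp_rw [sub_mul]
    rw [integral_sub hi.integrableOn (hp.const_mul _).integrableOn, integral_const_mul,
      integral_Ioi_eq_sub hi, integral_Ioi_eq_sub hp, hd.integral_one, distrib]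
  have hN : ∫ y in Set.Iic x, (h y - ∫ z, h z * p z) * p y =
      (∫ y in Set.Iic x, h y * p y) - (∫ z, h z * p z) * distrib p x := by
    simp_rw [sub_mul]
    rw [integral_sub hi.integrableOn (hp.const_mul _).integrableOn, integral_const_mul, distrib]
  refine ⟨∫ y in Set.Iic x, (h x - h y) * p y, ∫ y in Set.Ioi x, (h y - h x) * p y,
    ?_, ?_, ?_, ?_⟩
  · rw [lowerMean, ← integral_const_mul, ← Real.norm_eq_abs]
    refine norm_integral_le_of_norm_le ((hd.integrable_rsub x).const_mul C).integrableOn ?_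
    filter_upwards [ae_restrict_mem measurableSet_Iic] with y hy
    rw [norm_mul, Real.norm_eq_abs, Real.norm_eq_abs, abs_of_nonneg (hd.nonneg y), ← mul_assoc]
    refine mul_le_mul_of_nonneg_right ((hh x y).trans_eq ?_) (hd.nonneg y)
    rw [abs_of_nonneg (sub_nonneg.2 hy)]
  · rw [upperMean, ← integral_const_mul, ← Real.norm_eq_abs]
    refine norm_integral_le_of_norm_le ((hd.integrable_sub x).const_mul C).integrableOn ?_
    filter_upwards [ae_restrict_mem measurableSet_Ioi] with y hy
    rw [norm_mul, Real.norm_eq_abs, Real.norm_eq_abs, abs_of_nonneg (hd.nonneg y), ← mul_assoc]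
    refine mul_le_mul_of_nonneg_right ((hh y x).trans_eq ?_) (hd.nonneg y)
    rw [abs_of_nonneg (sub_nonneg.2 (le_of_lt hy))]
  · rw [hA, hB]; ring
  · rw [hA, hB, hN]; ring

theorem exists_isSteinSolution {K : ℝ} (hK0 : 0 ≤ K) (hK : ∀ x ∈ I,
    upperMean p x * lowerMean p x ≤ K * (pearsonB b₀ b₁ b₂ x * tailMean m p x))
    {h : ℝ → ℝ} {C : ℝ} (hC : 0 ≤ C) (hh : ∀ x y, |h x - h y| ≤ C * |x - y|)
    (hc : Continuous h) :
    ∃ φ f, IsSteinSolution m b₀ b₁ b₂ I h (∫ y, h y * p y) C (2 * C * K) φ f := by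
  have hi := hd.integrable_lipschitz_mul hh hc
  set e := ∫ y, h y * p y with he
  set N : ℝ → ℝ := fun x => ∫ y in Set.Iic x, (h y - e) * p y with hN
  have hNi : Integrable fun y => (h y - e) * p y := by
    simp_rw [sub_mul]; exact hi.sub (hd.integrable.const_mul e)
  have hNc : Continuous N := continuous_integral_Iic hNi
  have hT := hd.continuous_tailMean
  set f : ℝ → ℝ := fun x => N x / tailMean m p x with hf
  set ψ : ℝ → ℝ := fun x => (h x - e + (x - m) * f x) / pearsonB b₀ b₁ b₂ x with hψ
  have hfc : ContinuousOn f I := hNc.continuousOn.div hT.continuousOn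
    fun x hx => (hd.tailMean_pos hx).ne'
  have hψc : ContinuousOn ψ I := ContinuousOn.div
    ((hc.continuousOn.sub continuousOn_const).add ((by fun_prop : ContinuousOn (fun x => x - m) I).mul
      hfc)) continuous_pearsonB.continuousOn fun x hx => (hd.pearsonB_pos hx).ne'
  have hψm : Measurable ψ := by
    have h1 := hc.measurable
    have h2 := hNc.measurable
    have h3 := hT.measurable
    have h4 := (continuous_pearsonB (b₀ := b₀) (b₁ := b₁) (b₂ := b₂)).measurable
    fun_prop
  have hD : ∀ x ∈ I, |ψ x| ≤ 2 * C * K := by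
    intro x hx
    obtain ⟨A, B, hA, hB, e1, e2⟩ := hd.stein_numerator_bounds hh hc x
    have hb := hd.pearsonB_pos hx
    have ht := hd.tailMean_pos hx
    have hL := hd.lowerMean_nonneg x
    have hR := hd.upperMean_nonneg x
    have e3 : ψ x * (pearsonB b₀ b₁ b₂ x * tailMean m p x) =
        A * upperMean p x - B * lowerMean p x := by
      have : N x = -((1 - distrib p x) * A) - distrib p x * B := e2
      simp only [hψ, hf]
      rw [this, e1, hd.lowerMean_eq, hd.upperMean_eq]
      field_simp
      ring
    have e4 : |A * upperMean p x - B * lowerMean p x| ≤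
        2 * C * (upperMean p x * lowerMean p x) := by
      refine (abs_sub _ _).trans ?_
      rw [abs_mul, abs_mul, abs_of_nonneg hL, abs_of_nonneg hR]
      have := mul_le_mul_of_nonneg_right hA hR
      have := mul_le_mul_of_nonneg_right hB hL
      linarith
    rw [← e3, abs_mul, abs_of_pos (mul_pos hb ht)] at e4
    have e5 := e4.trans (mul_le_mul_of_nonneg_left (hK x hx) (by positivity))
    rw [← mul_assoc (2 * C)] at e5
    exact le_of_mul_le_mul_right e5 (mul_pos hb ht)
  refine ⟨I.indicator ψ, f, hψm.indicator hd.isOpen.measurableSet,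
    hψc.congr fun x hx => Set.indicator_of_mem hx _, fun x hx => Set.indicator_of_notMem hx _,
    fun x => ?_, fun x hx => ?_, fun x hx => ?_, fun x hx => ?_⟩
  · by_cases hx : x ∈ I
    · rw [Set.indicator_of_mem hx]; exact hD x hx
    · rw [Set.indicator_of_notMem hx, abs_zero]; positivity
  · rw [Set.indicator_of_mem hx]
    have ht := hd.tailMean_pos hx
    have hb := hd.pearsonB_pos hx
    have h1 : HasDerivAt N ((h x - e) * p x) x := hasDerivAt_integral_Iic hNi
      ((hc.continuousAt.sub continuousAt_const).mul (hd.continuousAt hx))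
    refine (h1.div (hd.hasDerivAt_tailMean hx) ht.ne').congr_deriv ?_
    have e1 : p x = tailMean m p x / pearsonB b₀ b₁ b₂ x := by
      rw [← hd.mul_eq_tailMean hx]; field_simp
    simp only [hψ, hf]
    rw [e1]
    field_simp
    ring
  · rw [Set.indicator_of_mem hx]
    have hb := hd.pearsonB_pos hx
    simp only [hψ]
    field_simp
    ring
  · obtain ⟨A, B, hA, hB, e1, e2⟩ := hd.stein_numerator_bounds hh hc x
    have ht := hd.tailMean_pos hx
    have : N x = -((1 - distrib p x) * A) - distrib p x * B := e2
    simp only [hf]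
    rw [abs_div, abs_of_pos ht, div_le_iff₀ ht, this]
    have h0 := hd.distrib_nonneg x
    have h1 := sub_nonneg.2 (hd.distrib_le_one x)
    refine (abs_sub _ _).trans ?_
    rw [abs_neg, abs_mul, abs_mul, abs_of_nonneg h0, abs_of_nonneg h1]
    have e3 := mul_le_mul_of_nonneg_left hA h1
    have e4 := mul_le_mul_of_nonneg_left hB h0
    rw [hd.lowerMean_eq] at e3
    rw [hd.upperMean_eq] at e4
    refine (add_le_add e3 e4).trans (le_of_eq ?_)
    ring

end IsPearsonDensity

/-- The excess of `x` over the upper end of `I`. -/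
noncomputable def rightExcess (m : ℝ) (I : Set ℝ) (x : ℝ) : ℝ :=
  open Classical in if m < x ∧ x ∉ I then x - sSup I else 0

namespace IsPearsonDensity

variable {m b₀ b₁ b₂ : ℝ} {I : Set ℝ} {p : ℝ → ℝ} (hd : IsPearsonDensity m b₀ b₁ b₂ I p)
include hd

theorem rightExcess_cases : ((∀ x, m ≤ x → x ∈ I) ∧ ∀ x, rightExcess m I x = 0) ∨
    ∃ u, m < u ∧ (∀ x, m ≤ x → (x ∈ I ↔ x < u)) ∧ ∀ x, rightExcess m I x = max (x - u) 0 := by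
  rcases hd.right_end with hI | ⟨u, hmu, hu⟩
  · refine Or.inl ⟨hI, fun x => if_neg fun hx => hx.2 (hI x hx.1.le)⟩
  · refine Or.inr ⟨u, hmu, hu, fun x => ?_⟩
    have hsup : sSup I = u := by
      have hle : ∀ y ∈ I, y ≤ u := fun y hy => by
        rcases le_total m y with hmy | hmy
        · exact ((hu y hmy).1 hy).le
        · linarith
      refine csSup_eq_of_forall_le_of_forall_lt_exists_gt hd.nonempty hle fun w hw => ?_
      obtain ⟨z, hz1, hz2⟩ := exists_between (max_lt hmu hw)
      exact ⟨z, (hu z ((le_max_left _ _).trans hz1.le)).2 hz2, (le_max_right _ _).trans_lt hz1⟩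
    rw [rightExcess, hsup]
    split_ifs with hx
    · have := hx.2
      rw [hu x hx.1.le, not_lt] at this
      rw [max_eq_left (by linarith)]
    · rw [max_eq_right]
      by_contra! hlt
      exact hx ⟨by linarith, by rw [hu x (by linarith)]; linarith⟩

theorem rightExcess_nonneg (x : ℝ) : 0 ≤ rightExcess m I x := by
  rcases hd.rightExcess_cases with ⟨-, h⟩ | ⟨u, -, -, h⟩ <;> simp [h]

/-- The extended Stein solution, constant outside of `I`, solves the Stein equation up to the
distance to `I`. -/
theorem abs_stein_residual_le {h φ f : ℝ → ℝ} {e C D : ℝ} (hC : 0 ≤ C)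
    (hh : ∀ x y, |h x - h y| ≤ C * |x - y|) (hc : Continuous h)
    (H : IsSteinSolution m b₀ b₁ b₂ I h e C D φ f) {x : ℝ} (hx : m ≤ x) :
    |h x - e - (pearsonB b₀ b₁ b₂ x * φ x - (x - m) * ((∫ t in m..x, φ t) + f m))| ≤
      2 * C * rightExcess m I x := by
  have hin : ∀ x ∈ I, m ≤ x → (∫ t in m..x, φ t) + f m = f x := by
    intro x hxI hmx
    have hsub : Set.uIcc m x ⊆ I := by
      rw [Set.uIcc_of_le hmx]; exact fun y hy => hd.ordConnected.out hd.mean_mem hxI hy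
    rw [intervalIntegral.integral_eq_sub_of_hasDerivAt (fun y hy => H.hasDerivAt y (hsub hy))
      (H.continuousOn.mono hsub).intervalIntegrable]
    ring
  by_cases hxI : x ∈ I
  · rw [hin x hxI hx, H.eq_sub x hxI, sub_self, abs_zero]
    have := hd.rightExcess_nonneg x
    positivity
  rcases hd.rightExcess_cases with ⟨hI, -⟩ | ⟨u, hmu, hu, hρ⟩
  · exact absurd (hI x hx) hxI
  have hux : u ≤ x := by rwa [hu x hx, not_lt] at hxI
  have hφi : ∀ a b, IntervalIntegrable φ volume a b := fun a b =>
    (intervalIntegrable_const (c := D)).mono_fun' H.measurable.aestronglyMeasurable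
      (Eventually.of_forall fun y => H.abs_deriv_le y)
  set c := (∫ t in m..u, φ t) + f m with hcdef
  have hconst : (∫ t in m..x, φ t) + f m = c := by
    rw [hcdef, ← intervalIntegral.integral_add_adjacent_intervals (hφi m u) (hφi u x)]
    have : ∫ t in u..x, φ t = 0 := by
      rw [intervalIntegral.integral_of_le hux]
      refine setIntegral_eq_zero_of_forall_eq_zero fun y hy => H.eq_zero y ?_
      rw [hu y (hmu.le.trans hy.1.le), not_lt]; exact hy.1.le
    rw [this, add_zero]
  have hlim : Tendsto (fun y => (∫ t in m..y, φ t) + f m) (𝓝[<] u) (𝓝 c) :=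
    ((intervalIntegral.continuous_primitive hφi m).add continuous_const).continuousWithinAt
  have hIoo : ∀ᶠ y in 𝓝[<] u, y ∈ I ∧ m ≤ y := by
    filter_upwards [Ioo_mem_nhdsLT hmu] with y hy using ⟨(hu y hy.1.le).2 hy.2, hy.1.le⟩
  have hfl : Tendsto f (𝓝[<] u) (𝓝 c) := hlim.congr' (by
    filter_upwards [hIoo] with y hy using hin y hy.1 hy.2)
  have hcC : |c| ≤ C := by
    refine le_of_tendsto hfl.abs ?_
    filter_upwards [hIoo] with y hy using H.abs_le y hy.1
  have hbl : Tendsto (fun y => pearsonB b₀ b₁ b₂ y * φ y) (𝓝[<] u) (𝓝 0) := by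
    have h1 : Tendsto (fun y => |pearsonB b₀ b₁ b₂ y| * D) (𝓝[<] u)
        (𝓝 (|pearsonB b₀ b₁ b₂ u| * D)) :=
      ((continuous_pearsonB.abs).mul continuous_const).continuousWithinAt
    rw [hd.pearsonB_end hu hmu, abs_zero, zero_mul] at h1
    refine squeeze_zero_norm (fun y => ?_) h1
    rw [norm_mul]
    exact mul_le_mul_of_nonneg_left (H.abs_deriv_le y) (abs_nonneg _)
  have hequ : 0 - (u - m) * c = h u - e := by
    have h1 : Tendsto (fun y => pearsonB b₀ b₁ b₂ y * φ y - (y - m) * f y) (𝓝[<] u)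
        (𝓝 (0 - (u - m) * c)) := hbl.sub
          (((continuous_id.sub continuous_const).continuousWithinAt (x := u)).tendsto.mul hfl)
    have h2 : Tendsto (fun y => h y - e) (𝓝[<] u) (𝓝 (h u - e)) :=
      (hc.sub continuous_const).continuousWithinAt
    refine tendsto_nhds_unique (h1.congr' ?_) h2
    filter_upwards [hIoo] with y hy using H.eq_sub y hy.1
  rw [hconst, H.eq_zero x hxI, hρ, max_eq_left (by linarith)]
  have e1 : h x - e - (pearsonB b₀ b₁ b₂ x * 0 - (x - m) * c) = (h x - h u) + (x - u) * c := by
    linear_combination -hequ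
  rw [e1]
  have h1 := hh x u
  rw [abs_of_nonneg (sub_nonneg.2 hux)] at h1
  have h2 : |(x - u) * c| ≤ (x - u) * C := by
    rw [abs_mul, abs_of_nonneg (sub_nonneg.2 hux)]
    exact mul_le_mul_of_nonneg_left hcC (sub_nonneg.2 hux)
  refine (abs_add_le _ _).trans ?_
  linarith

end IsPearsonDensity

universe v

section

variable {E : Type v} [MeasurableSpace E] {μ : Measure E} {m : ℝ} {G τ : E → ℝ}

theorem IsSteinKernel.neg (h : IsSteinKernel μ m G τ) :
    IsSteinKernel μ (-m) (fun x => -G x) τ := by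
  refine ⟨h.memLp.neg, h.memLp_kernel, h.nonneg, fun φ hφ ⟨C, hC⟩ => ?_⟩
  rw [← h.integral_eq (fun x => φ (-x)) (hφ.comp continuous_neg) ⟨C, fun x => hC _⟩]
  refine integral_congr_ae (Eventually.of_forall fun x => ?_)
  simp only [intervalIntegral.integral_comp_neg]
  rw [intervalIntegral.integral_symm (-G x)]
  ring

theorem intervalIntegral_indicator_Ici {m u : ℝ} (hmu : m ≤ u) (x : ℝ) :
    ∫ t in m..x, (Set.Ici u).indicator (fun _ => (1 : ℝ)) t = max (x - u) 0 := by
  have hm : Measurable ((Set.Ici u).indicator fun _ => (1 : ℝ)) :=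
    measurable_const.indicator measurableSet_Ici
  have hi : IntervalIntegrable ((Set.Ici u).indicator fun _ => (1 : ℝ)) volume m x :=
    (intervalIntegrable_const (c := (1 : ℝ))).mono_fun' hm.aestronglyMeasurable
      (Eventually.of_forall fun y => by by_cases hy : y ∈ Set.Ici u <;> simp [hy])
  rw [intervalIntegral.integral_eq_sub_of_hasDeriv_right (f := fun t => max (t - u) 0)
    (by fun_prop) (fun y _ => ?_) hi, max_eq_right (sub_nonpos.2 hmu), sub_zero]
  by_cases hy : u ≤ y
  · rw [Set.indicator_of_mem (Set.mem_Ici.2 hy)]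
    refine ((hasDerivAt_id y).sub_const u).hasDerivWithinAt.congr (fun z hz => ?_) ?_
    · exact max_eq_left (by have : y < z := hz; linarith)
    · exact max_eq_left (by linarith)
  · rw [Set.indicator_of_notMem (by simpa using hy)]
    refine ((hasDerivAt_const y (0 : ℝ)).congr_of_eventuallyEq ?_).hasDerivWithinAt
    filter_upwards [Iio_mem_nhds (not_le.1 hy)] with z hz
    exact max_eq_right (by have : z < u := hz; linarith)

variable [IsProbabilityMeasure μ]

theorem IsSteinKernel.integral_eq_indicator_Ici (h : IsSteinKernel μ m G τ) {u : ℝ} (hmu : m ≤ u) :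
    ∫ x, (G x - m) * max (G x - u) 0 ∂μ =
      ∫ x, τ x * (Set.Ici u).indicator (fun _ => (1 : ℝ)) (G x) ∂μ := by
  have hF : IsClosed (Set.Ici u) := isClosed_Ici
  have hcont : ∀ n, Continuous fun x => (hF.apprSeq n x : ℝ) := fun n => by fun_prop
  have hle : ∀ n x, |(hF.apprSeq n x : ℝ)| ≤ 1 := fun n x => by
    rw [abs_of_nonneg (NNReal.coe_nonneg _)]
    exact_mod_cast HasOuterApproxClosed.apprSeq_apply_le_one hF n x
  have h1 := h.integral_eq_of_tendsto (φ := fun n x => (hF.apprSeq n x : ℝ))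
    (ψ := (Set.Ici u).indicator fun _ => (1 : ℝ)) (C := 1) (fun n => (hcont n).measurable)
    (fun n x => (hle n x).trans (by nlinarith [sq_nonneg x])) (fun x => ?_)
    (fun n => h.integral_eq _ (hcont n) ⟨1, hle n⟩)
  · simp_rw [intervalIntegral_indicator_Ici hmu] at h1
    exact h1
  · have h2 := (tendsto_pi_nhds.1 (HasOuterApproxClosed.tendsto_apprSeq hF)) x
    have h3 := (NNReal.continuous_coe.tendsto _).comp h2
    have h4 : (((Set.Ici u).indicator (fun _ => (1 : NNReal)) x : NNReal) : ℝ) =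
        (Set.Ici u).indicator (fun _ => (1 : ℝ)) x := by
      by_cases hx : x ∈ Set.Ici u <;> simp [Set.indicator, hx]
    rw [← h4]
    exact h3

/-- The Stein identity for derivatives supported by an open set. -/
theorem IsSteinKernel.integral_eq_of_continuousOn (h : IsSteinKernel μ m G τ) {I : Set ℝ}
    (hI : IsOpen I) {φ : ℝ → ℝ} {D : ℝ} (hφ : ContinuousOn φ I) (h0 : ∀ x, x ∉ I → φ x = 0)
    (hD : ∀ x, |φ x| ≤ D) :
    ∫ x, (G x - m) * (∫ t in m..G x, φ t) ∂μ = ∫ x, τ x * φ (G x) ∂μ := by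
  have hF : IsClosed Iᶜ := hI.isClosed_compl
  have hD0 : 0 ≤ D := (abs_nonneg _).trans (hD 0)
  have hcχ : ∀ n, Continuous fun x => 1 - (hF.apprSeq n x : ℝ) := fun n => by fun_prop
  have hχ0 : ∀ n x, x ∉ I → 1 - (hF.apprSeq n x : ℝ) = 0 := fun n x hx => by
    rw [HasOuterApproxClosed.apprSeq_apply_eq_one hF n hx]; simp
  have hχ1 : ∀ n x, |1 - (hF.apprSeq n x : ℝ)| ≤ 1 := fun n x => by
    have h1 : (hF.apprSeq n x : ℝ) ≤ 1 := by
      exact_mod_cast HasOuterApproxClosed.apprSeq_apply_le_one hF n x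
    have h2 := NNReal.coe_nonneg (hF.apprSeq n x)
    rw [abs_le]; constructor <;> linarith
  have hbd : ∀ n x, |(1 - (hF.apprSeq n x : ℝ)) * φ x| ≤ D := fun n x => by
    rw [abs_mul]
    calc _ ≤ 1 * D := mul_le_mul (hχ1 n x) (hD x) (abs_nonneg _) zero_le_one
      _ = D := one_mul D
  have hcont : ∀ n, Continuous fun x => (1 - (hF.apprSeq n x : ℝ)) * φ x := fun n => by
    refine continuous_iff_continuousAt.2 fun x => ?_
    by_cases hx : x ∈ I
    · exact (hcχ n).continuousAt.mul (hφ.continuousAt (hI.mem_nhds hx))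
    · have h1 : Tendsto (fun y => |1 - (hF.apprSeq n y : ℝ)| * D) (𝓝 x) (𝓝 0) := by
        have h2 : Continuous fun y => |1 - (hF.apprSeq n y : ℝ)| * D :=
          (hcχ n).abs.mul continuous_const
        have h3 := h2.tendsto x
        rwa [hχ0 n x hx, abs_zero, zero_mul] at h3
      rw [ContinuousAt, h0 x hx, mul_zero]
      refine squeeze_zero_norm (fun y => ?_) h1
      rw [norm_mul]
      exact mul_le_mul_of_nonneg_left (hD y) (abs_nonneg _)
  refine h.integral_eq_of_tendsto (φ := fun n x => (1 - (hF.apprSeq n x : ℝ)) * φ x) (C := D)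
    (fun n => (hcont n).measurable) (fun n x => (hbd n x).trans ?_) (fun x => ?_)
    (fun n => h.integral_eq _ (hcont n) ⟨D, hbd n⟩)
  · nlinarith [mul_nonneg hD0 (sq_nonneg x)]
  · by_cases hx : x ∈ I
    · have h2 := (tendsto_pi_nhds.1 (HasOuterApproxClosed.tendsto_apprSeq hF)) x
      have h3 := (((NNReal.continuous_coe.tendsto _).comp h2).const_sub 1).mul_const (φ x)
      have h4 : Iᶜ.indicator (fun _ => (1 : NNReal)) x = 0 :=
        Set.indicator_of_notMem (by simpa using hx) _
      rw [h4, NNReal.coe_zero, sub_zero, one_mul] at h3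
      exact h3
    · simp [h0 x hx]

end

namespace IsPearsonDensity

variable {m b₀ b₁ b₂ : ℝ} {I : Set ℝ} {p : ℝ → ℝ} (hd : IsPearsonDensity m b₀ b₁ b₂ I p)
include hd

/-- The Stein discrepancy controls the mass above the upper end of `I`. -/
theorem exists_integral_rightExcess_le : ∃ κ : ℝ, 0 ≤ κ ∧
    ∀ {E : Type v} [MeasurableSpace E] (μ : Measure E) [IsProbabilityMeasure μ] (G τ : E → ℝ),
      IsSteinKernel μ m G τ →
      ∫ x, rightExcess m I (G x) ∂μ ≤ κ * ∫ x, |τ x - pearsonB b₀ b₁ b₂ (G x)| ∂μ := by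
  rcases hd.rightExcess_cases with ⟨-, h0⟩ | ⟨u, hmu, hu, hρ⟩
  · exact ⟨0, le_rfl, fun μ _ G τ _ => by simp [h0]⟩
  · refine ⟨1 / (u - m), by have := sub_pos.2 hmu; positivity, fun μ _ G τ h => ?_⟩
    have hb0 := hd.pearsonB_end hu hmu
    have hb1 := hd.deriv_pearsonB_end hu hmu
    have hb2 := hd.lt_half
    have hum := sub_pos.2 hmu
    simp_rw [hρ]
    rw [div_mul_eq_mul_div, one_mul, le_div_iff₀' hum, ← integral_const_mul]
    have hG2 : MemLp G 2 μ := h.memLp.mono_exponent (by norm_num)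
    have hρL : MemLp (fun x => max (G x - u) 0) 2 μ := (hG2.sub (memLp_const u)).pos_part
    have hm : Measurable ((Set.Ici u).indicator fun _ => (1 : ℝ)) :=
      measurable_const.indicator measurableSet_Ici
    have i1 : Integrable (fun x => (G x - m) * max (G x - u) 0) μ :=
      (hG2.sub (memLp_const m)).integrable_mul hρL
    have i2 : Integrable (fun x => τ x * (Set.Ici u).indicator (fun _ => (1 : ℝ)) (G x)) μ :=
      (h.integrable_test (C := 1) hm fun x => by
        by_cases hx : x ∈ Set.Ici u <;> simp [hx] <;> positivity).2
    have i3 : Integrable (fun x => max (G x - u) 0 ^ 2) μ := hρL.integrable_sq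
    have i4 : Integrable (fun x => |τ x - pearsonB b₀ b₁ b₂ (G x)|) μ :=
      ((h.memLp_kernel.sub (MemLp.quadratic_of_four h.memLp b₂ b₁ b₀)).integrable
        (by norm_num)).abs
    have e1 : ∫ x, (u - m) * max (G x - u) 0 ∂μ =
        ∫ x, ((G x - m) * max (G x - u) 0 - max (G x - u) 0 ^ 2) ∂μ := by
      refine integral_congr_ae (Eventually.of_forall fun x => ?_)
      rcases le_total (G x) u with hx | hx
      · simp [hx]
      · simp only [max_eq_left (sub_nonneg.2 hx)]; ring
    rw [e1, integral_sub i1 i3, h.integral_eq_indicator_Ici hmu.le, ← integral_sub i2 i3]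
    refine integral_mono_ae (i2.sub i3) i4 (Eventually.of_forall fun x => ?_)
    simp only
    by_cases hx : u ≤ G x
    · rw [Set.indicator_of_mem (Set.mem_Ici.2 hx), max_eq_left (sub_nonneg.2 hx), mul_one]
      refine le_trans ?_ (le_abs_self _)
      have : pearsonB b₀ b₁ b₂ (G x) ≤ (G x - u) ^ 2 := by
        have e : pearsonB b₀ b₁ b₂ (G x) = pearsonB b₀ b₁ b₂ u + (2 * b₂ * u + b₁) * (G x - u) +
            b₂ * (G x - u) ^ 2 := by simp only [pearsonB]; ring
        rw [e, hb0]
        nlinarith [sq_nonneg (G x - u), mul_nonneg (neg_nonneg.2 hb1) (sub_nonneg.2 hx)]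
      linarith
    · rw [Set.indicator_of_notMem (by simpa using hx), max_eq_right (by linarith)]
      simp

/-- Stein's method for Pearson distributions. -/
theorem exists_stein_bound : ∃ κ : ℝ, 0 ≤ κ ∧
    ∀ {E : Type v} [MeasurableSpace E] (μ : Measure E) [IsProbabilityMeasure μ] (G τ : E → ℝ),
      IsSteinKernel μ m G τ → ∫ x, G x ∂μ = m →
      ∀ (h : ℝ → ℝ) (C : ℝ), 0 ≤ C → (∀ x y, |h x - h y| ≤ C * |x - y|) → Continuous h →
      |(∫ x, h (G x) ∂μ) - ∫ y, h y * p y| ≤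
        κ * C * ∫ x, |τ x - pearsonB b₀ b₁ b₂ (G x)| ∂μ := by
  obtain ⟨K, hK0, hK⟩ := hd.exists_kernel_bound
  obtain ⟨κ₁, hκ₁0, hκ₁⟩ := hd.exists_integral_rightExcess_le.{v}
  obtain ⟨κ₂, hκ₂0, hκ₂⟩ := hd.neg.exists_integral_rightExcess_le.{v}
  refine ⟨2 * κ₁ + 2 * κ₂ + 2 * K, by positivity, fun μ _ G τ hS hmean h C hC hh hc => ?_⟩
  obtain ⟨φ, f, H⟩ := hd.exists_isSteinSolution hK0 hK hC hh hc
  set e := ∫ y, h y * p y with he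
  have hG2 : MemLp G 2 μ := hS.memLp.mono_exponent (by norm_num)
  have hG1 : Integrable G μ := hG2.integrable (by norm_num)
  have hφ : Measurable φ := H.measurable
  have hφq : ∀ x, |φ x| ≤ 2 * C * K * (1 + x ^ 2) := fun x => (H.abs_deriv_le x).trans (by
    have : 0 ≤ 2 * C * K * x ^ 2 := by positivity
    linarith)
  set ρ₁ : ℝ → ℝ := rightExcess m I with hρ₁
  set ρ₂ : ℝ → ℝ := fun x => rightExcess (-m) (-I) (-x) with hρ₂
  have hex : ∀ {m b₀ b₁ b₂ : ℝ} {I : Set ℝ} {p : ℝ → ℝ}, IsPearsonDensity m b₀ b₁ b₂ I p →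
      ∀ {G : _ → ℝ}, MemLp G 2 μ → Integrable (fun x => rightExcess m I (G x)) μ := by
    intro m b₀ b₁ b₂ I p hd G hG
    rcases hd.rightExcess_cases with ⟨-, h0⟩ | ⟨u, hmu, hu, hρ⟩
    · simp [h0]
    · simp_rw [hρ]
      exact ((hG.sub (memLp_const u)).integrable (by norm_num)).pos_part
  have iρ₁ : Integrable (fun x => ρ₁ (G x)) μ := hex hd hG2
  have iρ₂ : Integrable (fun x => ρ₂ (G x)) μ := hex hd.neg hG2.neg
  have hres : ∀ x, |h x - e - (pearsonB b₀ b₁ b₂ x * φ x - (x - m) * ((∫ t in m..x, φ t) + f m))| ≤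
      2 * C * ρ₁ x + 2 * C * ρ₂ x := by
    intro x
    have n1 : 0 ≤ 2 * C * ρ₁ x := mul_nonneg (by positivity) (hd.rightExcess_nonneg x)
    have n2 : 0 ≤ 2 * C * ρ₂ x := mul_nonneg (by positivity) (hd.neg.rightExcess_nonneg (-x))
    rcases le_total m x with hx | hx
    · linarith [hd.abs_stein_residual_le hC hh hc H hx]
    · have h1 := hd.neg.abs_stein_residual_le hC (h := fun x => h (-x))
        (fun x y => (hh (-x) (-y)).trans_eq (by rw [← abs_neg]; ring_nf)) (by fun_prop) H.neg
        (neg_le_neg hx)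
      simp only [neg_neg, intervalIntegral.integral_comp_neg] at h1
      rw [intervalIntegral.integral_symm m x, show pearsonB b₀ (-b₁) b₂ (-x) = pearsonB b₀ b₁ b₂ x by
        simp [pearsonB]] at h1
      have h2 : (-x - -m) * (-(∫ t in m..x, φ t) + -f m) = (x - m) * ((∫ t in m..x, φ t) + f m) := by
        ring
      rw [h2] at h1
      linarith
  have iB : Integrable (fun x => τ x - pearsonB b₀ b₁ b₂ (G x)) μ :=
    (hS.memLp_kernel.sub (MemLp.quadratic_of_four hS.memLp b₂ b₁ b₀)).integrable (by norm_num)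
  have hφG : AEStronglyMeasurable (fun x => φ (G x)) μ :=
    (hφ.comp_aemeasurable hG2.1.aemeasurable).aestronglyMeasurable
  have ih : Integrable (fun x => h (G x)) μ := by
    refine ((hG1.abs.const_mul C).add (integrable_const |h 0|)).mono'
      (hc.comp_aestronglyMeasurable hG2.1) (Eventually.of_forall fun x => ?_)
    have e1 := hh (G x) 0
    rw [sub_zero] at e1
    rw [Real.norm_eq_abs]
    simp only [Pi.add_apply]
    linarith [abs_sub_abs_le_abs_sub (h (G x)) (h 0)]
  obtain ⟨i1, i2⟩ := hS.integrable_test hφ hφq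
  have i4 : Integrable (fun x => f m * (G x - m)) μ := (hG1.sub (integrable_const m)).const_mul _
  have key : (∫ x, h (G x) ∂μ) - e = ∫ x, ((h (G x) - e - (pearsonB b₀ b₁ b₂ (G x) * φ (G x) -
      (G x - m) * ((∫ t in m..G x, φ t) + f m))) -
      (τ x - pearsonB b₀ b₁ b₂ (G x)) * φ (G x)) ∂μ := by
    have e1 : ∀ x, (h (G x) - e - (pearsonB b₀ b₁ b₂ (G x) * φ (G x) -
      (G x - m) * ((∫ t in m..G x, φ t) + f m))) - (τ x - pearsonB b₀ b₁ b₂ (G x)) * φ (G x) =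
      ((h (G x) - e) + f m * (G x - m)) +
        ((G x - m) * (∫ t in m..G x, φ t) - τ x * φ (G x)) := fun x => by ring
    simp_rw [e1]
    have j1 : Integrable (fun x => h (G x) - e) μ := ih.sub (integrable_const e)
    have i12 : Integrable (fun x => (G x - m) * (∫ t in m..G x, φ t) - τ x * φ (G x)) μ :=
      i1.sub i2
    rw [integral_add (j1.fun_add i4) i12, integral_add j1 i4,
      integral_sub ih (integrable_const e), integral_const_mul, integral_sub hG1 (integrable_const m),
      integral_sub i1 i2, hS.integral_eq_of_continuousOn hd.isOpen H.continuousOn H.eq_zero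
        H.abs_deriv_le, hmean]
    simp
  rw [key, ← Real.norm_eq_abs]
  have hb : ∫ x, ((2 * C * ρ₁ (G x) + 2 * C * ρ₂ (G x)) +
      2 * C * K * |τ x - pearsonB b₀ b₁ b₂ (G x)|) ∂μ ≤
      (2 * κ₁ + 2 * κ₂ + 2 * K) * C * ∫ x, |τ x - pearsonB b₀ b₁ b₂ (G x)| ∂μ := by
    rw [integral_add ((iρ₁.const_mul _).fun_add (iρ₂.const_mul _)) (iB.abs.const_mul _),
      integral_add (iρ₁.const_mul _) (iρ₂.const_mul _)]
    simp_rw [integral_const_mul]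
    have k1 := hκ₁ μ G τ hS
    have k2 := hκ₂ μ _ τ hS.neg
    simp only [show ∀ x, pearsonB b₀ (-b₁) b₂ (-x) = pearsonB b₀ b₁ b₂ x by
      intro x; simp [pearsonB]] at k2
    have k1' := mul_le_mul_of_nonneg_left k1 hC
    have k2' := mul_le_mul_of_nonneg_left k2 hC
    linarith
  refine (norm_integral_le_of_norm_le (((iρ₁.const_mul _).fun_add (iρ₂.const_mul _)).fun_add
    (iB.abs.const_mul (2 * C * K))) (Eventually.of_forall fun x => ?_)).trans hb
  refine (norm_sub_le _ _).trans (add_le_add (hres (G x)) ?_)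
  rw [norm_mul, mul_comm, Real.norm_eq_abs, Real.norm_eq_abs]
  exact mul_le_mul_of_nonneg_right (H.abs_deriv_le _) (abs_nonneg _)

end IsPearsonDensity

/-- A Pearson distribution with a finite fourth moment has a Pearson density. -/
theorem IsPearson.exists_isPearsonDensity {m b₀ b₁ b₂ : ℝ} {ν : Measure ℝ}
    (hν : IsPearson m b₀ b₁ b₂ ν) (hν4 : Integrable (fun x => x ^ 4) ν) :
    ∃ I p, IsPearsonDensity m b₀ b₁ b₂ I p ∧ ∀ h : ℝ → ℝ, ∫ x, h x ∂ν = ∫ y, h y * p y := by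
  obtain ⟨hprob, I, p, hI, hconn, hp, hpos, hzero, hνp, -, hid, hb⟩ := hν
  have hp0 : ∀ x, 0 ≤ p x := fun x => by
    by_cases hx : x ∈ I
    exacts [(hpos x hx).le, (hzero x hx).ge]
  have hfin : ∀ᵐ x : ℝ, ENNReal.ofReal (p x) < ⊤ := Eventually.of_forall fun x => by simp
  have hint : ∀ h : ℝ → ℝ, ∫ x, h x ∂ν = ∫ y, h y * p y := fun h => by
    rw [hνp, integral_withDensity_eq_integral_toReal_smul hp.ennreal_ofReal hfin]
    refine integral_congr_ae (Eventually.of_forall fun x => ?_)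
    simp only [ENNReal.toReal_ofReal (hp0 x), smul_eq_mul]
    ring
  have hintble : ∀ h : ℝ → ℝ, Integrable h ν → Integrable fun y => h y * p y := fun h hh => by
    rw [hνp, integrable_withDensity_iff_integrable_smul' hp.ennreal_ofReal hfin] at hh
    refine hh.congr (Eventually.of_forall fun x => ?_)
    simp only [ENNReal.toReal_ofReal (hp0 x), smul_eq_mul]
    ring
  refine ⟨I, p, ⟨hI, hconn, hp, hpos, hzero, ?_, hintble _ hν4, ?_, ?_, fun x hx => ?_⟩, hint⟩
  · simpa using hintble (fun _ => 1) (integrable_const 1)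
  · simpa using (hint fun _ => 1).symm
  · rw [← hid, hint]
  · rw [hb x hx, div_mul_cancel₀ _ (hpos x hx).ne']

theorem AbsolutelyContinuousOnInterval.abs_sub_le {h : ℝ → ℝ} {C x y : ℝ}
    (hac : AbsolutelyContinuousOnInterval h y x) (hC : ∀ᵐ t : ℝ, |deriv h t| ≤ C) :
    |h x - h y| ≤ C * |x - y| := by
  rw [← hac.integral_deriv_eq_sub, ← Real.norm_eq_abs]
  exact intervalIntegral.norm_integral_le_of_norm_le_const_ae (hC.mono fun t ht _ => ht)

theorem continuous_of_abs_sub_le {h : ℝ → ℝ} {C : ℝ} (hC : 0 ≤ C)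
    (hh : ∀ x y, |h x - h y| ≤ C * |x - y|) : Continuous h :=
  (LipschitzWith.of_dist_le_mul (K := ⟨C, hC⟩) fun x y => hh x y).continuous

theorem integral_abs_le_sqrt_integral_sq {E : Type*} [MeasurableSpace E] {μ : Measure E}
    [IsProbabilityMeasure μ] {f : E → ℝ} (hf : MemLp f 2 μ) :
    ∫ x, |f x| ∂μ ≤ √(∫ x, f x ^ 2 ∂μ) := by
  have h := (integral_abs_le_sqrt_mul_sqrt hf.integrable_sq (integrable_const (1 : ℝ)) hf.1
    (Eventually.of_forall fun x => sq_nonneg _) (Eventually.of_forall fun _ => zero_le_one)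
    (Eventually.of_forall fun x => by simp)).2
  simpa using h

theorem proposition3p5
    (m b₀ b₁ b₂ : ℝ) (ν : Measure ℝ) (hν : IsPearson m b₀ b₁ b₂ ν)
    (hν4 : Integrable (fun x => x ^ 4) ν)
    (H : Set (ℝ → ℝ)) (hsep : IsSeparating H) (hder : HasBoundedDerivatives H) :
    ∃ c : ℝ, 0 < c ∧
      ∀ {E : Type*} [MeasurableSpace E] (μ : Measure E) [IsProbabilityMeasure μ]
        (M : FullMarkovTriple μ) (F : E → ℝ) (lam η : ℝ),
        M.IsChaotic lam F η → MemLp F 4 μ →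
      ∀ {Ω : Type*} [MeasurableSpace Ω] (P : Measure Ω) (Z : Ω → ℝ),
        AEMeasurable Z P → P.map Z = ν →
      ∀ G : E → ℝ, (G = fun x => F x + m) →
        IsAdmissible H (μ.map G) (P.map Z) →
        (η ≤ 2 * (1 - b₂) →
          lawDist H (μ.map G) (P.map Z) ≤
            ENNReal.ofReal (c * √((1 - b₂ - η / 4) * ∫ x, pearsonU m b₀ b₁ b₂ (G x) ∂μ))) ∧
        (2 * (1 - b₂) < η →
          ∀ ξ : ℝ, ξ = η - 2 * (1 - b₂) →
          lawDist H (μ.map G) (P.map Z) ≤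
            ENNReal.ofReal (c * √((1 - b₂ - η / 4) * ∫ x, pearsonU m b₀ b₁ b₂ (G x) ∂μ
              + ξ * (1 - b₂) / 2 * ∫ x, pearsonQ m b₀ b₁ b₂ (G x) ^ 2 ∂μ))) := by
  obtain ⟨I, p, hd, hint⟩ := hν.exists_isPearsonDensity hν4
  have hb := hd.lt_half
  obtain ⟨κ, hκ, hstein⟩ := hd.exists_stein_bound
  obtain ⟨hac, C, hC⟩ := hder
  have hlip : ∀ h ∈ H, ∀ x y, |h x - h y| ≤ max C 0 * |x - y| := fun h hh x y =>
    (hac h hh y x).abs_sub_le ((hC h hh).mono fun t ht => ht.trans (le_max_left _ _))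
  set D := max C 0
  have hD : 0 ≤ D := le_max_right _ _
  refine ⟨κ * D * √2 + 1, by positivity, ?_⟩
  intro E _ μ _ M F lam η hchaos hF4 Ω _ P Z hZ hPZ G hG hadm
  obtain ⟨hF0, τ, hS, hL⟩ := hchaos.exists_isSteinKernel hF4 M.hasGenerator_one m
  have hsq := hS.integral_sq_sub_pearsonB_le (b₀ := b₀) (b₁ := b₁) hb hF4 hF0 hL
  rw [← hG] at hS
  have hGm : ∫ x, G x ∂μ = m := by
    rw [hG, integral_add (hF4.integrable (by norm_num)) (integrable_const m), hF0]
    simp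
  have hτ : MemLp (fun x => τ x - pearsonB b₀ b₁ b₂ (G x)) 2 μ :=
    hS.memLp_kernel.sub (MemLp.quadratic_of_four hS.memLp b₂ b₁ b₀)
  have hmain : ∀ X : ℝ, ∫ x, (τ x - pearsonB b₀ b₁ b₂ (G x)) ^ 2 ∂μ ≤ 2 * X →
      lawDist H (μ.map G) (P.map Z) ≤ ENNReal.ofReal ((κ * D * √2 + 1) * √X) := by
    intro X hX
    refine iSup₂_le fun h hh => ENNReal.ofReal_le_ofReal ?_
    rw [hPZ, hint, integral_map hS.memLp.1.aemeasurable (hsep.1 h hh).aestronglyMeasurable]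
    calc _ ≤ κ * D * ∫ x, |τ x - pearsonB b₀ b₁ b₂ (G x)| ∂μ :=
          hstein μ G τ hS hGm h D hD (hlip h hh) (continuous_of_abs_sub_le hD (hlip h hh))
      _ ≤ κ * D * √(2 * X) := mul_le_mul_of_nonneg_left
          ((integral_abs_le_sqrt_integral_sq hτ).trans (Real.sqrt_le_sqrt hX)) (by positivity)
      _ = κ * D * √2 * √X := by rw [Real.sqrt_mul (by norm_num)]; ring
      _ ≤ _ := mul_le_mul_of_nonneg_right (by linarith) (Real.sqrt_nonneg _)
  have hQ : 0 ≤ ∫ x, pearsonQ m b₀ b₁ b₂ (G x) ^ 2 ∂μ := integral_nonneg fun x => sq_nonneg _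
  simp only [← congrFun hG] at hsq
  have hb1 : 0 ≤ (1 - b₂) / 2 * ∫ x, pearsonQ m b₀ b₁ b₂ (G x) ^ 2 ∂μ :=
    mul_nonneg (by linarith) hQ
  refine ⟨fun hη => hmain _ ?_, fun hη ξ hξ => hmain _ ?_⟩
  · have := mul_nonneg (sub_nonneg.2 hη) hb1
    linarith
  · have := mul_nonneg (sub_nonneg.2 hη.le) hb1
    rw [hξ]
    linarith
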